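/- Let $k\ge 1$, $n\ge 1$, and let $M$ be a smooth $n$-dimensional oriented manifold (Hausdorff, $\sigma$-compact, without boundary). A $b^k$-manifold structure on $M$ consists of an oriented hypersurface $Z\subseteq M$ (closed and embedded) and a jet $j_Z\in C^\infty/\mathcal I_Z^{k}$ along $Z$, where $\mathcal I_Z$ is the ideal of functions vanishing on $Z$, such that $j_Z$ is represented by a positively oriented local defining function. Here a local defining function $y$ for $Z$ is a smooth function on an open neighbourhood of $Z$ with zero set $Z$ and $dy\neq 0$ along $Z$; it is positively oriented if $dy\wedge\Omega_Z$ is positive on $M$ for every positive volume form $\Omega_Z$ of $Z$. A $b^k$-vector field is a smooth vector field $v$ on $M$ that is tangent to $Z$ along $Z$ and satisfies $\mathcal L_v f\in\mathcal I_Z^{k}$ for all $f\in j_Z$; the $b^k$-vector fields are the sections of a vector bundle ${}^{b^k}TM$. A $b^k$-form of degree $p$ is a smooth section of $\Lambda^p({}^{b^k}T^*M)$; equivalently, it is a smooth $p$-form on $M\setminus Z$ whose pairings with $b^k$-vector fields extend to smooth functions on $M$. The differential of a $b^k$-form is the extension over $Z$ of its ordinary differential on $M\setminus Z$, and ${}^{b^k}H^*_c(M)$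 is the cohomology of the complex of compactly supported $b^k$-forms. For a compactly supported $b^k$-form $\omega$ of degree $n$, a local defining function $y\in j_Z$ and $\epsilon>0$, put $U_{y,\epsilon}=\{|y|<\epsilon\}$ and $$\mathrm{vol}_{y,\epsilon}(\omega)=\int_{M\setminus U_{y,\epsilon}}\omega .$$ **Theorem.** Suppose that $Z$ is compact and let $[\omega]\in {}^{b^k}H^n_c(M)$. The integrals $\mathrm{vol}_{y,\epsilon}(\omega)$ converge absolutely, for every local defining function $y\in j_Z$, every representative $\omega$ of $[\omega]$ and every $\epsilon>0$. There is exactly one polynomial $P_{[\omega]}$ with real coefficients such that $$\lim_{\epsilon\to 0^+}\bigl(P_{[\omega]}(\epsilon^{-1})-\mathrm{vol}_{y,\epsilon}(\omega)\bigr)=0$$ for every local defining function $y\in j_Z$ and every compactly supported $b^k$-form $\omega$ that represents $[\omega]$. This polynomial is the volume polynomial of $[\omega]$, and its constant term is, by definition, the Liouville volume of $[\omega]$. -/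

import Mathlib

open Set Filter Topology MeasureTheory
open scoped Manifold ContDiff

noncomputable section

namespace BK

/-! ### Differential forms and orientations on a manifold modelled on `ℝ^n` -/

section Forms

variable {n : ℕ} {M : Type*} [TopologicalSpace M] [ChartedSpace (EuclideanSpace ℝ (Fin n)) M]

/-- Not necessarily continuous differential `p`-forms on an `n`-dimensional manifold `M`. -/
def Form (n : ℕ) (M : Type*) [TopologicalSpace M] [ChartedSpace (EuclideanSpace ℝ (Fin n)) M]
    (p : ℕ) : Type _ :=
  ∀ x : M, TangentSpace (𝓡 n) x [⋀^Fin p]→L[ℝ] ℝ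

instance (p : ℕ) : AddCommGroup (Form n M p) :=
  inferInstanceAs (AddCommGroup (∀ x : M, TangentSpace (𝓡 n) x [⋀^Fin p]→L[ℝ] ℝ))

instance (p : ℕ) : Module ℝ (Form n M p) :=
  inferInstanceAs (Module ℝ (∀ x : M, TangentSpace (𝓡 n) x [⋀^Fin p]→L[ℝ] ℝ))

lemma Form.add_apply {p : ℕ} (θ η : Form n M p) (x : M) : (θ + η) x = θ x + η x := rfl

lemma Form.zero_apply {p : ℕ} (x : M) : (0 : Form n M p) x = 0 := rfl

lemma Form.smul_apply {p : ℕ} (a : ℝ) (θ : Form n M p) (x : M) : (a • θ) x = a • θ x := rfl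

/-- The derivative of the inverse of the preferred chart `φ` at `c`, at a point `u` of its target,
as a linear map `ℝ^n → T_{φ⁻¹(u)} M`. -/
def chartDeriv (c : M) (u : EuclideanSpace ℝ (Fin n)) :
    EuclideanSpace ℝ (Fin n) →L[ℝ]
      TangentSpace (𝓡 n) ((chartAt (EuclideanSpace ℝ (Fin n)) c).symm u) :=
  mfderiv (𝓡 n) (𝓡 n) (chartAt (EuclideanSpace ℝ (Fin n)) c).symm u

/-- The expression of a form in the preferred chart `φ` at `c`, that is, the pullback
`(φ⁻¹)^* θ`, a form on the target of `φ` in `ℝ^n`. -/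
def localRep {p : ℕ} (θ : Form n M p) (c : M) (u : EuclideanSpace ℝ (Fin n)) :
    EuclideanSpace ℝ (Fin n) [⋀^Fin p]→L[ℝ] ℝ :=
  (θ ((chartAt (EuclideanSpace ℝ (Fin n)) c).symm u)).compContinuousLinearMap (chartDeriv c u)

/-- `θ` is smooth on the open set `U`. -/
def SmoothFormOn {p : ℕ} (U : Set M) (θ : Form n M p) : Prop :=
  ∀ c : M, ContDiffOn ℝ ∞ (localRep θ c)
    ((chartAt (EuclideanSpace ℝ (Fin n)) c).target ∩
      (chartAt (EuclideanSpace ℝ (Fin n)) c).symm ⁻¹' U)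

/-- The exterior derivative, computed at every point `x` in the preferred chart at `x`. -/
def extDerivForm {p : ℕ} (θ : Form n M p) : Form n M (p + 1) := fun x =>
  (extDeriv (localRep θ x) (chartAt (EuclideanSpace ℝ (Fin n)) x x)).compContinuousLinearMap
    (mfderiv (𝓡 n) (𝓡 n) (chartAt (EuclideanSpace ℝ (Fin n)) x) x)

/-- The support of `θ` in `M`. -/
def formSupport {p : ℕ} (θ : Form n M p) : Set M := closure {x | θ x ≠ 0}

/-- The coordinate frame `∂/∂x_1, …, ∂/∂x_n` of the preferred chart at `c`, at the point with
coordinates `u`. -/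
def coordFrame (c : M) (u : EuclideanSpace ℝ (Fin n)) (i : Fin n) :
    TangentSpace (𝓡 n) ((chartAt (EuclideanSpace ℝ (Fin n)) c).symm u) :=
  chartDeriv c u (EuclideanSpace.single i 1)

/-- `1` if `e` is a positively oriented frame, `-1` if it is a negatively oriented one, `0` if `e`
is linearly dependent (for `V` of dimension `m`). -/
def frameSign {V : Type*} [AddCommGroup V] [Module ℝ V] {m : ℕ} (o : Orientation ℝ V (Fin m))
    (e : Fin m → V) : SignType :=
  SignType.sign (o.someVector e)

/-- Orientations of all tangent spaces of `M`. -/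
abbrev OrientationField (n : ℕ) (M : Type*) [TopologicalSpace M]
    [ChartedSpace (EuclideanSpace ℝ (Fin n)) M] : Type _ :=
  ∀ x : M, Orientation ℝ (TangentSpace (𝓡 n) x) (Fin n)

/-- The sign of the coordinate frame of the preferred chart at `c` with respect to `o`. -/
def chartSign (o : OrientationField n M) (c : M) (u : EuclideanSpace ℝ (Fin n)) : SignType :=
  frameSign (o ((chartAt (EuclideanSpace ℝ (Fin n)) c).symm u)) (coordFrame c u)

/-- The pointwise orientations `o` are an orientation of `M`: the sign of the coordinate frame is
locally constant in every preferred chart. -/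
def IsManifoldOrientation (o : OrientationField n M) : Prop :=
  ∀ c : M, ContinuousOn (chartSign o c) (chartAt (EuclideanSpace ℝ (Fin n)) c).target

/-- A smooth partition of unity subordinate to the domains of the preferred charts. -/
def chartPartition (n : ℕ) (M : Type*) [TopologicalSpace M]
    [ChartedSpace (EuclideanSpace ℝ (Fin n)) M] [IsManifold (𝓡 n) ∞ M] [T2Space M]
    [SigmaCompactSpace M] : SmoothPartitionOfUnity M (𝓡 n) M univ :=
  (SmoothPartitionOfUnity.exists_isSubordinate_chartAt_source (𝓡 n) M).choose

variable [IsManifold (𝓡 n) ∞ M] [T2Space M] [SigmaCompactSpace M]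

/-- The part of `A` in the domain of the preferred chart at `c`, in coordinates. -/
def chartPart (n : ℕ) {M : Type*} [TopologicalSpace M] [ChartedSpace (EuclideanSpace ℝ (Fin n)) M]
    (A : Set M) (c : M) : Set (EuclideanSpace ℝ (Fin n)) :=
  (chartAt (EuclideanSpace ℝ (Fin n)) c).target ∩
    (chartAt (EuclideanSpace ℝ (Fin n)) c).symm ⁻¹' A

/-- The function `u ↦ ± ρ_c f` on the target of the preferred chart at `c`, where `ρ_c` is the
member of the partition of unity belonging to this chart, `f du_1 ∧ ⋯ ∧ du_n` is the expression of
`θ` in the chart, and the sign is `1` or `-1` as the chart preserves or reverses orientation. -/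
def chartIntegrand (o : OrientationField n M) (θ : Form n M n) (c : M)
    (u : EuclideanSpace ℝ (Fin n)) : ℝ :=
  chartPartition n M c ((chartAt (EuclideanSpace ℝ (Fin n)) c).symm u) *
    (((chartSign o c u : SignType) : ℝ) *
      θ ((chartAt (EuclideanSpace ℝ (Fin n)) c).symm u) (coordFrame c u))

/-- The `n`-form `θ` is absolutely integrable over `A`, and only finitely many charts contribute. -/
def FormIntegrableOn (o : OrientationField n M) (A : Set M) (θ : Form n M n) : Prop :=
  (∀ c : M, IntegrableOn (chartIntegrand o θ c) (chartPart n A c)) ∧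
    {c : M | ∃ u ∈ chartPart n A c, chartIntegrand o θ c u ≠ 0}.Finite

/-- `∫_A θ`, the integral over `A` of an `n`-form on an oriented `n`-dimensional manifold. -/
def formIntegral (o : OrientationField n M) (A : Set M) (θ : Form n M n) : ℝ :=
  ∑ᶠ c : M, ∫ u in chartPart n A c, chartIntegrand o θ c u

end Forms

/-! ### Hypersurfaces, jets, local defining functions -/

section Hypersurfaces

variable {n : ℕ} {M : Type*} [TopologicalSpace M] [ChartedSpace (EuclideanSpace ℝ (Fin n)) M]

/-- The ideal `I_Z` of the smooth functions on `M` that vanish on `Z`. -/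
def vanishingIdeal (n : ℕ) {M : Type*} [TopologicalSpace M]
    [ChartedSpace (EuclideanSpace ℝ (Fin n)) M] (Z : Set M) : Ideal C^∞⟮𝓡 n, M; ℝ⟯ where
  carrier := {f | ∀ x ∈ Z, f x = 0}
  add_mem' {f g} hf hg x hx := by simp [hf x hx, hg x hx]
  zero_mem' x _ := by simp
  smul_mem' g f hf x hx := by simp [hf x hx]

/-- The `(k-1)`-jets `C^∞ / I_Z^k` along the closed set `Z`. As `Z` is closed and `M` has smooth
partitions of unity, every section along `Z` of the quotient sheaf comes from a global function,
and two global functions give the same section iff they differ by an element of `I_Z^k`. -/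
abbrev Jet (n : ℕ) {M : Type*} [TopologicalSpace M]
    [ChartedSpace (EuclideanSpace ℝ (Fin n)) M] (Z : Set M) (k : ℕ) : Type _ :=
  C^∞⟮𝓡 n, M; ℝ⟯ ⧸ (vanishingIdeal n Z) ^ k

/-- The tangent space of the hypersurface `Z` at `x ∈ Z`: the vectors that annihilate all smooth
functions vanishing on `Z`. -/
def hypersurfaceTangent (n : ℕ) {M : Type*} [TopologicalSpace M]
    [ChartedSpace (EuclideanSpace ℝ (Fin n)) M] (Z : Set M) (x : M) :
    Submodule ℝ (TangentSpace (𝓡 n) x) :=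
  ⨅ f ∈ vanishingIdeal n Z, LinearMap.ker (mfderiv (𝓡 n) 𝓘(ℝ, ℝ) (⇑f) x).toLinearMap

/-- A local defining function for `Z`: a smooth function `y` on an open neighbourhood `dom` of `Z`
with zero set `Z` and with `dy ≠ 0` along `Z`. The values of `toFun` off `dom` mean nothing. -/
structure LocalDefiningFunction (n : ℕ) {M : Type*} [TopologicalSpace M]
    [ChartedSpace (EuclideanSpace ℝ (Fin n)) M] (Z : Set M) where
  dom : Set M
  toFun : M → ℝ
  isOpen_dom : IsOpen dom
  subset_dom : Z ⊆ dom
  smooth : ContMDiffOn (𝓡 n) 𝓘(ℝ, ℝ) ∞ toFun dom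
  zero_iff : ∀ x ∈ dom, toFun x = 0 ↔ x ∈ Z
  deriv_ne_zero : ∀ x ∈ Z, mfderiv (𝓡 n) 𝓘(ℝ, ℝ) toFun x ≠ 0

/-- The directional derivative `df_x(w)` of a real function. -/
def dirDeriv {n : ℕ} {M : Type*} [TopologicalSpace M]
    [ChartedSpace (EuclideanSpace ℝ (Fin n)) M] (f : M → ℝ) (x : M) (w : TangentSpace (𝓡 n) x) : ℝ :=
  mfderiv (𝓡 n) 𝓘(ℝ, ℝ) f x w

/-- `y ∈ j`: the function `y` represents the jet `j`. -/
def LocalDefiningFunction.Represents {Z : Set M} {k : ℕ} (y : LocalDefiningFunction n Z)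
    (j : Jet n Z k) : Prop :=
  ∃ f : C^∞⟮𝓡 n, M; ℝ⟯, Ideal.Quotient.mk ((vanishingIdeal n Z) ^ k) f = j ∧
    ∀ᶠ x in 𝓝ˢ Z, f x = y.toFun x

/-- The neighbourhood `{|y| < ε}` of `Z`. -/
def LocalDefiningFunction.tube {Z : Set M} (y : LocalDefiningFunction n Z) (ε : ℝ) : Set M :=
  {x | x ∈ y.dom ∧ |y.toFun x| < ε}

end Hypersurfaces

/-- Orientations of all tangent spaces of a hypersurface `Z` of an `(m+1)`-dimensional manifold. -/
abbrev HypersurfaceOrientation (m : ℕ) {M : Type*} [TopologicalSpace M]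
    [ChartedSpace (EuclideanSpace ℝ (Fin (m + 1))) M] (Z : Set M) : Type _ :=
  ∀ z : Z, Orientation ℝ (hypersurfaceTangent (m + 1) Z (z : M)) (Fin m)

/-- `y` is positively oriented: if `Ω` is a positive volume form of `Z`, then `dy ∧ Ω` is positive
on `M`. This is tested on the tuples `(w, b_1, …, b_m)` with `w` tangent to `M` and the `b_i`
tangent to `Z`, on which `dy ∧ Ω` has the value `dy(w) Ω(b_1, …, b_m)`. -/
def LocalDefiningFunction.IsPositive {m : ℕ} {M : Type*} [TopologicalSpace M]
    [ChartedSpace (EuclideanSpace ℝ (Fin (m + 1))) M] {Z : Set M}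
    (y : LocalDefiningFunction (m + 1) Z) (o : OrientationField (m + 1) M)
    (oZ : HypersurfaceOrientation m Z) : Prop :=
  ∀ (z : Z) (w : TangentSpace (𝓡 (m + 1)) (z : M))
    (b : Fin m → hypersurfaceTangent (m + 1) Z (z : M)),
    frameSign (o z) (Matrix.vecCons w fun i => (b i : TangentSpace (𝓡 (m + 1)) (z : M))) =
      SignType.sign (dirDeriv y.toFun (z : M) w) * frameSign (oZ z) b

/-! ### `b^k`-manifolds, `b^k`-vector fields, `b^k`-forms -/

/-- A `b^k`-structure on the `(m+1)`-dimensional manifold `M`: an orientation of `M`, an oriented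
(closed, embedded) hypersurface `Z`, and a `(k-1)`-jet along `Z` that is represented by a positively
oriented local defining function. That `Z` is an embedded hypersurface and that its pointwise
orientations vary continuously follows from the existence of this function. -/
structure BkStructure (k m : ℕ) (M : Type*) [TopologicalSpace M]
    [ChartedSpace (EuclideanSpace ℝ (Fin (m + 1))) M] where
  orientation : OrientationField (m + 1) M
  isOrientation : IsManifoldOrientation orientation
  Z : Set M
  isClosed_Z : IsClosed Z
  orientationZ : HypersurfaceOrientation m Z
  jet : Jet (m + 1) Z k
  exists_positive : ∃ y : LocalDefiningFunction (m + 1) Z,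
    y.IsPositive orientation orientationZ ∧ y.Represents jet

section Bk

variable {k m : ℕ} {M : Type*} [TopologicalSpace M]
  [ChartedSpace (EuclideanSpace ℝ (Fin (m + 1))) M] [IsManifold (𝓡 (m + 1)) ∞ M]

/-- A `b^k`-vector field: a smooth vector field on `M` that is tangent to `Z` along `Z` and such
that the derivative along it of any function in the jet of the `b^k`-structure lies in `I_Z^k`. -/
structure BkVectorField (B : BkStructure k m M) where
  toFun : ∀ x : M, TangentSpace (𝓡 (m + 1)) x
  smooth : ContMDiff (𝓡 (m + 1)) (𝓡 (m + 1)).tangent ∞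
    (fun x => (⟨x, toFun x⟩ : TangentBundle (𝓡 (m + 1)) M))
  tangent : ∀ x ∈ B.Z, toFun x ∈ hypersurfaceTangent (m + 1) B.Z x
  lie_mem : ∀ f : C^∞⟮𝓡 (m + 1), M; ℝ⟯,
    Ideal.Quotient.mk ((vanishingIdeal (m + 1) B.Z) ^ k) f = B.jet →
      ∃ g ∈ (vanishingIdeal (m + 1) B.Z) ^ k,
        ∀ x, g x = dirDeriv (⇑f) x (toFun x)

/-- `b^k`-forms, that is, smooth sections of the exterior power of the bundle dual to the bundle
whose sections are the `b^k`-vector fields. Off `Z` the fibres of this bundle are the ordinary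
tangent spaces, and the complement of `Z` is dense, so such a section is the same thing as an
ordinary smooth form on `M ∖ Z` whose pairings with `b^k`-vector fields all extend to smooth
functions on `M`. The value of `θ` on `Z`, which means nothing here, is set to `0`. -/
structure IsBkForm (B : BkStructure k m M) {p : ℕ} (θ : Form (m + 1) M p) : Prop where
  eq_zero : ∀ x ∈ B.Z, θ x = 0
  smooth : SmoothFormOn B.Zᶜ θ
  pairing : ∀ v : Fin p → BkVectorField B, ∃ F : C^∞⟮𝓡 (m + 1), M; ℝ⟯,
    ∀ x ∉ B.Z, F x = θ x (fun i => (v i).toFun x)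

lemma localRep_add {n p : ℕ} {M : Type*} [TopologicalSpace M]
    [ChartedSpace (EuclideanSpace ℝ (Fin n)) M] (θ η : Form n M p) (c : M) :
    localRep (θ + η) c = localRep θ c + localRep η c := by
  ext u v; rfl

lemma localRep_smul {n p : ℕ} {M : Type*} [TopologicalSpace M]
    [ChartedSpace (EuclideanSpace ℝ (Fin n)) M] (a : ℝ) (θ : Form n M p) (c : M) :
    localRep (a • θ) c = a • localRep θ c := by
  ext u v; rfl

lemma localRep_zero {n p : ℕ} {M : Type*} [TopologicalSpace M]
    [ChartedSpace (EuclideanSpace ℝ (Fin n)) M] (c : M) :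
    localRep (0 : Form n M p) c = 0 := by
  ext u v; rfl

lemma extDerivForm_add {n p : ℕ} {M : Type*} [TopologicalSpace M]
    [ChartedSpace (EuclideanSpace ℝ (Fin n)) M] {U : Set M} (hU : IsOpen U) {θ η : Form n M p}
    (hθ : SmoothFormOn U θ) (hη : SmoothFormOn U η) {x : M} (hx : x ∈ U) :
    extDerivForm (θ + η) x = extDerivForm θ x + extDerivForm η x := by
  have key : ∀ {ζ : Form n M p}, SmoothFormOn U ζ → DifferentiableAt ℝ (localRep ζ x)
      (chartAt (EuclideanSpace ℝ (Fin n)) x x) := by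
    intro ζ hζ
    refine ((hζ x).contDiffAt ?_).differentiableAt (by simp)
    refine ((chartAt (EuclideanSpace ℝ (Fin n)) x).isOpen_inter_preimage_symm hU).mem_nhds ?_
    simp [hx]
  unfold extDerivForm
  rw [localRep_add, extDeriv_add (key hθ) (key hη)]
  ext v; rfl

lemma extDerivForm_smul {n p : ℕ} {M : Type*} [TopologicalSpace M]
    [ChartedSpace (EuclideanSpace ℝ (Fin n)) M] (a : ℝ) (θ : Form n M p) (x : M) :
    extDerivForm (a • θ) x = a • extDerivForm θ x := by
  unfold extDerivForm
  rw [localRep_smul, extDeriv_smul]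
  ext v; rfl

lemma extDerivForm_zero {n p : ℕ} {M : Type*} [TopologicalSpace M]
    [ChartedSpace (EuclideanSpace ℝ (Fin n)) M] (x : M) :
    extDerivForm (0 : Form n M p) x = 0 := by
  simpa using extDerivForm_smul (0 : ℝ) (0 : Form n M p) x

/-- The space of compactly supported `b^k`-forms of degree `p`. -/
def bkFormsC (B : BkStructure k m M) (p : ℕ) : Submodule ℝ (Form (m + 1) M p) where
  carrier := {θ | IsBkForm B θ ∧ IsCompact (formSupport θ)}
  add_mem' := by
    rintro θ η ⟨hθ, hθc⟩ ⟨hη, hηc⟩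
    refine ⟨⟨fun x hx => ?_, fun c => ?_, fun v => ?_⟩, ?_⟩
    · rw [Form.add_apply, hθ.eq_zero x hx, hη.eq_zero x hx, add_zero]
    · rw [localRep_add]; exact (hθ.smooth c).add (hη.smooth c)
    · obtain ⟨F, hF⟩ := hθ.pairing v
      obtain ⟨G, hG⟩ := hη.pairing v
      refine ⟨F + G, fun x hx => ?_⟩
      rw [ContMDiffMap.coe_add, Pi.add_apply, hF x hx, hG x hx]; rfl
    · refine (hθc.union hηc).of_isClosed_subset isClosed_closure ?_
      unfold formSupport
      rw [← closure_union]
      refine closure_mono fun x hx => ?_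
      by_contra h
      simp only [mem_union, mem_ofPred_eq, not_or, not_not] at h
      exact hx (by rw [Form.add_apply, h.1, h.2, add_zero])
  zero_mem' := by
    refine ⟨⟨fun x _ => rfl, fun c => ?_, fun v => ⟨0, fun x _ => rfl⟩⟩, ?_⟩
    · rw [localRep_zero]; exact contDiffOn_const
    · simp [formSupport, Form.zero_apply]
  smul_mem' := by
    rintro a θ ⟨hθ, hθc⟩
    refine ⟨⟨fun x hx => ?_, fun c => ?_, fun v => ?_⟩, ?_⟩
    · rw [Form.smul_apply, hθ.eq_zero x hx, smul_zero]
    · rw [localRep_smul]; exact contDiffOn_const.smul (hθ.smooth c)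
    · obtain ⟨F, hF⟩ := hθ.pairing v
      refine ⟨a • F, fun x hx => ?_⟩
      rw [ContMDiffMap.coe_smul, Pi.smul_apply, hF x hx]; rfl
    · refine hθc.of_isClosed_subset isClosed_closure (closure_mono fun x hx h => hx ?_)
      rw [Form.smul_apply, h, smul_zero]

lemma bkFormsC_smooth {B : BkStructure k m M} {p : ℕ} {θ : Form (m + 1) M p}
    (h : θ ∈ bkFormsC B p) : SmoothFormOn B.Zᶜ θ := h.1.smooth

/-- The closed compactly supported `b^k`-forms. The differential of a `b^k`-form is the extension
over `Z` of its ordinary differential on `M ∖ Z`. -/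
def closedFormsC (B : BkStructure k m M) (p : ℕ) : Submodule ℝ (Form (m + 1) M p) where
  carrier := {θ | θ ∈ bkFormsC B p ∧ ∀ x ∉ B.Z, extDerivForm θ x = 0}
  add_mem' := by
    rintro θ η ⟨hθ, hθz⟩ ⟨hη, hη0⟩
    refine ⟨add_mem hθ hη, fun x hx => ?_⟩
    rw [extDerivForm_add B.isClosed_Z.isOpen_compl (bkFormsC_smooth hθ) (bkFormsC_smooth hη) hx,
      hθz x hx, hη0 x hx, add_zero]
  zero_mem' := ⟨zero_mem _, fun x _ => extDerivForm_zero x⟩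
  smul_mem' := by
    rintro a θ ⟨hθ, hθz⟩
    exact ⟨Submodule.smul_mem _ _ hθ, fun x hx => by rw [extDerivForm_smul, hθz x hx, smul_zero]⟩

/-- The differentials of the compactly supported `b^k`-forms of degree `p - 1`. -/
def exactFormsC (B : BkStructure k m M) : (p : ℕ) → Submodule ℝ (Form (m + 1) M p)
  | 0 => ⊥
  | p + 1 =>
    { carrier := {θ | θ ∈ bkFormsC B (p + 1) ∧
        ∃ η ∈ bkFormsC B p, ∀ x ∉ B.Z, θ x = extDerivForm η x}
      add_mem' := by
        rintro θ θ' ⟨hθ, η, hη, h⟩ ⟨hθ', η', hη', h'⟩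
        refine ⟨add_mem hθ hθ', η + η', add_mem hη hη', fun x hx => ?_⟩
        rw [extDerivForm_add B.isClosed_Z.isOpen_compl (bkFormsC_smooth hη)
          (bkFormsC_smooth hη') hx, Form.add_apply, h x hx, h' x hx]
      zero_mem' := ⟨zero_mem _, 0, zero_mem _, fun x _ => (extDerivForm_zero x).symm⟩
      smul_mem' := by
        rintro a θ ⟨hθ, η, hη, h⟩
        refine ⟨Submodule.smul_mem _ _ hθ, a • η, Submodule.smul_mem _ _ hη, fun x hx => ?_⟩
        rw [extDerivForm_smul, Form.smul_apply, h x hx] }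

/-- The `b^k`-cohomology with compact supports in degree `p`: closed forms modulo exact ones. -/
abbrev BkCohomologyC (B : BkStructure k m M) (p : ℕ) : Type _ :=
  closedFormsC B p ⧸ (exactFormsC B p).submoduleOf (closedFormsC B p)

/-- The class `[θ]` in the `b^k`-cohomology with compact supports. -/
def bkClass {B : BkStructure k m M} {p : ℕ} (θ : closedFormsC B p) : BkCohomologyC B p :=
  Submodule.Quotient.mk θ

/-! ### The volume polynomial -/

variable [T2Space M] [SigmaCompactSpace M]

/-- `vol_{y, ε}(θ) = ∫_{M ∖ {|y| < ε}} θ`. -/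
def vol (B : BkStructure k m M) (y : LocalDefiningFunction (m + 1) B.Z) (ε : ℝ)
    (θ : Form (m + 1) M (m + 1)) : ℝ :=
  formIntegral B.orientation (y.tube ε)ᶜ θ

/-- `P(1/ε) - vol_{y, ε}(θ) → 0` as `ε → 0⁺`, for every local defining function `y` in the jet and
every form `θ` representing the class `a`. -/
def IsVolumePolynomial (B : BkStructure k m M) (a : BkCohomologyC B (m + 1))
    (P : Polynomial ℝ) : Prop :=
  ∀ y : LocalDefiningFunction (m + 1) B.Z, y.Represents B.jet →
    ∀ θ : closedFormsC B (m + 1), bkClass θ = a →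
      Tendsto (fun ε : ℝ => P.eval ε⁻¹ - vol B y ε (θ : Form (m + 1) M (m + 1))) (𝓝[>] 0) (𝓝 0)

open Classical in
/-- The volume polynomial of the class `a` (by convention `0` if there were none). -/
def volumePolynomial (B : BkStructure k m M) (a : BkCohomologyC B (m + 1)) : Polynomial ℝ :=
  if h : ∃ P, IsVolumePolynomial B a P then h.choose else 0

/-- The Liouville volume of the class `a`: the constant term of its volume polynomial. -/
def liouvilleVolume (B : BkStructure k m M) (a : BkCohomologyC B (m + 1)) : ℝ :=
  (volumePolynomial B a).eval 0

end Bk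

end BK

end

/-!
Fix a local defining function `y` in the jet, a global function `f` that agrees with `y` near `Z`,
and a bump function `q` that equals `1` near `Z` and is supported where `f` and `y` agree. The part
`(1 - q) θ` of a `b^k`-form `θ` of top degree is smooth with compact support. In a chart, `q θ` has
a pole of order at most `k` along `f = 0`: this is `IsBkForm.exists_smooth_mul`, proved by pairing
`θ` with `b^k`-vector fields constructed from `f` and from elements of `I_Z^k`. As `df ≠ 0` along
`Z`, integration over the level sets of `f` (`exists_density`) reduces the volume to integrals
`∫ Φ(t / ε) g(t) / t^k dt` over the line, where `g` is a test function and `Φ` is the indicator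
function of `1 ≤ |t|`. Taylor expansion of `g` yields a polynomial in `ε⁻¹`
(`hasExpansion_div_pow`); there is no logarithm since `Φ` is even.

This works for any even cutoff `Φ`, smooth or not, and the expansions for different cutoffs
determine each other: the constant terms agree and the coefficient of `ε⁻ʲ` is a constant
independent of `Φ` times a positive moment of `Φ` (`HasExpansion`, `expansionPoly_eq_of_eq`). So the
two invariance statements need to be proved for a smooth cutoff only. Both then follow from the
observation `tendsto_integral_concentrated`: if `ψ` has integral zero and vanishes outside a compact
set, then `ε⁻¹ ψ(f / ε)` tends to zero when it is integrated against smooth functions.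

* Independence of `y` (`IsBkForm.tendsto_sub`). For two functions `f` and `f'` in the jet,
  `Φ(f' / ε) - Φ(f / ε)` is the integral of `ε⁻¹ Φ'(f_σ / ε) (f' - f)` along an interpolation `f_σ`,
  and `(f' - f) θ` is smooth because `f' - f` lies in `I_Z^k`. The observation applies on the
  product of the chart with the line, provided that `df_σ ≠ 0` along `Z`. For `2 ≤ k` this holds
  since the jet determines `df` along `Z`. For `k = 1` one replaces `f'` by `-f'` near some
  components of `Z`; an even cutoff does not notice.
* Independence of `θ` (`tendsto_cutoffIntegral_of_exact`). If `θ = dη`, then by Stokes' theorem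
  (`formIntegral_extDerivForm_eq_zero`) the smoothed volume is, up to sign, the integral of
  `q ε⁻¹ Φ'(f / ε) df ∧ η`, and `df ∧ η` is smooth across `Z` (`IsBkForm.exists_smooth_wedge`).

The polynomial is unique because a polynomial in `ε⁻¹` that tends to zero vanishes.
-/

noncomputable section

namespace BK

/-! ### Cutoffs and asymptotic expansions in one variable -/

/-- An even measurable cutoff on the line that vanishes for `|s| < 1` and equals `1` for
`2 ≤ |s|`. The sharp cutoff `𝟙 {1 ≤ |s|}` and its smoothings are treated on an equal footing. -/
structure IsCutoff (Φ : ℝ → ℝ) : Prop where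
  measurable : Measurable Φ
  even : ∀ s, Φ (-s) = Φ s
  nonneg : ∀ s, 0 ≤ Φ s
  le_one : ∀ s, Φ s ≤ 1
  eq_zero : ∀ s, |s| < 1 → Φ s = 0
  eq_one : ∀ s, 2 ≤ |s| → Φ s = 1

/-- The sharp cutoff. -/
def sharpCutoff : ℝ → ℝ := indicator {s | 1 ≤ |s|} 1

lemma isCutoff_sharpCutoff : IsCutoff sharpCutoff where
  measurable := measurable_one.indicator (measurableSet_le measurable_const measurable_norm)
  even s := by simp [sharpCutoff, indicator]
  nonneg s := indicator_nonneg (fun _ _ => zero_le_one) s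
  le_one s := indicator_le_self' (fun _ _ => zero_le_one) s
  eq_zero s hs := by simp [sharpCutoff, hs]
  eq_one s hs := by
    have : 1 ≤ |s| := by linarith
    simp [sharpCutoff, this]

/-- A smooth cutoff. -/
def smoothCutoff (s : ℝ) : ℝ := Real.smoothTransition (s ^ 2 - 1)

lemma contDiff_smoothCutoff : ContDiff ℝ ∞ smoothCutoff :=
  Real.smoothTransition.contDiff.comp ((contDiff_id.pow 2).sub contDiff_const)

lemma isCutoff_smoothCutoff : IsCutoff smoothCutoff where
  measurable := contDiff_smoothCutoff.continuous.measurable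
  even s := by simp [smoothCutoff]
  nonneg s := Real.smoothTransition.nonneg _
  le_one s := Real.smoothTransition.le_one _
  eq_zero s hs := by
    refine Real.smoothTransition.zero_of_nonpos ?_
    have := sq_lt_one_iff_abs_lt_one s |>.2 hs
    linarith
  eq_one s hs := by
    refine Real.smoothTransition.one_of_one_le ?_
    have : (2 : ℝ) ^ 2 ≤ |s| ^ 2 := pow_le_pow_left₀ (by norm_num) hs 2
    rw [sq_abs] at this
    linarith

lemma IsCutoff.abs_le_one {Φ : ℝ → ℝ} (h : IsCutoff Φ) (s : ℝ) : |Φ s| ≤ 1 := by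
  rw [abs_of_nonneg (h.nonneg s)]; exact h.le_one s

lemma IsCutoff.eventually_div_eq_one {Φ : ℝ → ℝ} (h : IsCutoff Φ) {δ : ℝ} (hδ : 0 < δ) :
    ∀ᶠ ε in 𝓝[>] (0 : ℝ), ∀ t, δ ≤ |t| → Φ (t / ε) = 1 := by
  have h1 : ∀ᶠ ε in 𝓝[>] (0 : ℝ), ε < δ / 2 :=
    mem_nhdsWithin_of_mem_nhds (Iio_mem_nhds (by positivity))
  filter_upwards [h1, self_mem_nhdsWithin] with ε hε hε0 t ht
  have hε0 : 0 < ε := hε0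
  refine h.eq_one _ ?_
  rw [abs_div, abs_of_pos hε0, le_div_iff₀ hε0]
  linarith

/-- The `j`-th negative moment of a cutoff. -/
def moment (Φ : ℝ → ℝ) (j : ℕ) : ℝ := ∫ s in Ioi (0 : ℝ), Φ s / s ^ j

lemma IsCutoff.abs_div_pow_le {Φ : ℝ → ℝ} (h : IsCutoff Φ) (j : ℕ) (s : ℝ) :
    |Φ s / s ^ (j + 2)| ≤ 2 * (1 + s ^ 2)⁻¹ := by
  by_cases hs : |s| < 1
  · rw [h.eq_zero s hs]; simp; positivity
  · push Not at hs
    have h1 : (1 : ℝ) ≤ |s| ^ j := one_le_pow₀ hs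
    have h2 : (1 : ℝ) ≤ s ^ 2 := by rw [← sq_abs]; exact one_le_pow₀ hs
    rw [abs_div, abs_pow, pow_add, sq_abs, div_le_iff₀ (by positivity)]
    have h3 : (1 : ℝ) ≤ 2 * (1 + s ^ 2)⁻¹ * s ^ 2 := by
      rw [mul_comm 2, mul_assoc, ← div_eq_inv_mul, le_div_iff₀ (by positivity)]; linarith
    calc |Φ s| ≤ 1 * 1 := by simpa using h.abs_le_one s
      _ ≤ |s| ^ j * (2 * (1 + s ^ 2)⁻¹ * s ^ 2) := by gcongr
      _ = _ := by ring

lemma IsCutoff.integrable_div_pow {Φ : ℝ → ℝ} (h : IsCutoff Φ) (j : ℕ) :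
    Integrable fun s => Φ s / s ^ (j + 2) := by
  refine (integrable_inv_one_add_sq.const_mul 2).mono'
    (h.measurable.div (measurable_id.pow_const _)).aestronglyMeasurable ?_
  exact Eventually.of_forall fun s => h.abs_div_pow_le j s

lemma IsCutoff.moment_pos {Φ : ℝ → ℝ} (h : IsCutoff Φ) (j : ℕ) : 0 < moment Φ (j + 2) := by
  unfold moment
  rw [setIntegral_pos_iff_support_of_nonneg_ae]
  · refine lt_of_lt_of_le ?_ (measure_mono (s := Ioo (2 : ℝ) 3) ?_)
    · simp; norm_num
    · intro s hs
      have h0 : (0 : ℝ) < s := by linarith [hs.1]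
      refine ⟨?_, h0⟩
      have : Φ s = 1 := h.eq_one s (by rw [abs_of_pos h0]; exact hs.1.le)
      simp [this, h0.ne']
  · refine (ae_restrict_iff' measurableSet_Ioi).2 (Eventually.of_forall fun s hs => ?_)
    have hs : 0 < s := hs
    have := h.nonneg s
    simp only [Pi.zero_apply]; positivity
  · exact (h.integrable_div_pow j).integrableOn

/-- The family `V`, indexed by cutoffs, has an asymptotic expansion in powers `ε⁻¹, …, ε⁻ᴺ` whose
coefficients depend on the cutoff only through its moments; the constant term does not depend on
the cutoff at all. -/
def HasExpansion (N : ℕ) (V : (ℝ → ℝ) → ℝ → ℝ) : Prop :=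
  ∃ (C : ℝ) (a : ℕ → ℝ), ∀ Φ, IsCutoff Φ →
    Tendsto (fun ε => V Φ ε - (C + ∑ j ∈ Finset.range N, a j * moment Φ (j + 2) * ε⁻¹ ^ (j + 1)))
      (𝓝[>] 0) (𝓝 0)

namespace HasExpansion

variable {N : ℕ} {V W : (ℝ → ℝ) → ℝ → ℝ}

lemma congr' (h : HasExpansion N V)
    (hVW : ∀ Φ, IsCutoff Φ → ∀ᶠ ε in 𝓝[>] (0 : ℝ), V Φ ε = W Φ ε) : HasExpansion N W := by
  obtain ⟨C, a, h⟩ := h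
  refine ⟨C, a, fun Φ hΦ => (h Φ hΦ).congr' ?_⟩
  filter_upwards [hVW Φ hΦ] with ε hε
  rw [hε]

lemma of_tendsto {C : ℝ} (h : ∀ Φ, IsCutoff Φ → Tendsto (V Φ) (𝓝[>] 0) (𝓝 C)) :
    HasExpansion N V :=
  ⟨C, 0, fun Φ hΦ => by simpa using (h Φ hΦ).sub_const C⟩

lemma zero : HasExpansion N (fun _ _ => 0) := of_tendsto fun _ _ => tendsto_const_nhds

lemma add (hV : HasExpansion N V) (hW : HasExpansion N W) :
    HasExpansion N (fun Φ ε => V Φ ε + W Φ ε) := by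
  obtain ⟨C, a, hV⟩ := hV
  obtain ⟨D, b, hW⟩ := hW
  refine ⟨C + D, a + b, fun Φ hΦ => ?_⟩
  have := (hV Φ hΦ).add (hW Φ hΦ)
  rw [add_zero] at this
  refine this.congr fun ε => ?_
  simp only [Pi.add_apply, add_mul, Finset.sum_add_distrib]
  ring

lemma sum {ι : Type*} (s : Finset ι) {V : ι → (ℝ → ℝ) → ℝ → ℝ}
    (h : ∀ i ∈ s, HasExpansion N (V i)) : HasExpansion N (fun Φ ε => ∑ i ∈ s, V i Φ ε) := by
  classical
  induction s using Finset.induction_on with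
  | empty => simpa using zero
  | insert i s hi ih =>
    simp only [Finset.sum_insert hi]
    exact (h i (Finset.mem_insert_self _ _)).add
      (ih fun j hj => h j (Finset.mem_insert_of_mem hj))

end HasExpansion

/-- Taylor's theorem at `0` with a bound for the remainder on both sides of `0`. -/
lemma exists_taylor_bound (k : ℕ) {g : ℝ → ℝ} (hg : ContDiff ℝ ∞ g) :
    ∃ (a : ℕ → ℝ) (C : ℝ), ∀ t, |t| ≤ 1 →
      |g t - ∑ i ∈ Finset.range k, a i * t ^ i| ≤ C * |t| ^ k := by
  induction k generalizing g with
  | zero =>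
    obtain ⟨C, hC⟩ := (isCompact_Icc (a := (-1 : ℝ)) (b := 1)).exists_bound_of_continuousOn
      hg.continuous.continuousOn
    exact ⟨0, C, fun t ht => by simpa using hC t (abs_le.1 ht)⟩
  | succ k ih =>
    have hg' : ContDiff ℝ ∞ (deriv g) := hg.iterate_deriv 1
    obtain ⟨a, C, h⟩ := ih hg'
    refine ⟨fun i => if i = 0 then g 0 else a (i - 1) / i, C, fun t ht => ?_⟩
    set b : ℕ → ℝ := fun i => if i = 0 then g 0 else a (i - 1) / i
    have hd : ∀ s, HasDerivAt (fun s => g s - ∑ i ∈ Finset.range (k + 1), b i * s ^ i)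
        (deriv g s - ∑ i ∈ Finset.range k, a i * s ^ i) s := by
      intro s
      refine ((hg.differentiable (by simp)) s).hasDerivAt.sub ?_
      have := HasDerivAt.fun_sum (u := Finset.range (k + 1)) (x := s)
        (A := fun i s => b i * s ^ i) (A' := fun i => b i * (i * s ^ (i - 1)))
        (fun i _ => by simpa using (hasDerivAt_pow i s).const_mul (b i))
      convert this using 1
      rw [Finset.sum_range_succ']
      simp only [b]
      simp only [Nat.add_eq_zero_iff, one_ne_zero, and_false, if_false, Nat.add_sub_cancel,
        Nat.cast_zero, zero_mul, mul_zero, add_zero]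
      refine Finset.sum_congr rfl fun i _ => ?_
      have : ((i : ℝ) + 1) ≠ 0 := by positivity
      push_cast
      field_simp
    have key := (convex_Icc (-|t|) |t|).norm_image_sub_le_of_norm_hasDerivWithin_le
      (C := C * |t| ^ k) (fun s _ => (hd s).hasDerivWithinAt)
      (fun s hs => ?_) (x := 0) (y := t) (by simp) ⟨neg_abs_le t, le_abs_self t⟩
    · have h0 : g 0 - ∑ i ∈ Finset.range (k + 1), b i * (0 : ℝ) ^ i = 0 := by
        rw [Finset.sum_range_succ']
        simp only [pow_succ, mul_zero, Finset.sum_const_zero, pow_zero, mul_one, zero_add]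
        exact sub_self (g 0)
      rw [h0] at key
      simpa [pow_succ, mul_assoc] using key
    · have hs' : |s| ≤ |t| := abs_le.2 hs
      refine (h s (hs'.trans ht)).trans ?_
      have hC : 0 ≤ C := by
        have := (abs_nonneg _).trans (h 1 (by simp)); simpa using this
      gcongr

lemma IsCutoff.integral_even {Φ : ℝ → ℝ} (h : IsCutoff Φ) {j : ℕ} (hj : Even j) {ε : ℝ}
    (hε : 0 < ε) : ∫ t, Φ (t / ε) / t ^ (j + 2) = 2 * moment Φ (j + 2) * ε⁻¹ ^ (j + 1) := by
  have hj2 : Even (j + 2) := hj.add even_two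
  have h1 : ∀ t, Φ (t / ε) / t ^ (j + 2) = Φ (|t| / ε) / |t| ^ (j + 2) := by
    intro t
    rw [hj2.pow_abs]
    rcases abs_choice t with ht | ht <;> rw [ht]
    rw [neg_div, h.even]
  rw [integral_congr_ae (Eventually.of_forall h1),
    integral_comp_abs (f := fun t => Φ (t / ε) / t ^ (j + 2))]
  have h2 : ∀ t, Φ (t / ε) / t ^ (j + 2) =
      ε⁻¹ ^ (j + 2) * (fun s => Φ s / s ^ (j + 2)) (ε⁻¹ * t) := by
    intro t
    simp only [mul_pow, div_eq_inv_mul]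
    have : ε⁻¹ ^ (j + 2) ≠ 0 := by positivity
    field_simp
  rw [integral_congr_ae (Eventually.of_forall h2), integral_const_mul,
    integral_comp_mul_left_Ioi (fun s => Φ s / s ^ (j + 2)) 0
    (inv_pos.2 hε)]
  simp only [mul_zero, inv_inv, smul_eq_mul, moment]
  rw [pow_succ ε⁻¹ (j + 1)]
  field_simp

lemma integral_eq_zero_of_odd {f : ℝ → ℝ} (hf : ∀ t, f (-t) = -f t) : ∫ t, f t = 0 := by
  have h := integral_neg_eq_self f volume
  simp_rw [hf, integral_neg] at h
  linarith

/-- The one-variable case of the volume expansion. Against an even cutoff, the odd part of the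
singular Taylor terms integrates to zero; in particular there is no logarithm. -/
theorem hasExpansion_div_pow {N : ℕ} {g : ℝ → ℝ} (hg : ContDiff ℝ ∞ g)
    (hgc : HasCompactSupport g) :
    HasExpansion N (fun Φ ε => ∫ t, Φ (t / ε) * (g t / t ^ (N + 1))) := by
  obtain ⟨b, C, hb⟩ := exists_taylor_bound (N + 1) hg
  -- the part of the Taylor polynomial that leads to powers `t ^ (-j)` with `2 ≤ j`
  set S : ℝ → ℝ := fun t => ∑ j ∈ Finset.range N, b (N - 1 - j) / t ^ (j + 2)
  -- the term that would lead to a logarithm, cut off at infinity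
  set T : ℝ → ℝ := indicator {t | |t| ≤ 1} fun t => b N / t
  have hmeas1 : MeasurableSet {t : ℝ | |t| ≤ 1} := measurableSet_le measurable_norm measurable_const
  have hSm : Measurable S := by fun_prop
  have hTm : Measurable T := (measurable_const.div measurable_id).indicator hmeas1
  set R : ℝ → ℝ := fun t => g t / t ^ (N + 1) - S t - T t
  have hRm : Measurable R := ((hg.continuous.measurable.div (by fun_prop)).sub hSm).sub hTm
  obtain ⟨M, hM⟩ := hgc.exists_bound_of_continuous hg.continuous
  obtain ⟨r, hr⟩ := hgc.isCompact.isBounded.subset_closedBall 0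
  have hC0 : 0 ≤ C := by
    have := (abs_nonneg _).trans (hb 1 (by simp)); simpa using this
  have hM0 : 0 ≤ M := (norm_nonneg _).trans (hM 0)
  -- the remainder is bounded near `0` and decays like `t ^ (-2)`
  obtain ⟨D, hD⟩ : ∃ D, ∀ t, t ≠ 0 → |R t| ≤ D * (1 + t ^ 2)⁻¹ := by
    refine ⟨2 * C + M * (1 + r ^ 2) + ∑ j ∈ Finset.range N, 2 * |b (N - 1 - j)|, fun t ht => ?_⟩
    have hpos : (0 : ℝ) < 1 + t ^ 2 := by positivity
    have hsum0 : 0 ≤ ∑ j ∈ Finset.range N, 2 * |b (N - 1 - j)| :=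
      Finset.sum_nonneg fun _ _ => by positivity
    by_cases h1 : |t| ≤ 1
    · have hSR : R t = (g t - ∑ i ∈ Finset.range (N + 1), b i * t ^ i) / t ^ (N + 1) := by
        have hT : T t = b N / t := indicator_of_mem (s := {t : ℝ | |t| ≤ 1}) h1 _
        have hS : S t = (∑ i ∈ Finset.range N, b i * t ^ i) / t ^ (N + 1) := by
          rw [← Finset.sum_range_reflect, Finset.sum_div]
          refine Finset.sum_congr rfl fun j hj => ?_
          have hj := Finset.mem_range.1 hj
          have : t ^ (N + 1) = t ^ (N - 1 - j) * t ^ (j + 2) := by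
            rw [← pow_add]; congr 1; omega
          rw [this]
          field_simp
        simp only [R]
        rw [hT, hS, Finset.sum_range_succ]
        field_simp
        ring
      have h2 : |R t| ≤ C := by
        rw [hSR, abs_div, abs_pow, div_le_iff₀ (by positivity)]
        exact hb t h1
      have h3 : (1 : ℝ) ≤ 2 * (1 + t ^ 2)⁻¹ := by
        rw [← div_eq_mul_inv, le_div_iff₀ hpos]
        have : t ^ 2 ≤ 1 := (sq_le_one_iff_abs_le_one t).2 h1
        linarith
      calc |R t| ≤ C * 1 := by simpa using h2
        _ ≤ C * (2 * (1 + t ^ 2)⁻¹) := by gcongr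
        _ = (2 * C) * (1 + t ^ 2)⁻¹ := by ring
        _ ≤ _ := by
          gcongr
          nlinarith [sq_nonneg r, mul_nonneg hM0 (sq_nonneg r)]
    · have hT : T t = 0 := indicator_of_notMem (s := {t : ℝ | |t| ≤ 1}) h1 _
      push Not at h1
      have ht2 : (1 : ℝ) ≤ t ^ 2 := by rw [← sq_abs]; exact one_le_pow₀ h1.le
      have h4 : |g t / t ^ (N + 1)| ≤ M * (1 + r ^ 2) * (1 + t ^ 2)⁻¹ := by
        by_cases hgt : g t = 0
        · rw [hgt]; simp; positivity
        · have h5 : |t| ≤ r := by simpa using hr (subset_tsupport _ hgt)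
          have h6 : t ^ 2 ≤ r ^ 2 := by
            rw [← sq_abs t]; exact pow_le_pow_left₀ (abs_nonneg _) h5 2
          have h7 : (1 : ℝ) ≤ |t| ^ (N + 1) := one_le_pow₀ h1.le
          rw [abs_div, abs_pow]
          calc |g t| / |t| ^ (N + 1) ≤ |g t| := div_le_self (abs_nonneg _) h7
            _ ≤ M * 1 := by simpa using hM t
            _ ≤ M * ((1 + r ^ 2) * (1 + t ^ 2)⁻¹) := by
              gcongr
              rw [← div_eq_mul_inv, le_div_iff₀ hpos]; linarith
            _ = _ := by ring
      have h8 : |S t| ≤ (∑ j ∈ Finset.range N, 2 * |b (N - 1 - j)|) * (1 + t ^ 2)⁻¹ := by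
        rw [Finset.sum_mul]
        refine (Finset.abs_sum_le_sum_abs _ _).trans (Finset.sum_le_sum fun j _ => ?_)
        have := isCutoff_sharpCutoff.abs_div_pow_le j t
        have h9 : sharpCutoff t = 1 := by simp [sharpCutoff, h1.le]
        rw [h9, abs_div, abs_one] at this
        rw [abs_div]
        calc |b (N - 1 - j)| / |t ^ (j + 2)| = |b (N - 1 - j)| * (1 / |t ^ (j + 2)|) := by ring
          _ ≤ |b (N - 1 - j)| * (2 * (1 + t ^ 2)⁻¹) := by gcongr
          _ = _ := by ring
      have h10 : |R t| ≤ |g t / t ^ (N + 1)| + |S t| := by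
        simp only [R]; rw [hT, sub_zero]; exact abs_sub _ _
      have h11 : 0 ≤ 2 * C * (1 + t ^ 2)⁻¹ := by positivity
      rw [add_mul, add_mul]
      linarith
  have hae : ∀ᵐ t : ℝ, t ≠ 0 := by
    rw [ae_iff]; simp
  have hdom : Integrable fun t : ℝ => D * (1 + t ^ 2)⁻¹ := integrable_inv_one_add_sq.const_mul D
  have hRi : Integrable R :=
    hdom.mono' hRm.aestronglyMeasurable (by filter_upwards [hae] with t ht using hD t ht)
  refine ⟨∫ t, R t, fun j => if Even j then 2 * b (N - 1 - j) else 0, fun Φ hΦ => ?_⟩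
  have hlim : Tendsto (fun ε => ∫ t, Φ (t / ε) * R t) (𝓝[>] 0) (𝓝 (∫ t, R t)) := by
    refine tendsto_integral_filter_of_dominated_convergence _
      (Eventually.of_forall fun ε => ((hΦ.measurable.comp (by fun_prop)).mul
        hRm).aestronglyMeasurable) (Eventually.of_forall fun ε => ?_) hRi.norm ?_
    · refine Eventually.of_forall fun t => ?_
      rw [norm_mul]
      exact mul_le_of_le_one_left (norm_nonneg _) (hΦ.abs_le_one _)
    · filter_upwards [hae] with t ht
      refine tendsto_const_nhds.congr' ?_
      filter_upwards [hΦ.eventually_div_eq_one (abs_pos.2 ht)] with ε hε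
      rw [hε t le_rfl, one_mul]
  have hlim' := hlim.sub_const (∫ t, R t)
  rw [sub_self] at hlim'
  refine hlim'.congr' ?_
  filter_upwards [self_mem_nhdsWithin] with ε hε
  have hε : 0 < ε := hε
  have hΦε : Measurable fun t => Φ (t / ε) := hΦ.measurable.comp (by fun_prop)
  have hi : ∀ j, Integrable fun t => Φ (t / ε) / t ^ (j + 2) := by
    intro j
    have := ((hΦ.integrable_div_pow j).comp_div hε.ne').const_mul (ε⁻¹ ^ (j + 2))
    refine this.congr (Eventually.of_forall fun t => ?_)
    simp only [div_pow, inv_pow]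
    field_simp
  have hTi : Integrable fun t => Φ (t / ε) * T t := by
    have hb1 : IntegrableOn (fun _ : ℝ => |b N| / ε) {t : ℝ | |t| ≤ 1} := by
      refine integrableOn_const ?_ (by simp)
      have : {t : ℝ | |t| ≤ 1} = Icc (-1) 1 := by ext t; simp [abs_le]
      rw [this]; simp
    refine (hb1.integrable_indicator hmeas1).mono' (hΦε.mul hTm).aestronglyMeasurable
      (Eventually.of_forall fun t => ?_)
    by_cases h1 : |t| ≤ 1
    · rw [indicator_of_mem (s := {t : ℝ | |t| ≤ 1}) h1]
      have hT : T t = b N / t := indicator_of_mem (s := {t : ℝ | |t| ≤ 1}) h1 _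
      rw [hT]
      by_cases h2 : |t / ε| < 1
      · rw [hΦ.eq_zero _ h2]; simp; positivity
      · push Not at h2
        rw [abs_div, abs_of_pos hε, le_div_iff₀ hε, one_mul] at h2
        rw [norm_mul]
        calc ‖Φ (t / ε)‖ * ‖b N / t‖ ≤ 1 * ‖b N / t‖ := by gcongr; exact hΦ.abs_le_one _
          _ = |b N| / |t| := by simp
          _ ≤ _ := by gcongr
    · rw [indicator_of_notMem (s := {t : ℝ | |t| ≤ 1}) h1]
      have hT : T t = 0 := indicator_of_notMem (s := {t : ℝ | |t| ≤ 1}) h1 _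
      simp [hT]
  have hTz : ∫ t, Φ (t / ε) * T t = 0 := by
    refine integral_eq_zero_of_odd fun t => ?_
    rw [neg_div, hΦ.even]
    simp only [T, indicator, mem_ofPred_eq, abs_neg]
    split_ifs <;> simp [div_neg]
  have hRi' : Integrable fun t => Φ (t / ε) * R t := by
    refine hRi.norm.mono' (hΦε.mul hRm).aestronglyMeasurable (Eventually.of_forall fun t => ?_)
    rw [norm_mul]
    exact mul_le_of_le_one_left (norm_nonneg _) (hΦ.abs_le_one _)
  have hdecomp : ∀ t, Φ (t / ε) * (g t / t ^ (N + 1)) = Φ (t / ε) * R t + Φ (t / ε) * T t +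
      ∑ j ∈ Finset.range N, b (N - 1 - j) * (Φ (t / ε) / t ^ (j + 2)) := by
    intro t
    have : ∑ j ∈ Finset.range N, b (N - 1 - j) * (Φ (t / ε) / t ^ (j + 2)) = Φ (t / ε) * S t := by
      simp only [S]
      rw [Finset.mul_sum]
      exact Finset.sum_congr rfl fun j _ => by ring
    rw [this]
    simp only [R]
    ring
  have hsi : Integrable fun t =>
      ∑ j ∈ Finset.range N, b (N - 1 - j) * (Φ (t / ε) / t ^ (j + 2)) :=
    integrable_finsetSum _ fun j _ => (hi j).const_mul _
  simp_rw [hdecomp]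
  have hadd := integral_add (hRi'.add hTi) hsi
  simp only [Pi.add_apply] at hadd
  rw [hadd, integral_add hRi' hTi, hTz, add_zero,
    integral_finsetSum _ fun j _ => (hi j).const_mul _]
  have hterm : ∀ j ∈ Finset.range N, ∫ t, b (N - 1 - j) * (Φ (t / ε) / t ^ (j + 2)) =
      (if Even j then 2 * b (N - 1 - j) else 0) * moment Φ (j + 2) * ε⁻¹ ^ (j + 1) := by
    intro j _
    rw [integral_const_mul]
    by_cases hj : Even j
    · rw [if_pos hj, hΦ.integral_even hj hε]; ring
    · rw [if_neg hj, integral_eq_zero_of_odd]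
      · ring
      · intro t
        have : Odd (j + 2) := (Nat.not_even_iff_odd.1 hj).add_even even_two
        rw [neg_div, hΦ.even, this.neg_pow, div_neg]
  rw [Finset.sum_congr rfl hterm]
  ring

/-- A polynomial in `ε⁻¹` that tends to `0` as `ε → 0⁺` is zero. -/
lemma polynomial_eq_zero_of_tendsto_inv {P : Polynomial ℝ}
    (h : Tendsto (fun ε : ℝ => P.eval ε⁻¹) (𝓝[>] 0) (𝓝 0)) : P = 0 := by
  have h' : Tendsto (fun x : ℝ => P.eval x) atTop (𝓝 0) := by
    have := h.comp tendsto_inv_atTop_nhdsGT_zero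
    simpa [Function.comp_def] using this
  by_contra hP
  have hdeg : P.degree ≤ 0 := by
    have := (P.isBoundedUnder_abs_atTop_iff).1 (h'.abs.isBoundedUnder_le)
    exact this
  rw [Polynomial.eq_C_of_degree_le_zero hdeg] at h' hP
  simp only [Polynomial.eval_C] at h'
  have := tendsto_nhds_unique h' tendsto_const_nhds
  exact hP (by rw [← this]; simp)

/-- The polynomial `C + ∑ a_j c_j X ^ (j + 1)` with `c_j` the moments of a cutoff. -/
def expansionPoly (N : ℕ) (Φ : ℝ → ℝ) (C : ℝ) (a : ℕ → ℝ) : Polynomial ℝ :=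
  Polynomial.C C + ∑ j ∈ Finset.range N,
    Polynomial.C (a j * moment Φ (j + 2)) * Polynomial.X ^ (j + 1)

lemma eval_expansionPoly (N : ℕ) (Φ : ℝ → ℝ) (C : ℝ) (a : ℕ → ℝ) (x : ℝ) :
    (expansionPoly N Φ C a).eval x =
      C + ∑ j ∈ Finset.range N, a j * moment Φ (j + 2) * x ^ (j + 1) := by
  simp [expansionPoly, Polynomial.eval_finsetSum]

lemma coeff_expansionPoly (N : ℕ) (Φ : ℝ → ℝ) (C : ℝ) (a : ℕ → ℝ) (i : ℕ) :
    (expansionPoly N Φ C a).coeff i = if i = 0 then C else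
      if i - 1 < N then a (i - 1) * moment Φ (i + 1) else 0 := by
  rw [expansionPoly, Polynomial.coeff_add, Polynomial.finsetSum_coeff]
  simp only [Polynomial.coeff_C_mul, Polynomial.coeff_X_pow, Polynomial.coeff_C]
  rcases i with _ | i
  · simp
  · simp [Finset.sum_ite_eq]

/-- Two expansions agree for all cutoffs as soon as they agree for one cutoff: the coefficients
are recovered by dividing by the moments, which are positive. -/
lemma expansionPoly_eq_of_eq {N : ℕ} {Φ Ψ : ℝ → ℝ} (hΦ : IsCutoff Φ) {C D : ℝ} {a b : ℕ → ℝ}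
    (h : expansionPoly N Φ C a = expansionPoly N Φ D b) :
    expansionPoly N Ψ C a = expansionPoly N Ψ D b := by
  ext i
  have hi := congrArg (fun p => Polynomial.coeff p i) h
  simp only [coeff_expansionPoly] at hi ⊢
  rcases i with _ | i
  · simpa using hi
  · simp only [Nat.add_eq_zero_iff, one_ne_zero, and_false, if_false, Nat.add_sub_cancel] at hi ⊢
    split_ifs at hi ⊢ with hN
    · rw [mul_right_cancel₀ (hΦ.moment_pos i).ne' hi]
    · rfl

/-! ### Test functions and densities of pushforwards -/

section Density

variable {E : Type*} [NormedAddCommGroup E] [NormedSpace ℝ E]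

/-- A smooth function with compact support contained in `U`. -/
structure IsTestFunction (U : Set E) (h : E → ℝ) : Prop where
  contDiff : ContDiff ℝ ∞ h
  hasCompactSupport : HasCompactSupport h
  tsupport_subset : tsupport h ⊆ U

namespace IsTestFunction

variable {U V : Set E} {f g h : E → ℝ}

lemma mono (hf : IsTestFunction U f) (h : U ⊆ V) : IsTestFunction V f :=
  ⟨hf.contDiff, hf.hasCompactSupport, hf.tsupport_subset.trans h⟩

lemma zero : IsTestFunction U (0 : E → ℝ) :=
  ⟨contDiff_const, HasCompactSupport.zero, by simp [tsupport]⟩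

lemma add (hf : IsTestFunction U f) (hg : IsTestFunction U g) : IsTestFunction U (f + g) :=
  ⟨hf.contDiff.add hg.contDiff, hf.hasCompactSupport.add hg.hasCompactSupport,
    (tsupport_add f g).trans (union_subset hf.tsupport_subset hg.tsupport_subset)⟩

lemma eq_zero (hf : IsTestFunction U f) {u : E} (hu : u ∉ U) : f u = 0 :=
  image_eq_zero_of_notMem_tsupport fun h => hu (hf.tsupport_subset h)

end IsTestFunction

/-- Extension by zero of a smooth function that vanishes outside a closed subset of its domain. -/
lemma contDiff_of_contDiffOn_of_eq_zero {F : Type*} [NormedAddCommGroup F] [NormedSpace ℝ F]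
    {U K : Set E} {f : E → F} (hU : IsOpen U) (hK : IsClosed K) (hKU : K ⊆ U)
    (hf : ContDiffOn ℝ ∞ f U) (h0 : ∀ u ∉ K, f u = 0) : ContDiff ℝ ∞ f := by
  rw [contDiff_iff_contDiffAt]
  intro u
  by_cases hu : u ∈ U
  · exact hf.contDiffAt (hU.mem_nhds hu)
  · have : f =ᶠ[𝓝 u] fun _ => 0 := by
      filter_upwards [hK.isOpen_compl.mem_nhds fun h => hu (hKU h)] with v hv using h0 v hv
    exact contDiffAt_const.congr_of_eventuallyEq this

/-- The product of a test function on `U` and a function that is smooth on `U`. -/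
lemma IsTestFunction.mul_contDiffOn {U : Set E} {f g : E → ℝ} (hU : IsOpen U)
    (hg : IsTestFunction U g) (hf : ContDiffOn ℝ ∞ f U) :
    IsTestFunction U (fun u => f u * g u) := by
  refine ⟨contDiff_of_contDiffOn_of_eq_zero hU (isClosed_tsupport g) hg.tsupport_subset
    (hf.mul hg.contDiff.contDiffOn) fun u hu => ?_, hg.hasCompactSupport.mul_left,
    tsupport_mul_subset_right.trans hg.tsupport_subset⟩
  rw [image_eq_zero_of_notMem_tsupport hu, mul_zero]

variable [FiniteDimensional ℝ E]

/-- An additive property of test functions may be checked on test functions of small support. -/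
theorem IsTestFunction.induction_local {h : E → ℝ} {U : Set E} (hh : IsTestFunction U h)
    {P : (E → ℝ) → Prop} (h0 : P 0)
    (hadd : ∀ f g, IsTestFunction U f → IsTestFunction U g → P f → P g → P (f + g))
    (hloc : ∀ u ∈ U, ∃ W ∈ 𝓝 u, ∀ f, IsTestFunction (U ∩ W) f → P f) : P h := by
  classical
  choose! W hW hP using hloc
  obtain ⟨ρ, hρ⟩ := SmoothPartitionOfUnity.exists_isSubordinate 𝓘(ℝ, E)
    (isClosed_tsupport h) (fun u : tsupport h => interior (W u)) (fun _ => isOpen_interior)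
    (fun u hu => mem_iUnion.2 ⟨⟨u, hu⟩, mem_interior_iff_mem_nhds.2 (hW u (hh.tsupport_subset hu))⟩)
  have hfin := ρ.locallyFinite.finite_nonempty_inter_compact hh.hasCompactSupport.isCompact
  set S := hfin.toFinset
  have hsum : h = ∑ i ∈ S, fun u => ρ i u * h u := by
    funext u
    rw [Finset.sum_apply, ← Finset.sum_mul]
    by_cases hu : u ∈ tsupport h
    · have h1 := ρ.sum_eq_one hu
      rw [finsum_eq_sum_of_support_subset (s := S)] at h1
      · rw [h1, one_mul]
      · intro i hi
        simpa [S] using ⟨u, hi, hu⟩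
    · rw [image_eq_zero_of_notMem_tsupport hu, mul_zero]
  have key : ∀ i : tsupport h, IsTestFunction (U ∩ W i) fun u => ρ i u * h u := by
    intro i
    refine ⟨(ρ i).contMDiff.contDiff.mul hh.contDiff, hh.hasCompactSupport.mul_left,
      subset_inter (tsupport_mul_subset_right.trans hh.tsupport_subset) ?_⟩
    exact (tsupport_mul_subset_left).trans ((hρ i).trans interior_subset)
  have : ∀ S : Finset (tsupport h), IsTestFunction U (∑ i ∈ S, fun u => ρ i u * h u) ∧
      P (∑ i ∈ S, fun u => ρ i u * h u) := by
    intro S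
    induction S using Finset.induction_on with
    | empty => simpa using ⟨IsTestFunction.zero, h0⟩
    | insert i S hi ih =>
      rw [Finset.sum_insert hi]
      have h1 := (key i).mono inter_subset_left
      exact ⟨h1.add ih.1, hadd _ _ h1 ih.1 (hP i (hh.tsupport_subset i.2) _ (key i)) ih.2⟩
  rw [hsum]
  exact (this S).2

variable [MeasurableSpace E] [BorelSpace E] (μ : Measure E) [μ.IsAddHaarMeasure]

/-- Fubini's theorem along the fibres of a nonzero linear functional. -/
lemma exists_density_of_linear {ℓ : E →L[ℝ] ℝ} {a : E} (ha : ℓ a = 1) {U : Set E} {H : E → ℝ}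
    (hH : IsTestFunction U H) :
    ∃ g : ℝ → ℝ, ContDiff ℝ ∞ g ∧ HasCompactSupport g ∧ ∀ Ψ : ℝ → ℝ, Measurable Ψ →
      (∃ C, ∀ t, |Ψ t| ≤ C) → ∫ u, Ψ (ℓ u) * H u ∂μ = ∫ t, Ψ t * g t := by
  let L₀ : (ℓ.ker × ℝ) ≃ₗ[ℝ] E :=
    { toFun := fun p => (p.1 : E) + p.2 • a
      map_add' := fun p q => by simp [add_smul]; abel
      map_smul' := fun c p => by simp [mul_smul]
      invFun := fun x => (⟨x - ℓ x • a, by simp [ha]⟩, ℓ x)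
      left_inv := fun p => by
        have : ℓ (p.1 : E) = 0 := p.1.2
        ext <;> simp [ha, this]
      right_inv := fun x => by simp }
  let L : (ℓ.ker × ℝ) ≃L[ℝ] E := L₀.toContinuousLinearEquiv
  have hL : ∀ z t, L (z, t) = (z : E) + t • a := fun _ _ => rfl
  let ν : Measure ℓ.ker := Measure.addHaar
  have : ((ν.prod volume).map L).IsAddHaarMeasure := L.isAddHaarMeasure_map _
  have hμ := Measure.isAddLeftInvariant_eq_smul μ ((ν.prod volume).map L)
  set c := Measure.addHaarScalarFactor μ ((ν.prod volume).map L)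
  have hpj : Continuous fun x : E => L.symm x := L.symm.continuous
  have hcs := hH.hasCompactSupport.isCompact
  refine ⟨fun t => (c : ℝ) * ∫ z : ℓ.ker, H (z + t • a) ∂ν, ?_, ?_, fun Ψ hΨ ⟨C, hC⟩ => ?_⟩
  · refine contDiff_const.mul ?_
    -- the parametric integral is a convolution with the constant function `1`
    have := contDiffOn_convolution_right_with_param_comp (n := ⊤) (𝕜 := ℝ) (μ := ν)
      (ContinuousLinearMap.lsmul ℝ ℝ : ℝ →L[ℝ] ℝ →L[ℝ] ℝ) (s := (univ : Set ℝ))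
      (v := fun _ => (0 : ℓ.ker))
      contDiffOn_const (f := fun _ => (1 : ℝ))
      (g := fun t z => H (((-z : ℓ.ker) : E) + t • a))
      (k := (fun x => -(L.symm x).1) '' tsupport H) isOpen_univ
      (hcs.image (by fun_prop)) ?_ (locallyIntegrable_const 1) ?_
    · rw [contDiffOn_univ] at this
      refine cast (congrArg (ContDiff ℝ ∞) (funext fun t => ?_)) this
      rw [convolution_def]
      simp
    · intro t z _ hz
      refine image_eq_zero_of_notMem_tsupport fun h => hz ⟨_, h, ?_⟩
      rw [← hL]
      change -(L.symm (L (-z, t))).1 = z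
      rw [L.symm_apply_apply, neg_neg]
    · refine (hH.contDiff.comp ?_).contDiffOn
      have h1 : ContDiff ℝ ∞ fun p : ℝ × ℓ.ker => ((p.2 : ℓ.ker) : E) :=
        (ℓ.ker.subtypeL.contDiff).comp contDiff_snd
      have : (fun p : ℝ × ℓ.ker => ((-p.2 : ℓ.ker) : E) + p.1 • a) =
          fun p => -(p.2 : E) + p.1 • a := by funext p; simp
      exact this ▸ h1.neg.add (contDiff_fst.smul contDiff_const)
  · refine HasCompactSupport.intro (hcs.image ℓ.continuous) fun t ht => ?_
    have : ∀ z : ℓ.ker, H (z + t • a) = 0 := by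
      intro z
      refine image_eq_zero_of_notMem_tsupport fun h => ht ⟨_, h, ?_⟩
      have : ℓ (z : E) = 0 := z.2
      simp [ha, this]
    simp [this]
  · have hint : Integrable (fun p : ℓ.ker × ℝ => Ψ p.2 * H (p.1 + p.2 • a)) (ν.prod volume) := by
      have h1 : Integrable (fun p : ℓ.ker × ℝ => H (L p)) (ν.prod volume) := by
        refine Continuous.integrable_of_hasCompactSupport
          (hH.contDiff.continuous.comp L.continuous) ?_
        exact hH.hasCompactSupport.comp_homeomorph L.toHomeomorph
      refine (h1.bdd_mul (c := C) (f := fun p : ℓ.ker × ℝ => Ψ p.2)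
        (hΨ.comp measurable_snd).aestronglyMeasurable (Eventually.of_forall fun p => hC _))
    have h2 : ∀ p : ℓ.ker × ℝ, Ψ (ℓ (L p)) * H (L p) = Ψ p.2 * H (p.1 + p.2 • a) := by
      rintro ⟨z, t⟩
      have : ℓ (z : E) = 0 := z.2
      simp [hL, ha, this]
    have h3 : ∫ x, Ψ (ℓ x) * H x ∂((ν.prod volume).map L) =
        ∫ p, Ψ (ℓ (L p)) * H (L p) ∂(ν.prod volume) :=
      L.toHomeomorph.isClosedEmbedding.measurableEmbedding.integral_map _
    rw [hμ, integral_smul_nnreal_measure, h3, integral_congr_ae (Eventually.of_forall h2),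
      integral_prod_symm _ hint, NNReal.smul_def, smul_eq_mul,
      ← integral_const_mul]
    refine integral_congr_ae (Eventually.of_forall fun t => ?_)
    simp only
    rw [integral_const_mul]
    ring

/-- Near a point where `dy ≠ 0`, the pushforward by `y` of a smooth density with compact support
has a smooth density. In the coordinates `u ↦ u + (y u - ℓ u) a`, where `ℓ` is the derivative of
`y` at the point and `ℓ a = 1`, the function `y` becomes the linear functional `ℓ`. -/
theorem exists_density {y : E → ℝ} {V : Set E} (hV : IsOpen V) (hy : ContDiffOn ℝ ∞ y V) {u₀ : E}
    (hu₀ : u₀ ∈ V) (hd : fderiv ℝ y u₀ ≠ 0) :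
    ∃ W ∈ 𝓝 u₀, ∀ h, IsTestFunction W h →
      ∃ g : ℝ → ℝ, ContDiff ℝ ∞ g ∧ HasCompactSupport g ∧ ∀ Ψ : ℝ → ℝ, Measurable Ψ →
        (∃ C, ∀ t, |Ψ t| ≤ C) → ∫ u, Ψ (y u) * h u ∂μ = ∫ t, Ψ t * g t := by
  set ℓ := fderiv ℝ y u₀
  obtain ⟨a, ha⟩ : ∃ a, ℓ a = 1 := by
    obtain ⟨b, hb⟩ : ∃ b, ℓ b ≠ 0 := by
      by_contra! h
      exact hd (ContinuousLinearMap.ext h)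
    exact ⟨(ℓ b)⁻¹ • b, by simp [hb]⟩
  set ψ : E → E := fun u => u + (y u - ℓ u) • a
  have hψ : ContDiffOn ℝ ∞ ψ V :=
    contDiffOn_id.add ((hy.sub ℓ.contDiff.contDiffOn).smul contDiffOn_const)
  set ψ' : E → E →L[ℝ] E := fun u =>
    ContinuousLinearMap.id ℝ E + (fderiv ℝ y u - ℓ).smulRight a
  have hyd : ∀ u ∈ V, HasFDerivAt y (fderiv ℝ y u) u := fun u hu =>
    ((hy.contDiffAt (hV.mem_nhds hu)).differentiableAt (by simp)).hasFDerivAt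
  have hψ' : ∀ u ∈ V, HasFDerivAt ψ (ψ' u) u := fun u hu =>
    (hasFDerivAt_id u).add (((hyd u hu).sub ℓ.hasFDerivAt).smul_const a)
  have hdet : ∀ u, (ψ' u).det = fderiv ℝ y u a := by
    intro u
    have : ((ψ' u : E →L[ℝ] E) : E →ₗ[ℝ] E) =
        LinearMap.transvection ((fderiv ℝ y u - ℓ : E →L[ℝ] ℝ) : E →ₗ[ℝ] ℝ) a := by
      ext v; simp [ψ', LinearMap.transvection]
    rw [ContinuousLinearMap.det, this, LinearMap.transvection.det]
    simp [ha]
  have hψu₀ : HasFDerivAt ψ ((ContinuousLinearEquiv.refl ℝ E : E ≃L[ℝ] E) : E →L[ℝ] E) u₀ := by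
    convert hψ' u₀ hu₀ using 1
    ext v; simp [ψ', ℓ]
  have hψ₀ := hψ.contDiffAt (hV.mem_nhds hu₀)
  have hn : (∞ : WithTop ℕ∞) ≠ 0 := by simp
  set e₀ := hψ₀.toOpenPartialHomeomorph ψ hψu₀ hn
  have he₀ : u₀ ∈ e₀.source := hψ₀.mem_toOpenPartialHomeomorph_source hψu₀ hn
  have hdy : ContDiffOn ℝ ∞ (fun u => fderiv ℝ y u a) V :=
    (hy.fderiv_of_isOpen hV (by simp)).clm_apply contDiffOn_const
  set W : Set E := V ∩ (fun u => fderiv ℝ y u a) ⁻¹' Ioi 0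
  have hWo : IsOpen W := hdy.continuousOn.isOpen_inter_preimage hV isOpen_Ioi
  have hWV : W ⊆ V := inter_subset_left
  have hu₀W : u₀ ∈ W := ⟨hu₀, by simp [← show ℓ = fderiv ℝ y u₀ from rfl, ha]⟩
  set e := e₀.restrOpen W hWo
  have hes : e.source = e₀.source ∩ W := rfl
  have hec : ∀ u, e u = ψ u := fun u => rfl
  refine ⟨e.source, e.open_source.mem_nhds ⟨he₀, hu₀W⟩, fun h hh => ?_⟩
  set H : E → ℝ := indicator e.target fun x => (fderiv ℝ y (e.symm x) a)⁻¹ * h (e.symm x)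
  have hsymm : ContDiffOn ℝ ∞ e.symm e.target := by
    intro x hx
    have hx' := e.map_target hx
    have hpos : (0 : ℝ) < fderiv ℝ y (e.symm x) a := hx'.2.2
    refine ContDiffAt.contDiffWithinAt (e.contDiffAt_symm (f₀' :=
      (ψ' (e.symm x)).toContinuousLinearEquivOfDetNeZero (by rw [hdet]; exact hpos.ne')) hx ?_ ?_)
    · rw [ContinuousLinearMap.coe_toContinuousLinearEquivOfDetNeZero]
      exact hψ' _ hx'.2.1
    · exact hψ.contDiffAt (hV.mem_nhds hx'.2.1)
  have hmaps : MapsTo e.symm e.target W := fun x hx => (e.map_target hx).2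
  have hKt : e '' tsupport h ⊆ e.target := by
    rintro _ ⟨u, hu, rfl⟩
    exact e.map_source (hh.tsupport_subset hu)
  have hKc : IsCompact (e '' tsupport h) :=
    hh.hasCompactSupport.isCompact.image_of_continuousOn
      (e.continuousOn.mono hh.tsupport_subset)
  have hH0 : ∀ x ∉ e '' tsupport h, H x = 0 := by
    intro x hx
    by_cases hxt : x ∈ e.target
    · have : h (e.symm x) = 0 :=
        image_eq_zero_of_notMem_tsupport fun hc => hx ⟨_, hc, e.right_inv hxt⟩
      simp [H, this]
    · exact indicator_of_notMem hxt _
  have hHs : ContDiffOn ℝ ∞ H e.target := by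
    have h1 : ContDiffOn ℝ ∞ (fun x => (fderiv ℝ y (e.symm x) a)⁻¹ * h (e.symm x)) e.target :=
      ((hdy.comp hsymm fun x hx => hWV (hmaps hx)).inv fun x hx => (hmaps hx).2.ne').mul
        (hh.contDiff.comp_contDiffOn hsymm)
    exact h1.congr fun x hx => indicator_of_mem hx _
  have hH : IsTestFunction e.target H := by
    refine ⟨contDiff_of_contDiffOn_of_eq_zero e.open_target hKc.isClosed hKt hHs hH0,
      HasCompactSupport.intro hKc hH0, ?_⟩
    exact (closure_minimal (fun x (hx : H x ≠ 0) => by_contra fun hc => hx (hH0 x hc))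
      hKc.isClosed).trans hKt
  obtain ⟨g, hg, hgc, hgi⟩ := exists_density_of_linear μ ha hH
  refine ⟨g, hg, hgc, fun Ψ hΨ hC => ?_⟩
  rw [← hgi Ψ hΨ hC]
  have hℓψ : ∀ u, ℓ (ψ u) = y u := by intro u; simp [ψ, ha]
  have h1 : ∫ u, Ψ (y u) * h u ∂μ = ∫ u in e.source, Ψ (y u) * h u ∂μ := by
    rw [setIntegral_eq_integral_of_forall_compl_eq_zero]
    intro u hu
    rw [hh.eq_zero hu, mul_zero]
  have h2 : ∫ x, Ψ (ℓ x) * H x ∂μ = ∫ x in e.target, Ψ (ℓ x) * H x ∂μ := by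
    rw [setIntegral_eq_integral_of_forall_compl_eq_zero]
    intro u hu
    rw [hH.eq_zero hu, mul_zero]
  rw [h1, h2, integral_target_eq_integral_abs_det_fderiv_smul μ
    (f := e) (f' := ψ') fun u hu => hψ' u (hWV hu.2)]
  refine setIntegral_congr_fun e.open_source.measurableSet fun u hu => ?_
  have hpos : (0 : ℝ) < fderiv ℝ y u a := hu.2.2
  have hHu : H (e u) = (fderiv ℝ y u a)⁻¹ * h u := by
    simp only [H]
    rw [indicator_of_mem (e.map_source hu), e.left_inv hu]
  simp only [smul_eq_mul]
  rw [hHu, hdet, abs_of_pos hpos, hec, hℓψ]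
  field_simp

/-- If `ψ` is bounded with bounded support and mean zero, then `ε⁻¹ ψ (y / ε) h` has integral
tending to zero: this integral approximates the mean of `ψ` times the density of `h` over the
zero set of `y`. -/
theorem tendsto_integral_concentrated {y : E → ℝ} {V : Set E} (hV : IsOpen V)
    (hy : ContDiffOn ℝ ∞ y V) (hd : ∀ u ∈ V, y u = 0 → fderiv ℝ y u ≠ 0) {h : E → ℝ}
    (hh : IsTestFunction V h) {ψ : ℝ → ℝ} (hψ : Measurable ψ) {C : ℝ} (hC : ∀ s, |ψ s| ≤ C)
    (hψ2 : ∀ s, 2 ≤ |s| → ψ s = 0) (hψ0 : ∫ s, ψ s = 0) :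
    Tendsto (fun ε => ∫ u, ε⁻¹ * ψ (y u / ε) * h u ∂μ) (𝓝[>] 0) (𝓝 0) := by
  have hint : ∀ f, IsTestFunction V f → ∀ ε : ℝ,
      Integrable (fun u => ε⁻¹ * ψ (y u / ε) * f u) μ := by
    intro f hf ε
    have h1 : Integrable f μ :=
      hf.contDiff.continuous.integrable_of_hasCompactSupport hf.hasCompactSupport
    have h2 : Integrable (fun u => indicator V (fun u => ε⁻¹ * ψ (y u / ε)) u * f u) μ := by
      refine h1.bdd_mul (c := |ε⁻¹| * C) ?_ (Eventually.of_forall fun u => ?_)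
      · rw [aestronglyMeasurable_indicator_iff hV.measurableSet]
        have : AEMeasurable y (μ.restrict V) := hy.continuousOn.aemeasurable hV.measurableSet
        exact ((hψ.comp_aemeasurable (this.div_const ε)).const_mul _).aestronglyMeasurable
      · refine (norm_indicator_le_norm_self _ u).trans ?_
        rw [norm_mul]
        exact mul_le_mul_of_nonneg_left (hC _) (abs_nonneg _)
    refine h2.congr (Eventually.of_forall fun u => ?_)
    by_cases hu : u ∈ V
    · simp [hu]
    · simp [hf.eq_zero hu]
  refine hh.induction_local (P := fun h =>
    Tendsto (fun ε => ∫ u, ε⁻¹ * ψ (y u / ε) * h u ∂μ) (𝓝[>] 0) (𝓝 0)) (by simp) ?_ ?_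
  · intro f g hf hg h1 h2
    have := h1.add h2
    rw [add_zero] at this
    refine this.congr fun ε => ?_
    rw [← integral_add (hint f hf ε) (hint g hg ε)]
    exact integral_congr_ae (Eventually.of_forall fun u => by simp [mul_add])
  · intro u hu
    by_cases hyu : y u = 0
    · obtain ⟨W, hW, hg⟩ := exists_density μ hV hy hu (hd u hu hyu)
      refine ⟨W, hW, fun f hf => ?_⟩
      obtain ⟨g, hg, hgc, hgi⟩ := hg f (hf.mono inter_subset_right)
      have h1 : ∀ ε : ℝ, 0 < ε →
          ∫ u, ε⁻¹ * ψ (y u / ε) * f u ∂μ = ∫ s, ψ s * g (ε * s) := by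
        intro ε hε
        rw [hgi (fun t => ε⁻¹ * ψ (t / ε)) (by fun_prop) ⟨|ε⁻¹| * C, fun t => ?_⟩]
        · have h3 := Measure.integral_comp_mul_left (fun t => ε⁻¹ * ψ (t / ε) * g t) ε
          simp only [smul_eq_mul] at h3
          have h4 : ∫ t, ε⁻¹ * ψ (t / ε) * g t =
              ε * ∫ s, ε⁻¹ * ψ (ε * s / ε) * g (ε * s) := by
            rw [h3, abs_of_pos (inv_pos.2 hε)]; field_simp
          rw [h4, ← integral_const_mul]
          refine integral_congr_ae (Eventually.of_forall fun s => ?_)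
          simp only
          rw [mul_div_cancel_left₀ s hε.ne']
          field_simp
        · rw [abs_mul]
          exact mul_le_mul_of_nonneg_left (hC _) (abs_nonneg _)
      obtain ⟨M, hM⟩ := hgc.exists_bound_of_continuous hg.continuous
      have hC0 : 0 ≤ C := (abs_nonneg _).trans (hC 0)
      have h2 : Tendsto (fun ε => ∫ s, ψ s * g (ε * s)) (𝓝[>] 0) (𝓝 (∫ s, ψ s * g 0)) := by
        refine tendsto_integral_filter_of_dominated_convergence
          (indicator (Icc (-2) 2) fun _ => C * M)
          (Eventually.of_forall fun ε => (hψ.mul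
            (hg.continuous.measurable.comp (by fun_prop))).aestronglyMeasurable)
          (Eventually.of_forall fun ε => Eventually.of_forall fun s => ?_) ?_
          (Eventually.of_forall fun s => ?_)
        · by_cases hs : s ∈ Icc (-2 : ℝ) 2
          · rw [indicator_of_mem hs, norm_mul]
            exact mul_le_mul (hC s) (hM _) (norm_nonneg _) hC0
          · rw [indicator_of_notMem hs, hψ2 s, zero_mul, norm_zero]
            by_contra hc
            exact hs (abs_le.1 (not_le.1 hc).le)
        · exact (integrable_indicator_iff measurableSet_Icc).2
            (integrableOn_const (by simp) enorm_ne_top)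
        · refine Tendsto.mul tendsto_const_nhds ((hg.continuous.tendsto 0).comp ?_)
          have : Tendsto (fun ε : ℝ => ε * s) (𝓝 0) (𝓝 (0 * s)) :=
            tendsto_id.mul tendsto_const_nhds
          rw [zero_mul] at this
          exact this.mono_left nhdsWithin_le_nhds
      rw [integral_mul_const, hψ0, zero_mul] at h2
      refine h2.congr' ?_
      filter_upwards [self_mem_nhdsWithin] with ε hε
      exact (h1 ε hε).symm
    · have hcont : ContinuousAt y u := hy.continuousOn.continuousAt (hV.mem_nhds hu)
      have hpos : |y u| / 2 < |y u| := half_lt_self (abs_pos.2 hyu)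
      refine ⟨{v | |y u| / 2 < |y v|}, hcont.abs.eventually (lt_mem_nhds hpos), fun f hf => ?_⟩
      refine tendsto_const_nhds.congr' ?_
      have h1 : ∀ᶠ ε in 𝓝[>] (0 : ℝ), ε < |y u| / 4 :=
        mem_nhdsWithin_of_mem_nhds (Iio_mem_nhds (by have := abs_pos.2 hyu; positivity))
      filter_upwards [h1, self_mem_nhdsWithin] with ε hε hε0
      have hε0 : 0 < ε := hε0
      symm
      refine integral_eq_zero_of_ae (Eventually.of_forall fun v => ?_)
      by_cases hv : |y u| / 2 < |y v|
      · have : ψ (y v / ε) = 0 := by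
          refine hψ2 _ ?_
          rw [abs_div, abs_of_pos hε0, le_div_iff₀ hε0]; linarith
        simp [this]
      · simp [hf.eq_zero fun hc => hv hc.2]

end Density

/-! ### Functions and vector fields in charts -/

section Charts

variable {n : ℕ} {M : Type*} [TopologicalSpace M] [ChartedSpace (EuclideanSpace ℝ (Fin n)) M]

/-- The expression of a function in the preferred chart at `c`. -/
def chartFun (f : M → ℝ) (c : M) (u : EuclideanSpace ℝ (Fin n)) : ℝ :=
  f ((chartAt (EuclideanSpace ℝ (Fin n)) c).symm u)

/-- The vector field with compact support in the domain of the preferred chart at `c` that has the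
expression `w` there. -/
def chartField (c : M) (w : EuclideanSpace ℝ (Fin n) → EuclideanSpace ℝ (Fin n)) (x : M) :
    TangentSpace (𝓡 n) x :=
  open Classical in
  if x ∈ (chartAt (EuclideanSpace ℝ (Fin n)) c).source then
    (chartDeriv c (chartAt (EuclideanSpace ℝ (Fin n)) c x) :
      EuclideanSpace ℝ (Fin n) →L[ℝ] EuclideanSpace ℝ (Fin n))
      (w (chartAt (EuclideanSpace ℝ (Fin n)) c x))
  else 0

lemma chartField_of_mem {c x : M} (w : EuclideanSpace ℝ (Fin n) → EuclideanSpace ℝ (Fin n))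
    (hx : x ∈ (chartAt (EuclideanSpace ℝ (Fin n)) c).source) :
    chartField c w x = (chartDeriv c (chartAt (EuclideanSpace ℝ (Fin n)) c x) :
      EuclideanSpace ℝ (Fin n) →L[ℝ] EuclideanSpace ℝ (Fin n))
      (w (chartAt (EuclideanSpace ℝ (Fin n)) c x)) :=
  if_pos hx

lemma chartField_of_notMem {c x : M} (w : EuclideanSpace ℝ (Fin n) → EuclideanSpace ℝ (Fin n))
    (hx : x ∉ (chartAt (EuclideanSpace ℝ (Fin n)) c).source) : chartField c w x = 0 :=
  if_neg hx

lemma chartField_symm (c : M) (w : EuclideanSpace ℝ (Fin n) → EuclideanSpace ℝ (Fin n))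
    {u : EuclideanSpace ℝ (Fin n)} (hu : u ∈ (chartAt (EuclideanSpace ℝ (Fin n)) c).target) :
    chartField c w ((chartAt (EuclideanSpace ℝ (Fin n)) c).symm u) = chartDeriv c u (w u) := by
  refine (chartField_of_mem w ((chartAt (EuclideanSpace ℝ (Fin n)) c).map_target hu)).trans ?_
  rw [(chartAt (EuclideanSpace ℝ (Fin n)) c).right_inv hu]

lemma mdifferentiableAt_of_contMDiffMap (g : C^∞⟮𝓡 n, M; ℝ⟯) (x : M) :
    MDifferentiableAt (𝓡 n) 𝓘(ℝ, ℝ) g x := g.contMDiff.mdifferentiableAt (by simp)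

lemma dirDeriv_add (f g : C^∞⟮𝓡 n, M; ℝ⟯) (x : M) (w : TangentSpace (𝓡 n) x) :
    dirDeriv (f + g : C^∞⟮𝓡 n, M; ℝ⟯) x w = dirDeriv f x w + dirDeriv g x w := by
  unfold dirDeriv
  rw [ContMDiffMap.coe_add, mfderiv_add (mdifferentiableAt_of_contMDiffMap f x)
    (mdifferentiableAt_of_contMDiffMap g x)]
  rfl

lemma dirDeriv_mul (f g : C^∞⟮𝓡 n, M; ℝ⟯) (x : M) (w : TangentSpace (𝓡 n) x) :
    dirDeriv (f * g : C^∞⟮𝓡 n, M; ℝ⟯) x w = f x * dirDeriv g x w + g x * dirDeriv f x w := by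
  unfold dirDeriv
  rw [ContMDiffMap.coe_mul, ((mdifferentiableAt_of_contMDiffMap f x).hasMFDerivAt.mul
    (mdifferentiableAt_of_contMDiffMap g x).hasMFDerivAt).mfderiv]
  rfl

lemma isOpen_chartPart {U : Set M} (hU : IsOpen U) (c : M) : IsOpen (chartPart n U c) :=
  (chartAt (EuclideanSpace ℝ (Fin n)) c).isOpen_inter_preimage_symm hU

variable [IsManifold (𝓡 n) ∞ M]

lemma contMDiffAt_chart_symm {c : M} {u : EuclideanSpace ℝ (Fin n)}
    (hu : u ∈ (chartAt (EuclideanSpace ℝ (Fin n)) c).target) :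
    ContMDiffAt (𝓡 n) (𝓡 n) ∞ (chartAt (EuclideanSpace ℝ (Fin n)) c).symm u :=
  contMDiffOn_chart_symm.contMDiffAt
    ((chartAt (EuclideanSpace ℝ (Fin n)) c).open_target.mem_nhds hu)

lemma contMDiffAt_chart {c x : M} (hx : x ∈ (chartAt (EuclideanSpace ℝ (Fin n)) c).source) :
    ContMDiffAt (𝓡 n) (𝓡 n) ∞ (chartAt (EuclideanSpace ℝ (Fin n)) c) x :=
  contMDiffOn_chart.contMDiffAt ((chartAt (EuclideanSpace ℝ (Fin n)) c).open_source.mem_nhds hx)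

lemma contDiffOn_chartFun {U : Set M} {f : M → ℝ}
    (hf : ContMDiffOn (𝓡 n) 𝓘(ℝ, ℝ) ∞ f U) (c : M) :
    ContDiffOn ℝ ∞ (chartFun f c) (chartPart n U c) := by
  rw [← contMDiffOn_iff_contDiffOn]
  exact hf.comp (contMDiffOn_chart_symm.mono inter_subset_left) fun u hu => hu.2

lemma contDiffOn_chartFun_target (f : C^∞⟮𝓡 n, M; ℝ⟯) (c : M) :
    ContDiffOn ℝ ∞ (chartFun f c) (chartAt (EuclideanSpace ℝ (Fin n)) c).target := by
  have := contDiffOn_chartFun (U := univ) f.contMDiff.contMDiffOn c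
  rwa [chartPart, preimage_univ, inter_univ] at this

/-- The chain rule for a function in a chart. -/
lemma dirDeriv_chartDeriv {f : M → ℝ} {c : M} {u : EuclideanSpace ℝ (Fin n)}
    (hu : u ∈ (chartAt (EuclideanSpace ℝ (Fin n)) c).target)
    (hf : MDifferentiableAt (𝓡 n) 𝓘(ℝ, ℝ) f ((chartAt (EuclideanSpace ℝ (Fin n)) c).symm u))
    (w : EuclideanSpace ℝ (Fin n)) :
    dirDeriv f ((chartAt (EuclideanSpace ℝ (Fin n)) c).symm u) (chartDeriv c u w) =
      fderiv ℝ (chartFun f c) u w := by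
  have h := mfderiv_comp u hf ((contMDiffAt_chart_symm hu).mdifferentiableAt (by simp))
  rw [← mfderiv_eq_fderiv]
  exact (congrArg (fun L => L w) h).symm

/-- The derivative of the inverse chart is invertible. -/
lemma chartDeriv_mfderiv_chart {c x : M}
    (hx : x ∈ (chartAt (EuclideanSpace ℝ (Fin n)) c).source) (v : EuclideanSpace ℝ (Fin n)) :
    (chartDeriv c (chartAt (EuclideanSpace ℝ (Fin n)) c x) :
      EuclideanSpace ℝ (Fin n) →L[ℝ] EuclideanSpace ℝ (Fin n))
      ((mfderiv (𝓡 n) (𝓡 n) (chartAt (EuclideanSpace ℝ (Fin n)) c) x :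
        EuclideanSpace ℝ (Fin n) →L[ℝ] EuclideanSpace ℝ (Fin n)) v) = v := by
  have hu := (chartAt (EuclideanSpace ℝ (Fin n)) c).map_source hx
  have h := mfderiv_comp x ((contMDiffAt_chart_symm hu).mdifferentiableAt (by simp))
    ((contMDiffAt_chart hx).mdifferentiableAt (by simp))
  have h2 : ((chartAt (EuclideanSpace ℝ (Fin n)) c).symm ∘ chartAt (EuclideanSpace ℝ (Fin n)) c)
      =ᶠ[𝓝 x] id := by
    filter_upwards [(chartAt (EuclideanSpace ℝ (Fin n)) c).open_source.mem_nhds hx] with z hz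
    exact (chartAt (EuclideanSpace ℝ (Fin n)) c).left_inv hz
  rw [h2.mfderiv_eq, mfderiv_id] at h
  exact (congrArg (fun L : EuclideanSpace ℝ (Fin n) →L[ℝ] EuclideanSpace ℝ (Fin n) => L v) h).symm

/-- A smooth vector-valued function with compact support in the target of a chart gives a smooth
vector field. -/
lemma contMDiff_chartField [T2Space M] {c : M}
    {w : EuclideanSpace ℝ (Fin n) → EuclideanSpace ℝ (Fin n)} (hw : ContDiff ℝ ∞ w)
    (hc : HasCompactSupport w)
    (hs : tsupport w ⊆ (chartAt (EuclideanSpace ℝ (Fin n)) c).target) :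
    ContMDiff (𝓡 n) (𝓡 n).tangent ∞
      (fun x => (⟨x, chartField c w x⟩ : TangentBundle (𝓡 n) M)) := by
  set φ := chartAt (EuclideanSpace ℝ (Fin n)) c
  have hK : IsClosed (φ.symm '' tsupport w) :=
    (hc.isCompact.image_of_continuousOn (φ.continuousOn_symm.mono hs)).isClosed
  have h0 : ∀ x ∉ φ.symm '' tsupport w, chartField c w x = 0 := by
    intro x hx
    by_cases hxs : x ∈ φ.source
    · have : w (φ x) = 0 :=
        image_eq_zero_of_notMem_tsupport fun h => hx ⟨_, h, φ.left_inv hxs⟩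
      refine (chartField_of_mem w hxs).trans ?_
      rw [show chartAt (EuclideanSpace ℝ (Fin n)) c = φ from rfl, this]
      exact map_zero _
    · exact chartField_of_notMem w hxs
  intro x
  by_cases hx : x ∈ φ.source
  · have h1 : ContMDiffOn (𝓡 n).tangent (𝓡 n).tangent ∞ (tangentMapWithin (𝓡 n) (𝓡 n) φ.symm
        φ.target) (Bundle.TotalSpace.proj ⁻¹' φ.target) :=
      contMDiffOn_chart_symm.contMDiffOn_tangentMapWithin (n := ∞) (by simp)
        φ.open_target.uniqueMDiffOn
    have h2 : ContMDiff (𝓡 n) (𝓡 n).tangent ∞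
        (fun u => (⟨u, w u⟩ : TangentBundle (𝓡 n) (EuclideanSpace ℝ (Fin n)))) :=
      contMDiff_vectorSpace_iff_contDiff.2 hw
    have h3 : ContMDiffOn (𝓡 n) (𝓡 n).tangent ∞ (fun x => tangentMapWithin (𝓡 n) (𝓡 n) φ.symm
        φ.target (⟨φ x, w (φ x)⟩ : TangentBundle (𝓡 n) (EuclideanSpace ℝ (Fin n)))) φ.source :=
      h1.comp (h2.comp_contMDiffOn contMDiffOn_chart) fun z hz => φ.map_source hz
    refine (h3.contMDiffAt (φ.open_source.mem_nhds hx)).congr_of_eventuallyEq ?_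
    filter_upwards [φ.open_source.mem_nhds hx] with z hz
    have hz' := φ.map_source hz
    have h4 : ∀ z' : M, z = z' → ∀ v : EuclideanSpace ℝ (Fin n),
        (⟨z, v⟩ : TangentBundle (𝓡 n) M) = ⟨z', v⟩ := by rintro _ rfl v; rfl
    rw [chartField_of_mem w hz, tangentMapWithin, mfderivWithin_of_isOpen φ.open_target hz']
    exact h4 _ (φ.left_inv hz).symm _
  · have hxK : x ∉ φ.symm '' tsupport w := by
      rintro ⟨u, hu, rfl⟩
      exact hx (φ.map_target (hs hu))
    have h1 : ContMDiff (𝓡 n) (𝓡 n).tangent ∞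
        (fun x : M => (⟨x, 0⟩ : TangentBundle (𝓡 n) M)) :=
      Bundle.contMDiff_zeroSection ℝ (TangentSpace (𝓡 n) : M → Type _)
    refine (h1 x).congr_of_eventuallyEq ?_
    filter_upwards [hK.isOpen_compl.mem_nhds hxK] with z hz
    rw [h0 z hz]

/-- The derivative of a smooth function along a smooth vector field. -/
def lieDeriv (v : ∀ x : M, TangentSpace (𝓡 n) x)
    (hv : ContMDiff (𝓡 n) (𝓡 n).tangent ∞ (fun x => (⟨x, v x⟩ : TangentBundle (𝓡 n) M)))
    (g : C^∞⟮𝓡 n, M; ℝ⟯) : C^∞⟮𝓡 n, M; ℝ⟯ :=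
  ⟨fun x => dirDeriv g x (v x), by
    have h1 : ContMDiff (𝓡 n).tangent 𝓘(ℝ, ℝ).tangent ∞ (tangentMap (𝓡 n) 𝓘(ℝ, ℝ) g) :=
      g.contMDiff.contMDiff_tangentMap (by simp)
    exact (contMDiff_snd_tangentBundle_modelSpace ℝ 𝓘(ℝ, ℝ)).comp (h1.comp hv)⟩

/-- A vector field tangent to `Z` preserves the powers of the ideal of `Z`. -/
lemma lieDeriv_mem_pow {Z : Set M} {v : ∀ x : M, TangentSpace (𝓡 n) x}
    (hv : ContMDiff (𝓡 n) (𝓡 n).tangent ∞ (fun x => (⟨x, v x⟩ : TangentBundle (𝓡 n) M)))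
    (ht : ∀ x ∈ Z, v x ∈ hypersurfaceTangent n Z x) (k : ℕ) {g : C^∞⟮𝓡 n, M; ℝ⟯}
    (hg : g ∈ vanishingIdeal n Z ^ k) : lieDeriv v hv g ∈ vanishingIdeal n Z ^ k := by
  have hadd : ∀ f g, lieDeriv v hv (f + g) = lieDeriv v hv f + lieDeriv v hv g := by
    intro f g; ext x; exact dirDeriv_add f g x _
  have hmul : ∀ f g, lieDeriv v hv (f * g) = f * lieDeriv v hv g + g * lieDeriv v hv f := by
    intro f g; ext x; exact dirDeriv_mul f g x _
  have h1 : ∀ g ∈ vanishingIdeal n Z, lieDeriv v hv g ∈ vanishingIdeal n Z := by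
    intro g hg x hx
    have := ht x hx
    simp only [hypersurfaceTangent, Submodule.mem_iInf] at this
    exact this g hg
  induction k generalizing g with
  | zero => simp
  | succ k ih =>
    rw [pow_succ] at hg
    refine Submodule.mul_induction_on hg (fun a ha b hb => ?_) fun a b ha hb => ?_
    · rw [hmul, pow_succ]
      refine add_mem (Ideal.mul_mem_mul ha (h1 b hb)) ?_
      rw [mul_comm b]
      exact Ideal.mul_mem_mul (ih ha) hb
    · rw [hadd]; exact add_mem ha hb

end Charts

/-! ### Enough `b^k`-vector fields -/

/-- The smooth function `f` on `M` restricts to a local defining function for `Z` on the open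
neighbourhood `U` of `Z`. -/
structure IsDefiningOn {n : ℕ} {M : Type*} [TopologicalSpace M]
    [ChartedSpace (EuclideanSpace ℝ (Fin n)) M] (Z : Set M) (f : C^∞⟮𝓡 n, M; ℝ⟯) (U : Set M) :
    Prop where
  isOpen : IsOpen U
  subset : Z ⊆ U
  zero_iff : ∀ x ∈ U, f x = 0 ↔ x ∈ Z
  mfderiv_ne_zero : ∀ x ∈ Z, mfderiv (𝓡 n) 𝓘(ℝ, ℝ) f x ≠ 0

namespace IsDefiningOn

variable {n : ℕ} {M : Type*} [TopologicalSpace M] [ChartedSpace (EuclideanSpace ℝ (Fin n)) M]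
  {Z U : Set M} {f : C^∞⟮𝓡 n, M; ℝ⟯}

lemma mono {V : Set M} (h : IsDefiningOn Z f U) (hV : IsOpen V) (hZV : Z ⊆ V) (hVU : V ⊆ U) :
    IsDefiningOn Z f V :=
  ⟨hV, hZV, fun x hx => h.zero_iff x (hVU hx), h.mfderiv_ne_zero⟩

lemma mem_vanishingIdeal (h : IsDefiningOn Z f U) : f ∈ vanishingIdeal n Z := fun x hx =>
  (h.zero_iff x (h.subset hx)).2 hx

variable [IsManifold (𝓡 n) ∞ M]

lemma fderiv_chartFun_ne_zero (h : IsDefiningOn Z f U) {c : M} {u : EuclideanSpace ℝ (Fin n)}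
    (hu : u ∈ chartPart n Z c) : fderiv ℝ (chartFun f c) u ≠ 0 := by
  intro h0
  set φ := chartAt (EuclideanSpace ℝ (Fin n)) c
  suffices hv : ∀ v : TangentSpace (𝓡 n) (φ.symm u), dirDeriv f (φ.symm u) v = 0 from
    h.mfderiv_ne_zero _ hu.2 (ContinuousLinearMap.ext hv)
  intro v
  have h1 := chartDeriv_mfderiv_chart (φ.map_target hu.1) v
  rw [show chartAt (EuclideanSpace ℝ (Fin n)) c = φ from rfl, φ.right_inv hu.1] at h1
  have h2 := dirDeriv_chartDeriv hu.1 (mdifferentiableAt_of_contMDiffMap f _)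
    ((mfderiv (𝓡 n) (𝓡 n) φ (φ.symm u) :
        EuclideanSpace ℝ (Fin n) →L[ℝ] EuclideanSpace ℝ (Fin n)) v)
  rw [h0] at h2
  have h3 := (congrArg (dirDeriv f (φ.symm u)) h1).symm.trans h2
  exact h3

/-- The tangent space of `Z` is the kernel of the derivative of a defining function, by the method
of Lagrange multipliers: a function that vanishes on `Z` is extremal on the zero set. -/
lemma chartDeriv_mem_hypersurfaceTangent (h : IsDefiningOn Z f U) {c : M}
    {u : EuclideanSpace ℝ (Fin n)} (hu : u ∈ chartPart n Z c) {w : EuclideanSpace ℝ (Fin n)}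
    (hw : fderiv ℝ (chartFun f c) u w = 0) :
    chartDeriv c u w ∈
      hypersurfaceTangent n Z ((chartAt (EuclideanSpace ℝ (Fin n)) c).symm u) := by
  simp only [hypersurfaceTangent, Submodule.mem_iInf]
  intro g hg
  set φ := chartAt (EuclideanSpace ℝ (Fin n)) c
  have hstrict : ∀ g : C^∞⟮𝓡 n, M; ℝ⟯,
      HasStrictFDerivAt (chartFun g c) (fderiv ℝ (chartFun g c) u) u := fun g =>
    ((contDiffOn_chartFun_target g c).contDiffAt
      (φ.open_target.mem_nhds hu.1)).hasStrictFDerivAt (by simp)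
  have hfu : chartFun f c u = 0 := (h.zero_iff _ (h.subset hu.2)).2 hu.2
  have hmin : IsLocalMinOn (chartFun g c) {v | chartFun f c v = chartFun f c u} u := by
    have hN : chartPart n U c ∈ 𝓝 u :=
      (isOpen_chartPart h.isOpen c).mem_nhds ⟨hu.1, h.subset hu.2⟩
    have h1 : ∀ᶠ v in 𝓝[{v | chartFun f c v = chartFun f c u}] u,
        chartFun g c u ≤ chartFun g c v := by
      filter_upwards [mem_nhdsWithin_of_mem_nhds hN, self_mem_nhdsWithin] with v hv hv2
      have hvZ : φ.symm v ∈ Z := by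
        refine (h.zero_iff _ hv.2).1 ?_
        have : chartFun f c v = chartFun f c u := hv2
        rw [hfu] at this
        exact this
      exact ((hg _ hu.2).trans (hg _ hvZ).symm).le
    exact h1
  obtain ⟨a, b, hab, hL⟩ := IsLocalExtrOn.exists_multipliers_of_hasStrictFDerivAt_1d
    (Or.inl hmin) (hstrict f) (hstrict g)
  have hb : b ≠ 0 := by
    rintro rfl
    rw [zero_smul, add_zero, smul_eq_zero] at hL
    rcases hL with rfl | hL
    · exact hab rfl
    · exact h.fderiv_chartFun_ne_zero hu hL
  have hLw := congrArg (fun L => L w) hL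
  simp only [add_apply, smul_apply, hw, smul_zero,
    zero_add, zero_apply, smul_eq_zero, hb, false_or] at hLw
  exact (dirDeriv_chartDeriv hu.1 (mdifferentiableAt_of_contMDiffMap g _) w).trans hLw

end IsDefiningOn

section BkFields

variable {k m : ℕ} {M : Type*} [TopologicalSpace M]
  [ChartedSpace (EuclideanSpace ℝ (Fin (m + 1))) M] [IsManifold (𝓡 (m + 1)) ∞ M] [T2Space M]
  (B : BkStructure k m M)

/-- A compactly supported vector field in a chart that annihilates a defining function in the jet
is a `b^k`-vector field. -/
def BkVectorField.ofTangent {f : C^∞⟮𝓡 (m + 1), M; ℝ⟯} {U : Set M} (hf : IsDefiningOn B.Z f U)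
    (hj : Ideal.Quotient.mk (vanishingIdeal (m + 1) B.Z ^ k) f = B.jet) {c : M}
    {w : EuclideanSpace ℝ (Fin (m + 1)) → EuclideanSpace ℝ (Fin (m + 1))} (hw : ContDiff ℝ ∞ w)
    (hc : HasCompactSupport w)
    (hs : tsupport w ⊆ (chartAt (EuclideanSpace ℝ (Fin (m + 1))) c).target)
    (h0 : ∀ u ∈ (chartAt (EuclideanSpace ℝ (Fin (m + 1))) c).target,
      fderiv ℝ (chartFun f c) u (w u) = 0) : BkVectorField B :=
  have ht : ∀ x ∈ B.Z, chartField c w x ∈ hypersurfaceTangent (m + 1) B.Z x := by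
    intro x hx
    by_cases hxs : x ∈ (chartAt (EuclideanSpace ℝ (Fin (m + 1))) c).source
    · set φ := chartAt (EuclideanSpace ℝ (Fin (m + 1))) c
      obtain ⟨u, hu, rfl⟩ : ∃ u ∈ φ.target, x = φ.symm u :=
        ⟨φ x, φ.map_source hxs, (φ.left_inv hxs).symm⟩
      rw [chartField_symm c w hu]
      exact hf.chartDeriv_mem_hypersurfaceTangent ⟨hu, hx⟩ (h0 u hu)
    · rw [chartField_of_notMem w hxs]
      exact zero_mem _
  { toFun := chartField c w
    smooth := contMDiff_chartField hw hc hs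
    tangent := ht
    lie_mem := by
      intro g hg
      refine ⟨lieDeriv _ (contMDiff_chartField hw hc hs) (g - f), ?_, fun x => ?_⟩
      · refine lieDeriv_mem_pow _ ht k ?_
        rw [← Ideal.Quotient.eq_zero_iff_mem, map_sub, hg, hj, sub_self]
      · have h1 : dirDeriv f x (chartField c w x) = 0 := by
          by_cases hxs : x ∈ (chartAt (EuclideanSpace ℝ (Fin (m + 1))) c).source
          · set φ := chartAt (EuclideanSpace ℝ (Fin (m + 1))) c
            obtain ⟨u, hu, rfl⟩ : ∃ u ∈ φ.target, x = φ.symm u :=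
              ⟨φ x, φ.map_source hxs, (φ.left_inv hxs).symm⟩
            rw [chartField_symm c w hu, dirDeriv_chartDeriv hu
              (mdifferentiableAt_of_contMDiffMap f _), h0 u hu]
          · rw [chartField_of_notMem w hxs]
            exact map_zero _
        have h2 := dirDeriv_add (g - f) f x (chartField c w x)
        rw [sub_add_cancel, h1, add_zero] at h2
        exact h2.symm }

lemma BkVectorField.ofTangent_toFun {f : C^∞⟮𝓡 (m + 1), M; ℝ⟯} {U : Set M}
    (hf : IsDefiningOn B.Z f U)
    (hj : Ideal.Quotient.mk (vanishingIdeal (m + 1) B.Z ^ k) f = B.jet) {c : M}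
    {w : EuclideanSpace ℝ (Fin (m + 1)) → EuclideanSpace ℝ (Fin (m + 1))} (hw : ContDiff ℝ ∞ w)
    (hc : HasCompactSupport w)
    (hs : tsupport w ⊆ (chartAt (EuclideanSpace ℝ (Fin (m + 1))) c).target)
    (h0 : ∀ u ∈ (chartAt (EuclideanSpace ℝ (Fin (m + 1))) c).target,
      fderiv ℝ (chartFun f c) u (w u) = 0) :
    (BkVectorField.ofTangent B hf hj hw hc hs h0).toFun = chartField c w := rfl

/-- A smooth vector field multiplied by an element of `I_Z^k` is a `b^k`-vector field, for
`1 ≤ k`. -/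
def BkVectorField.ofSMul (hk : 1 ≤ k) {G : C^∞⟮𝓡 (m + 1), M; ℝ⟯}
    (hG : G ∈ vanishingIdeal (m + 1) B.Z ^ k) {c : M}
    {w : EuclideanSpace ℝ (Fin (m + 1)) → EuclideanSpace ℝ (Fin (m + 1))} (hw : ContDiff ℝ ∞ w)
    (hc : HasCompactSupport w)
    (hs : tsupport w ⊆ (chartAt (EuclideanSpace ℝ (Fin (m + 1))) c).target) : BkVectorField B where
  toFun x := G x • chartField c w x
  smooth := ContMDiff.smul_section (f := G) (s := chartField c w) G.contMDiff
    (contMDiff_chartField hw hc hs)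
  tangent x hx := by
    have : G x = 0 := Ideal.pow_le_self (by omega) hG x hx
    rw [this, zero_smul]
    exact zero_mem _
  lie_mem g _ := by
    refine ⟨G * lieDeriv _ (contMDiff_chartField hw hc hs) g, Ideal.mul_mem_right _ _ hG,
      fun x => ?_⟩
    exact ((mfderiv (𝓡 (m + 1)) 𝓘(ℝ, ℝ) g x).map_smul (G x) (chartField c w x)).symm

end BkFields

/-! ### Regularity of `b^k`-forms near the hypersurface -/

section Regularity

/-- A nonzero functional and a vector on which it is `1` extend to an adapted basis. -/
lemma exists_adapted_basis {m : ℕ} {ℓ : EuclideanSpace ℝ (Fin (m + 1)) →L[ℝ] ℝ}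
    {a : EuclideanSpace ℝ (Fin (m + 1))} (ha : ℓ a = 1) :
    ∃ b : Module.Basis (Fin (m + 1)) ℝ (EuclideanSpace ℝ (Fin (m + 1))),
      b 0 = a ∧ ∀ i : Fin m, ℓ (b i.succ) = 0 := by
  have hfr : Module.finrank ℝ ℓ.ker = m := by
    have h1 := LinearMap.finrank_range_add_finrank_ker (ℓ : EuclideanSpace ℝ (Fin (m + 1)) →ₗ[ℝ] ℝ)
    have h2 : LinearMap.range (ℓ : EuclideanSpace ℝ (Fin (m + 1)) →ₗ[ℝ] ℝ) = ⊤ := by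
      rw [LinearMap.range_eq_top]
      exact fun t => ⟨t • a, by simp [ha]⟩
    rw [h2, finrank_top, Module.finrank_self, finrank_euclideanSpace_fin] at h1
    change Module.finrank ℝ (LinearMap.ker (ℓ : EuclideanSpace ℝ (Fin (m + 1)) →ₗ[ℝ] ℝ)) = m
    omega
  let b₀ := Module.finBasisOfFinrankEq ℝ ℓ.ker hfr
  refine ⟨Module.Basis.mkFinCons a b₀ (fun c x hx h => ?_) fun z => ⟨-ℓ z, by simp [ha]⟩, ?_, ?_⟩
  · have h1 : ℓ x = 0 := hx
    have := congrArg ℓ h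
    simpa [ha, h1] using this
  · rw [Module.Basis.coe_mkFinCons]; rfl
  · intro i
    rw [Module.Basis.coe_mkFinCons, Fin.cons_succ]
    exact (b₀ i).2

/-- The determinant of `n` vectors of `ℝ^n` with respect to the standard basis. -/
def stdDet (n : ℕ) (w : Fin n → EuclideanSpace ℝ (Fin n)) : ℝ :=
  (EuclideanSpace.basisFun (Fin n) ℝ).toBasis.det w

lemma alternatingMap_apply_eq_stdDet_mul {n : ℕ}
    (α : EuclideanSpace ℝ (Fin n) [⋀^Fin n]→ₗ[ℝ] ℝ) (w : Fin n → EuclideanSpace ℝ (Fin n)) :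
    α w = stdDet n w * α fun i => EuclideanSpace.single i 1 := by
  have h2 := congrArg (fun L => L w)
    (α.eq_smul_basis_det (EuclideanSpace.basisFun (Fin n) ℝ).toBasis)
  have h3 : α w = α (EuclideanSpace.basisFun (Fin n) ℝ).toBasis * stdDet n w := h2
  rw [h3, mul_comm]
  congr 2
  funext i
  simp

lemma apply_eq_stdDet_mul {n : ℕ} (α : EuclideanSpace ℝ (Fin n) [⋀^Fin n]→L[ℝ] ℝ)
    (w : Fin n → EuclideanSpace ℝ (Fin n)) :
    α w = stdDet n w * α fun i => EuclideanSpace.single i 1 :=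
  alternatingMap_apply_eq_stdDet_mul α.toAlternatingMap w

lemma contDiff_stdDet (n : ℕ) : ContDiff ℝ ∞ (stdDet n) := by
  have : stdDet n = fun w => ∑ σ : Equiv.Perm (Fin n),
      ((Equiv.Perm.sign σ : ℤ) : ℝ) * ∏ i, w i (σ i) := by
    funext w
    rw [stdDet, Module.Basis.det_apply, Matrix.det_apply']
    rfl
  rw [this]
  refine ContDiff.sum fun σ _ => contDiff_const.mul (contDiff_prod fun i _ => ?_)
  exact (EuclideanSpace.proj (𝕜 := ℝ) (σ i)).contDiff.comp (contDiff_apply ℝ _ i)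

lemma stdDet_basis_ne_zero {n : ℕ} (b : Module.Basis (Fin n) ℝ (EuclideanSpace ℝ (Fin n))) :
    stdDet n b ≠ 0 :=
  ((EuclideanSpace.basisFun (Fin n) ℝ).toBasis.isUnit_det b).ne_zero

variable {k m : ℕ} {M : Type*} [TopologicalSpace M]
  [ChartedSpace (EuclideanSpace ℝ (Fin (m + 1))) M]

/-- The expression of `df ∧ η` in the preferred chart at `c`. -/
def wedgeRep {p : ℕ} (f : M → ℝ) (η : Form (m + 1) M p) (c : M)
    (u : EuclideanSpace ℝ (Fin (m + 1))) :
    EuclideanSpace ℝ (Fin (m + 1)) [⋀^Fin (p + 1)]→L[ℝ] ℝ :=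
  ContinuousAlternatingMap.alternatizeUncurryFin
    ((fderiv ℝ (chartFun f c) u).smulRight (localRep η c u))

/-- If all `w i.succ` lie in the kernel of `df`, only one term of `(df ∧ η) w` survives. -/
lemma wedgeRep_apply_of_ker {p : ℕ} (f : M → ℝ) (η : Form (m + 1) M p) (c : M)
    (u : EuclideanSpace ℝ (Fin (m + 1))) {w : Fin (p + 1) → EuclideanSpace ℝ (Fin (m + 1))}
    (hw : ∀ i : Fin p, fderiv ℝ (chartFun f c) u (w i.succ) = 0) :
    wedgeRep f η c u w =
      fderiv ℝ (chartFun f c) u (w 0) * localRep η c u (fun i => w i.succ) := by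
  rw [wedgeRep, ContinuousAlternatingMap.alternatizeUncurryFin_apply, Fin.sum_univ_succ]
  rw [Finset.sum_eq_zero fun i _ => by simp [hw i]]
  simp [Fin.removeNth_zero]
  exact Or.inl rfl

/-- A `b^k`-form in a chart, evaluated on the expressions of `b^k`-vector fields, is smooth. -/
lemma IsBkForm.exists_pairing [IsManifold (𝓡 (m + 1)) ∞ M] {B : BkStructure k m M} {p : ℕ}
    {θ : Form (m + 1) M p}
    (hθ : IsBkForm B θ) (v : Fin p → BkVectorField B) (c : M)
    (w : EuclideanSpace ℝ (Fin (m + 1)) → Fin p → EuclideanSpace ℝ (Fin (m + 1)))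
    (hw : ∀ i, ∀ u ∈ (chartAt (EuclideanSpace ℝ (Fin (m + 1))) c).target,
      (v i).toFun ((chartAt (EuclideanSpace ℝ (Fin (m + 1))) c).symm u) =
        chartDeriv c u (w u i)) :
    ∃ F : EuclideanSpace ℝ (Fin (m + 1)) → ℝ,
      ContDiffOn ℝ ∞ F (chartAt (EuclideanSpace ℝ (Fin (m + 1))) c).target ∧
      ∀ u ∈ chartPart (m + 1) B.Zᶜ c, F u = localRep θ c u (w u) := by
  obtain ⟨F, hF⟩ := hθ.pairing v
  refine ⟨chartFun F c, contDiffOn_chartFun_target F c, fun u hu => ?_⟩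
  rw [chartFun, hF _ hu.2]
  exact congrArg _ (funext fun i => hw i u hu.1)

variable [IsManifold (𝓡 (m + 1)) ∞ M] [T2Space M]

/-- Near a point of `Z` there is a frame `w` in a chart whose members, except the first, are the
expressions of `b^k`-vector fields that annihilate a given defining function `f` in the jet, while
the multiples of the first by elements of `I_Z^k` are expressions of `b^k`-vector fields. -/
lemma exists_adapted_frame (hk : 1 ≤ k) {B : BkStructure k m M} {f : C^∞⟮𝓡 (m + 1), M; ℝ⟯}
    {U : Set M} (hf : IsDefiningOn B.Z f U)
    (hj : Ideal.Quotient.mk (vanishingIdeal (m + 1) B.Z ^ k) f = B.jet) {c : M}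
    {u₀ : EuclideanSpace ℝ (Fin (m + 1))} (hu₀ : u₀ ∈ chartPart (m + 1) B.Z c) :
    ∃ w : EuclideanSpace ℝ (Fin (m + 1)) → Fin (m + 1) → EuclideanSpace ℝ (Fin (m + 1)),
      ContDiff ℝ ∞ w ∧ stdDet (m + 1) (w u₀) ≠ 0 ∧
      (∀ u ∈ (chartAt (EuclideanSpace ℝ (Fin (m + 1))) c).target, ∀ i : Fin m,
        fderiv ℝ (chartFun f c) u (w u i.succ) = 0) ∧
      (∀ i : Fin m, ∃ v : BkVectorField B,
        ∀ u ∈ (chartAt (EuclideanSpace ℝ (Fin (m + 1))) c).target,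
          v.toFun ((chartAt (EuclideanSpace ℝ (Fin (m + 1))) c).symm u) =
            chartDeriv c u (w u i.succ)) ∧
      ∀ G ∈ vanishingIdeal (m + 1) B.Z ^ k, ∃ v : BkVectorField B,
        ∀ u ∈ (chartAt (EuclideanSpace ℝ (Fin (m + 1))) c).target,
          v.toFun ((chartAt (EuclideanSpace ℝ (Fin (m + 1))) c).symm u) =
            chartDeriv c u (chartFun G c u • w u 0) := by
  set φ := chartAt (EuclideanSpace ℝ (Fin (m + 1))) c
  set D := fderiv ℝ (chartFun (n := m + 1) f c)
  obtain ⟨a, ha⟩ : ∃ a, D u₀ a = 1 := by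
    obtain ⟨b, hb⟩ : ∃ b, D u₀ b ≠ 0 := by
      by_contra! h
      exact hf.fderiv_chartFun_ne_zero hu₀ (ContinuousLinearMap.ext h)
    exact ⟨(D u₀ b)⁻¹ • b, by simp [hb]⟩
  obtain ⟨b, hb0, hbs⟩ := exists_adapted_basis ha
  obtain ⟨χ, hχs, hχc, hχd, -, hχ1⟩ :=
    exists_contDiff_tsupport_subset (n := ⊤) (φ.open_target.mem_nhds hu₀.1)
  have hD : ContDiffOn ℝ ∞ D φ.target :=
    (contDiffOn_chartFun_target f c).fderiv_of_isOpen φ.open_target (by simp)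
  -- a vector-valued function that is smooth on the target, times the cutoff
  have hsm : ∀ s : EuclideanSpace ℝ (Fin (m + 1)) → EuclideanSpace ℝ (Fin (m + 1)),
      ContDiffOn ℝ ∞ s φ.target → ContDiff ℝ ∞ (fun u => χ u • s u) ∧
        HasCompactSupport (fun u => χ u • s u) ∧ tsupport (fun u => χ u • s u) ⊆ φ.target := by
    intro s hs
    refine ⟨contDiff_of_contDiffOn_of_eq_zero φ.open_target (isClosed_tsupport χ) hχs
      (hχd.contDiffOn.smul hs) fun u hu => ?_, hχc.smul_right,
      (tsupport_smul_subset_left χ s).trans hχs⟩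
    rw [image_eq_zero_of_notMem_tsupport hu, zero_smul]
  set s : Fin m → EuclideanSpace ℝ (Fin (m + 1)) → EuclideanSpace ℝ (Fin (m + 1)) :=
    fun i u => D u a • b i.succ - D u (b i.succ) • a
  have hs : ∀ i, ContDiffOn ℝ ∞ (s i) φ.target := fun i =>
    ((hD.clm_apply contDiffOn_const).smul contDiffOn_const).sub
      ((hD.clm_apply contDiffOn_const).smul contDiffOn_const)
  have hker : ∀ u, ∀ i, D u (χ u • s i u) = 0 := by
    intro u i
    simp only [s, map_smul, map_sub, smul_eq_mul]
    ring
  refine ⟨fun u => Fin.cons (χ u • a) fun i => χ u • s i u, ?_, ?_, fun u hu i => ?_,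
    fun i => ?_, fun G hG => ?_⟩
  · rw [contDiff_pi]
    intro i
    refine Fin.cases ?_ (fun i => ?_) i
    · exact hχd.smul contDiff_const
    · exact (hsm _ (hs i)).1
  · have : (Fin.cons (χ u₀ • a) fun i => χ u₀ • s i u₀ :
        Fin (m + 1) → EuclideanSpace ℝ (Fin (m + 1))) = b := by
      funext i
      refine Fin.cases ?_ (fun i => ?_) i
      · simp [hχ1, hb0]
      · simp [hχ1, s, ha, hbs]
    exact (congrArg (stdDet (m + 1)) this).trans_ne (stdDet_basis_ne_zero b)
  · exact hker u i
  · obtain ⟨h1, h2, h3⟩ := hsm _ (hs i)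
    refine ⟨BkVectorField.ofTangent B hf hj h1 h2 h3 fun u _ => hker u i, fun u hu => ?_⟩
    rw [BkVectorField.ofTangent_toFun, chartField_symm c _ hu]
    rfl
  · obtain ⟨h1, h2, h3⟩ := hsm (fun _ => a) contDiffOn_const
    refine ⟨BkVectorField.ofSMul B hk hG h1 h2 h3, fun u hu => ?_⟩
    change G (φ.symm u) • chartField c (fun u => χ u • a) (φ.symm u) = _
    rw [chartField_symm c _ hu]
    exact ((chartDeriv c u).map_smul _ _).symm

/-- A `b^k`-form of top degree times an element of `I_Z^k` is smooth across `Z`. -/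
theorem IsBkForm.exists_smooth_mul (hk : 1 ≤ k) {B : BkStructure k m M}
    {f : C^∞⟮𝓡 (m + 1), M; ℝ⟯} {U : Set M} (hf : IsDefiningOn B.Z f U)
    (hj : Ideal.Quotient.mk (vanishingIdeal (m + 1) B.Z ^ k) f = B.jet)
    {θ : Form (m + 1) M (m + 1)} (hθ : IsBkForm B θ) {G : C^∞⟮𝓡 (m + 1), M; ℝ⟯}
    (hG : G ∈ vanishingIdeal (m + 1) B.Z ^ k) {c : M}
    {u₀ : EuclideanSpace ℝ (Fin (m + 1))} (hu₀ : u₀ ∈ chartPart (m + 1) B.Z c) :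
    ∃ W : Set (EuclideanSpace ℝ (Fin (m + 1))), IsOpen W ∧ u₀ ∈ W ∧
      W ⊆ (chartAt (EuclideanSpace ℝ (Fin (m + 1))) c).target ∧
      ∃ H : EuclideanSpace ℝ (Fin (m + 1)) → ℝ, ContDiffOn ℝ ∞ H W ∧
        ∀ u ∈ W, (chartAt (EuclideanSpace ℝ (Fin (m + 1))) c).symm u ∉ B.Z →
          H u = chartFun G c u * localRep θ c u fun i => EuclideanSpace.single i 1 := by
  set φ := chartAt (EuclideanSpace ℝ (Fin (m + 1))) c
  obtain ⟨w, hw, hw0, -, hv, hvG⟩ := exists_adapted_frame hk hf hj hu₀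
  choose v hv using hv
  obtain ⟨v₀, hv₀⟩ := hvG G hG
  set w' : EuclideanSpace ℝ (Fin (m + 1)) → Fin (m + 1) → EuclideanSpace ℝ (Fin (m + 1)) :=
    fun u => Function.update (w u) 0 (chartFun G c u • w u 0)
  obtain ⟨F, hF, hFθ⟩ := hθ.exists_pairing (Fin.cons v₀ v) c w' (by
    intro i
    refine Fin.cases ?_ (fun i => ?_) i
    · intro u hu
      simp only [Fin.cons_zero, w', Function.update_self]
      exact hv₀ u hu
    · intro u hu
      simp only [Fin.cons_succ, w', Function.update_of_ne (Fin.succ_ne_zero i)]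
      exact hv i u hu)
  have hdet : ContDiff ℝ ∞ fun u => stdDet (m + 1) (w u) := (contDiff_stdDet _).comp hw
  have hWo : IsOpen {u | stdDet (m + 1) (w u) ≠ 0} :=
    isOpen_ne_fun hdet.continuous continuous_const
  refine ⟨φ.target ∩ {u | stdDet (m + 1) (w u) ≠ 0}, φ.open_target.inter hWo, ⟨hu₀.1, hw0⟩,
    inter_subset_left, fun u => F u / stdDet (m + 1) (w u),
    (hF.mono inter_subset_left).div hdet.contDiffOn fun u hu => hu.2, fun u hu huZ => ?_⟩
  rw [div_eq_iff hu.2, hFθ u ⟨hu.1, huZ⟩]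
  have h1 : localRep θ c u (w' u) = chartFun G c u * localRep θ c u (w u) := by
    simp only [w']
    rw [(localRep θ c u).map_update_smul, Function.update_eq_self]
    rfl
  rw [h1, apply_eq_stdDet_mul (localRep θ c u) (w u)]
  ring

/-- If `f` is a defining function in the jet and `η` is a `b^k`-form of degree `dim Z`, then
`df ∧ η` is smooth across `Z`: the singular component of `η` is a multiple of `df`. -/
theorem IsBkForm.exists_smooth_wedge (hk : 1 ≤ k) {B : BkStructure k m M}
    {f : C^∞⟮𝓡 (m + 1), M; ℝ⟯} {U : Set M} (hf : IsDefiningOn B.Z f U)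
    (hj : Ideal.Quotient.mk (vanishingIdeal (m + 1) B.Z ^ k) f = B.jet)
    {η : Form (m + 1) M m} (hη : IsBkForm B η) {c : M}
    {u₀ : EuclideanSpace ℝ (Fin (m + 1))} (hu₀ : u₀ ∈ chartPart (m + 1) B.Z c) :
    ∃ W : Set (EuclideanSpace ℝ (Fin (m + 1))), IsOpen W ∧ u₀ ∈ W ∧
      W ⊆ (chartAt (EuclideanSpace ℝ (Fin (m + 1))) c).target ∧
      ∃ H : EuclideanSpace ℝ (Fin (m + 1)) → ℝ, ContDiffOn ℝ ∞ H W ∧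
        ∀ u ∈ W, (chartAt (EuclideanSpace ℝ (Fin (m + 1))) c).symm u ∉ B.Z →
          H u = wedgeRep f η c u fun i => EuclideanSpace.single i 1 := by
  set φ := chartAt (EuclideanSpace ℝ (Fin (m + 1))) c
  obtain ⟨w, hw, hw0, hker, hv, -⟩ := exists_adapted_frame hk hf hj hu₀
  choose v hv using hv
  obtain ⟨F, hF, hFη⟩ := hη.exists_pairing v c (fun u i => w u i.succ) fun i u hu => hv i u hu
  have hdet : ContDiff ℝ ∞ fun u => stdDet (m + 1) (w u) := (contDiff_stdDet _).comp hw
  have hWo : IsOpen {u | stdDet (m + 1) (w u) ≠ 0} :=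
    isOpen_ne_fun hdet.continuous continuous_const
  have hD : ContDiffOn ℝ ∞ (fun u => fderiv ℝ (chartFun f c) u (w u 0)) φ.target :=
    ((contDiffOn_chartFun_target f c).fderiv_of_isOpen φ.open_target (by simp)).clm_apply
      ((contDiff_apply ℝ _ 0).comp hw).contDiffOn
  refine ⟨φ.target ∩ {u | stdDet (m + 1) (w u) ≠ 0}, φ.open_target.inter hWo, ⟨hu₀.1, hw0⟩,
    inter_subset_left, fun u => fderiv ℝ (chartFun f c) u (w u 0) * F u / stdDet (m + 1) (w u),
    ((hD.mul hF).mono inter_subset_left).div hdet.contDiffOn fun u hu => hu.2,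
    fun u hu huZ => ?_⟩
  rw [div_eq_iff hu.2, hFη u ⟨hu.1, huZ⟩, ← wedgeRep_apply_of_ker f η c u (hker u hu.1),
    apply_eq_stdDet_mul (wedgeRep f η c u) (w u)]
  ring

end Regularity

/-! ### Change of charts -/

section Transition

variable {n : ℕ} {M : Type*} [TopologicalSpace M] [ChartedSpace (EuclideanSpace ℝ (Fin n)) M]

/-- The transition map from the preferred chart at `c` to the preferred chart at `c'`. -/
def transition (n : ℕ) {M : Type*} [TopologicalSpace M]
    [ChartedSpace (EuclideanSpace ℝ (Fin n)) M] (c c' : M) :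
    OpenPartialHomeomorph (EuclideanSpace ℝ (Fin n)) (EuclideanSpace ℝ (Fin n)) :=
  (chartAt (EuclideanSpace ℝ (Fin n)) c).symm.trans (chartAt (EuclideanSpace ℝ (Fin n)) c')

lemma transition_source (c c' : M) : (transition n c c').source =
    chartPart n (chartAt (EuclideanSpace ℝ (Fin n)) c').source c := rfl

lemma transition_target (c c' : M) : (transition n c c').target =
    chartPart n (chartAt (EuclideanSpace ℝ (Fin n)) c).source c' := rfl

lemma symm_transition {c c' : M} {u : EuclideanSpace ℝ (Fin n)}
    (hu : u ∈ (transition n c c').source) :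
    (chartAt (EuclideanSpace ℝ (Fin n)) c').symm (transition n c c' u) =
      (chartAt (EuclideanSpace ℝ (Fin n)) c).symm u :=
  (chartAt (EuclideanSpace ℝ (Fin n)) c').left_inv hu.2

lemma Form.congr_point {p : ℕ} (θ : Form n M p) {x x' : M} (h : x = x') :
    (θ x : EuclideanSpace ℝ (Fin n) [⋀^Fin p]→L[ℝ] ℝ) = θ x' := by
  subst h; rfl

/-- The density of a form of top degree in the preferred chart at `c`, with the sign by which the
chart preserves or reverses orientation. -/
def chartDensity (o : OrientationField n M) (θ : Form n M n) (c : M)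
    (u : EuclideanSpace ℝ (Fin n)) : ℝ :=
  ((chartSign o c u : SignType) : ℝ) * localRep θ c u fun i => EuclideanSpace.single i 1

/-- The orientation at a point, as a nonzero alternating form on `ℝ^n`. -/
def orientationForm (o : OrientationField n M) (x : M) :
    EuclideanSpace ℝ (Fin n) [⋀^Fin n]→ₗ[ℝ] ℝ :=
  (o x).someVector

lemma chartSign_eq (o : OrientationField n M) (c : M) (u : EuclideanSpace ℝ (Fin n)) :
    chartSign o c u = SignType.sign (((orientationForm o
      ((chartAt (EuclideanSpace ℝ (Fin n)) c).symm u)).compLinearMap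
        (chartDeriv c u : EuclideanSpace ℝ (Fin n) →L[ℝ] EuclideanSpace ℝ (Fin n)).toLinearMap)
          fun i => EuclideanSpace.single i 1) := rfl

variable [IsManifold (𝓡 n) ∞ M]

lemma contDiffAt_transition {c c' : M} {u : EuclideanSpace ℝ (Fin n)}
    (hu : u ∈ (transition n c c').source) : ContDiffAt ℝ ∞ (transition n c c') u := by
  rw [← contMDiffAt_iff_contDiffAt]
  exact (contMDiffAt_chart hu.2).comp u (contMDiffAt_chart_symm hu.1)

lemma hasFDerivAt_transition {c c' : M} {u : EuclideanSpace ℝ (Fin n)}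
    (hu : u ∈ (transition n c c').source) :
    HasFDerivAt (transition n c c') (fderiv ℝ (transition n c c') u) u :=
  ((contDiffAt_transition hu).differentiableAt (by simp)).hasFDerivAt

/-- The chain rule for the derivatives of the inverse charts. -/
lemma chartDeriv_transition {c c' : M} {u : EuclideanSpace ℝ (Fin n)}
    (hu : u ∈ (transition n c c').source) :
    (chartDeriv c u : EuclideanSpace ℝ (Fin n) →L[ℝ] EuclideanSpace ℝ (Fin n)) =
      (chartDeriv c' (transition n c c' u) :
        EuclideanSpace ℝ (Fin n) →L[ℝ] EuclideanSpace ℝ (Fin n)).comp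
        (fderiv ℝ (transition n c c') u) := by
  have hu' : transition n c c' u ∈ (chartAt (EuclideanSpace ℝ (Fin n)) c').target :=
    ((transition n c c').map_source hu).1
  have h := mfderiv_comp u ((contMDiffAt_chart_symm hu').mdifferentiableAt (by simp))
    ((contDiffAt_transition hu).contMDiffAt.mdifferentiableAt (by simp))
  have h2 : ((chartAt (EuclideanSpace ℝ (Fin n)) c').symm ∘ transition n c c') =ᶠ[𝓝 u]
      (chartAt (EuclideanSpace ℝ (Fin n)) c).symm := by
    filter_upwards [(transition n c c').open_source.mem_nhds hu] with v hv
    exact symm_transition hv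
  rw [mfderiv_eq_fderiv] at h
  exact (h2.mfderiv_eq (I := 𝓡 n) (I' := 𝓡 n)).symm.trans h

lemma mfderiv_chart_comp_chartDeriv {c c' : M} {u : EuclideanSpace ℝ (Fin n)}
    (hu : u ∈ (transition n c c').source) :
    (mfderiv (𝓡 n) (𝓡 n) (chartAt (EuclideanSpace ℝ (Fin n)) c')
      ((chartAt (EuclideanSpace ℝ (Fin n)) c).symm u) :
        EuclideanSpace ℝ (Fin n) →L[ℝ] EuclideanSpace ℝ (Fin n)).comp
      (chartDeriv c u : EuclideanSpace ℝ (Fin n) →L[ℝ] EuclideanSpace ℝ (Fin n)) =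
      fderiv ℝ (transition n c c') u := by
  have h := mfderiv_comp u ((contMDiffAt_chart hu.2).mdifferentiableAt (by simp))
    ((contMDiffAt_chart_symm hu.1).mdifferentiableAt (by simp))
  rw [← mfderiv_eq_fderiv]
  exact h.symm

/-- The expressions of a form in two charts are related by pullback. -/
lemma localRep_transition {p : ℕ} (θ : Form n M p) {c c' : M} {u : EuclideanSpace ℝ (Fin n)}
    (hu : u ∈ (transition n c c').source) :
    localRep θ c u = (localRep θ c' (transition n c c' u)).compContinuousLinearMap
      (fderiv ℝ (transition n c c') u) := by
  ext v
  have h1 := Form.congr_point θ (symm_transition hu)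
  have h2 := chartDeriv_transition hu
  have h3 : localRep θ c u v = (θ ((chartAt (EuclideanSpace ℝ (Fin n)) c).symm u) :
      EuclideanSpace ℝ (Fin n) [⋀^Fin p]→L[ℝ] ℝ) (fun i => (chartDeriv c u :
        EuclideanSpace ℝ (Fin n) →L[ℝ] EuclideanSpace ℝ (Fin n)) (v i)) := rfl
  rw [h3, h2, ← h1]
  rfl

/-- The exterior derivative may be computed in any preferred chart. -/
lemma localRep_extDerivForm {p : ℕ} {θ : Form n M p} {U : Set M} (hU : IsOpen U)
    (hθ : SmoothFormOn U θ) {c : M} {u : EuclideanSpace ℝ (Fin n)} (hu : u ∈ chartPart n U c) :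
    localRep (extDerivForm θ) c u = extDeriv (localRep θ c) u := by
  set x := (chartAt (EuclideanSpace ℝ (Fin n)) c).symm u
  have hus : u ∈ (transition n c x).source := ⟨hu.1, mem_chart_source _ x⟩
  have hτu : transition n c x u = chartAt (EuclideanSpace ℝ (Fin n)) x x := rfl
  have h1 : localRep θ c =ᶠ[𝓝 u] fun v =>
      (localRep θ x (transition n c x v)).compContinuousLinearMap
      (fderiv ℝ (transition n c x) v) := by
    filter_upwards [(transition n c x).open_source.mem_nhds hus] with v hv
    exact localRep_transition θ hv
  have hmem : transition n c x u ∈ chartPart n U x := by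
    refine ⟨((transition n c x).map_source hus).1, ?_⟩
    rw [mem_preimage, symm_transition hus]
    exact hu.2
  have hd : DifferentiableAt ℝ (localRep θ x) (transition n c x u) :=
    ((hθ x).contDiffAt ((isOpen_chartPart hU x).mem_nhds hmem)).differentiableAt (by simp)
  rw [h1.extDeriv_eq, extDeriv_pullback (r := ∞) hd (contDiffAt_transition hus)
      (by simpa using WithTop.coe_le_coe.2 (le_top : (2 : ℕ∞) ≤ ⊤)),
    ← mfderiv_chart_comp_chartDeriv hus, hτu]
  rfl

lemma chartIntegrand_eq [T2Space M] [SigmaCompactSpace M]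
    (o : OrientationField n M) (θ : Form n M n) (c : M) (u : EuclideanSpace ℝ (Fin n)) :
    chartIntegrand o θ c u = chartFun (chartPartition n M c) c u * chartDensity o θ c u := rfl

lemma stdDet_comp_single {n : ℕ} (L : EuclideanSpace ℝ (Fin n) →L[ℝ] EuclideanSpace ℝ (Fin n)) :
    stdDet n (fun i => L (EuclideanSpace.single i 1)) = L.det := by
  have h := (EuclideanSpace.basisFun (Fin n) ℝ).toBasis.det_comp
    (L : EuclideanSpace ℝ (Fin n) →ₗ[ℝ] EuclideanSpace ℝ (Fin n))
    (EuclideanSpace.basisFun (Fin n) ℝ).toBasis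
  rw [Module.Basis.det_self, mul_one] at h
  rw [ContinuousLinearMap.det, ← h, stdDet]
  congr 1
  funext i
  simp

/-- The sign of a chart changes by the sign of the Jacobian determinant. -/
lemma chartSign_transition (o : OrientationField n M) {c c' : M} {u : EuclideanSpace ℝ (Fin n)}
    (hu : u ∈ (transition n c c').source) :
    chartSign o c u = SignType.sign (fderiv ℝ (transition n c c') u).det *
      chartSign o c' (transition n c c' u) := by
  rw [chartSign_eq, chartSign_eq, ← sign_mul, symm_transition hu, chartDeriv_transition hu,
    ← stdDet_comp_single, ← alternatingMap_apply_eq_stdDet_mul]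
  rfl

/-- The density of a form of top degree changes by the absolute value of the Jacobian
determinant. -/
lemma chartDensity_transition (o : OrientationField n M) (θ : Form n M n) {c c' : M}
    {u : EuclideanSpace ℝ (Fin n)} (hu : u ∈ (transition n c c').source) :
    chartDensity o θ c u = |(fderiv ℝ (transition n c c') u).det| *
      chartDensity o θ c' (transition n c c' u) := by
  have h1 : (localRep θ c u fun i => EuclideanSpace.single i 1) =
      (fderiv ℝ (transition n c c') u).det *
        localRep θ c' (transition n c c' u) fun i => EuclideanSpace.single i 1 := by
    rw [localRep_transition θ hu, ← stdDet_comp_single, ← apply_eq_stdDet_mul]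
    rfl
  rw [chartDensity, chartDensity, h1, chartSign_transition o hu,
    ← sign_mul_self (fderiv ℝ (transition n c c') u).det]
  push_cast
  ring

/-- Chart independence of the integral of a form of top degree. -/
lemma integral_chartDensity_transition (o : OrientationField n M) (θ : Form n M n) (g : M → ℝ)
    (c c' : M) :
    ∫ u in chartPart n (chartAt (EuclideanSpace ℝ (Fin n)) c').source c,
        chartFun g c u * chartDensity o θ c u =
      ∫ u in chartPart n (chartAt (EuclideanSpace ℝ (Fin n)) c).source c',
        chartFun g c' u * chartDensity o θ c' u := by
  rw [← transition_source, ← transition_target, integral_target_eq_integral_abs_det_fderiv_smul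
    volume (f := transition n c c') (f' := fderiv ℝ (transition n c c'))
    fun u hu => hasFDerivAt_transition hu]
  refine setIntegral_congr_fun (transition n c c').open_source.measurableSet fun u hu => ?_
  simp only [smul_eq_mul]
  rw [chartDensity_transition o θ hu, chartFun, chartFun, symm_transition hu]
  ring

end Transition

/-! ### Integration of forms and Stokes' theorem -/

section Integration

variable {n : ℕ} {M : Type*} [TopologicalSpace M] [ChartedSpace (EuclideanSpace ℝ (Fin n)) M]

/-- The product of a function and a form. -/
def Form.fmul {p : ℕ} (g : M → ℝ) (θ : Form n M p) : Form n M p := fun x => g x • θ x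

lemma localRep_fmul {p : ℕ} (g : M → ℝ) (θ : Form n M p) (c : M)
    (u : EuclideanSpace ℝ (Fin n)) :
    localRep (θ.fmul g) c u = chartFun g c u • localRep θ c u := rfl

lemma chartDensity_fmul (o : OrientationField n M) (g : M → ℝ) (θ : Form n M n) (c : M)
    (u : EuclideanSpace ℝ (Fin n)) :
    chartDensity o (θ.fmul g) c u = chartFun g c u * chartDensity o θ c u := by
  rw [chartDensity, localRep_fmul, chartDensity]
  exact mul_left_comm _ _ _

lemma Form.eq_zero_of_notMem {p : ℕ} {θ : Form n M p} {x : M} (hx : x ∉ formSupport θ) :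
    θ x = 0 := by
  by_contra h
  exact hx (subset_closure h)

lemma localRep_eq_zero {p : ℕ} {θ : Form n M p} {c : M} {u : EuclideanSpace ℝ (Fin n)}
    (h : (chartAt (EuclideanSpace ℝ (Fin n)) c).symm u ∉ formSupport θ) : localRep θ c u = 0 := by
  rw [localRep, Form.eq_zero_of_notMem h]
  rfl

lemma chartDensity_eq_zero (o : OrientationField n M) {θ : Form n M n} {c : M}
    {u : EuclideanSpace ℝ (Fin n)}
    (h : (chartAt (EuclideanSpace ℝ (Fin n)) c).symm u ∉ formSupport θ) :
    chartDensity o θ c u = 0 := by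
  rw [chartDensity, localRep_eq_zero h]
  exact mul_zero _

lemma chartDensity_add (o : OrientationField n M) (θ η : Form n M n) (c : M)
    (u : EuclideanSpace ℝ (Fin n)) :
    chartDensity o (θ + η) c u = chartDensity o θ c u + chartDensity o η c u := by
  rw [chartDensity, localRep_add]
  exact mul_add _ _ _

lemma formSupport_fmul_subset {p : ℕ} (g : M → ℝ) (θ : Form n M p) :
    formSupport (θ.fmul g) ⊆ tsupport g ∩ formSupport θ := by
  refine subset_inter (closure_mono fun x hx => ?_) (closure_mono fun x hx => ?_)
  · intro h0
    exact hx (by rw [Form.fmul, h0, zero_smul])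
  · intro h0
    exact hx (by rw [Form.fmul, h0, smul_zero])

lemma SmoothFormOn.add {p : ℕ} {U : Set M} {θ η : Form n M p} (hθ : SmoothFormOn U θ)
    (hη : SmoothFormOn U η) : SmoothFormOn U (θ + η) := fun c => by
  rw [localRep_add]; exact (hθ c).add (hη c)

/-- The sign of a chart is locally constant. -/
lemma eventually_chartSign_eq {o : OrientationField n M} (ho : IsManifoldOrientation o) {c : M}
    {u : EuclideanSpace ℝ (Fin n)} (hu : u ∈ (chartAt (EuclideanSpace ℝ (Fin n)) c).target) :
    ∀ᶠ v in 𝓝 u, chartSign o c v = chartSign o c u :=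
  ((ho c).continuousAt
    ((chartAt (EuclideanSpace ℝ (Fin n)) c).open_target.mem_nhds hu)).eventually_mem
    (s := {chartSign o c u}) (by simp [nhds_discrete])

lemma contDiffOn_chartSign {o : OrientationField n M} (ho : IsManifoldOrientation o) (c : M) :
    ContDiffOn ℝ ∞ (fun u => ((chartSign o c u : SignType) : ℝ))
      (chartAt (EuclideanSpace ℝ (Fin n)) c).target := by
  intro u hu
  refine ContDiffAt.contDiffWithinAt ?_
  refine (contDiffAt_const (c := ((chartSign o c u : SignType) : ℝ))).congr_of_eventuallyEq ?_
  filter_upwards [eventually_chartSign_eq ho hu] with v hv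
  rw [hv]

lemma SmoothFormOn.contDiffOn_localRep_apply {p : ℕ} {U : Set M} {θ : Form n M p}
    (hθ : SmoothFormOn U θ) (c : M) (w : Fin p → EuclideanSpace ℝ (Fin n)) :
    ContDiffOn ℝ ∞ (fun u => localRep θ c u w) (chartPart n U c) :=
  (ContinuousAlternatingMap.apply ℝ (EuclideanSpace ℝ (Fin n)) ℝ w).contDiff.comp_contDiffOn
    (hθ c)

lemma SmoothFormOn.contDiffOn_chartDensity {o : OrientationField n M}
    (ho : IsManifoldOrientation o) {U : Set M} {θ : Form n M n}
    (hθ : SmoothFormOn U θ) (c : M) : ContDiffOn ℝ ∞ (chartDensity o θ c) (chartPart n U c) :=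
  ((contDiffOn_chartSign ho c).mono inter_subset_left).mul (hθ.contDiffOn_localRep_apply c _)

lemma measurableSet_chartPart {A : Set M} (hA : IsClosed A) (c : M) :
    MeasurableSet (chartPart n A c) := by
  have h : chartPart n A c =
      (chartAt (EuclideanSpace ℝ (Fin n)) c).target \ chartPart n Aᶜ c := by
    ext u; simp [chartPart]
  rw [h]
  exact (chartAt (EuclideanSpace ℝ (Fin n)) c).open_target.measurableSet.diff
    (isOpen_chartPart hA.isOpen_compl c).measurableSet

lemma chartPart_univ (c : M) :
    chartPart n (univ : Set M) c = (chartAt (EuclideanSpace ℝ (Fin n)) c).target := by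
  simp [chartPart]

/-- A form that is smooth with compact support on a closed set, weighted by a function, is
absolutely integrable in a chart that contains the support of the product. -/
lemma integrableOn_chartDensity [T2Space M] {o : OrientationField n M}
    (ho : IsManifoldOrientation o) {U A : Set M} {θ : Form n M n} (hθ : SmoothFormOn U θ)
    (hc : IsCompact (formSupport θ)) (hA : IsClosed A) (hAU : A ⊆ U) {g : M → ℝ}
    (hg : Continuous g) {c : M}
    (hs : tsupport g ∩ formSupport θ ⊆ (chartAt (EuclideanSpace ℝ (Fin n)) c).source) :
    IntegrableOn (fun u => chartFun g c u * chartDensity o θ c u) (chartPart n A c) := by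
  set φ := chartAt (EuclideanSpace ℝ (Fin n)) c
  set K := tsupport g ∩ formSupport θ ∩ A
  have hK : IsCompact K := (hc.inter_left (isClosed_tsupport g)).inter_right hA
  have hKs : K ⊆ φ.source := inter_subset_left.trans hs
  have hK' : IsCompact (φ '' K) := hK.image_of_continuousOn (φ.continuousOn.mono hKs)
  have hsub : φ '' K ⊆ chartPart n U c := by
    rintro _ ⟨x, hx, rfl⟩
    refine ⟨φ.map_source (hKs hx), ?_⟩
    rw [mem_preimage, φ.left_inv (hKs hx)]
    exact hAU hx.2
  have hcont : ContinuousOn (fun u => chartFun g c u * chartDensity o θ c u) (φ '' K) := by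
    refine ContinuousOn.mul ?_ ((hθ.contDiffOn_chartDensity ho c).continuousOn.mono hsub)
    exact hg.comp_continuousOn (φ.continuousOn_symm.mono (hsub.trans inter_subset_left))
  refine (hcont.integrableOn_compact hK').of_forall_sdiff_eq_zero
    (measurableSet_chartPart hA c) fun u hu => ?_
  by_cases h1 : φ.symm u ∈ tsupport g
  · by_cases h2 : φ.symm u ∈ formSupport θ
    · exact absurd ⟨φ.symm u, ⟨⟨h1, h2⟩, hu.1.2⟩, φ.right_inv hu.1.1⟩ hu.2
    · rw [chartDensity_eq_zero o h2, mul_zero]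
  · rw [chartFun, image_eq_zero_of_notMem_tsupport h1, zero_mul]

variable [IsManifold (𝓡 n) ∞ M] [T2Space M] [SigmaCompactSpace M]

lemma isSubordinate_chartPartition :
    (chartPartition n M).IsSubordinate fun c => (chartAt (EuclideanSpace ℝ (Fin n)) c).source :=
  (SmoothPartitionOfUnity.exists_isSubordinate_chartAt_source (𝓡 n) M).choose_spec

lemma continuous_chartPartition (c : M) : Continuous (chartPartition n M c) :=
  (chartPartition n M c).contMDiff.continuous

/-- The finitely many charts that matter for forms supported in a given compact set. -/
def chartFinset (n : ℕ) {M : Type*} [TopologicalSpace M] [ChartedSpace (EuclideanSpace ℝ (Fin n)) M]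
    [IsManifold (𝓡 n) ∞ M] [T2Space M] [SigmaCompactSpace M] {K : Set M} (hK : IsCompact K) :
    Finset M :=
  ((chartPartition n M).locallyFinite.finite_nonempty_inter_compact hK).toFinset

lemma chartPartition_eq_zero {K : Set M} (hK : IsCompact K) {c x : M}
    (hc : c ∉ chartFinset n hK) (hx : x ∈ K) : chartPartition n M c x = 0 := by
  by_contra h
  exact hc (by simpa [chartFinset] using ⟨x, h, hx⟩)

lemma sum_chartPartition {K : Set M} (hK : IsCompact K) {x : M} (hx : x ∈ K) :
    ∑ c ∈ chartFinset n hK, chartPartition n M c x = 1 := by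
  rw [← (chartPartition n M).sum_eq_one (mem_univ x), finsum_eq_sum_of_support_subset]
  intro c hc
  by_contra h
  exact hc (chartPartition_eq_zero hK (fun hc' => h (Finset.mem_coe.2 hc')) hx)

lemma chartIntegrand_eq_zero (o : OrientationField n M) {θ : Form n M n} {K : Set M}
    (hK : IsCompact K) (hs : formSupport θ ⊆ K) {c : M} (h : c ∉ chartFinset n hK)
    (u : EuclideanSpace ℝ (Fin n)) : chartIntegrand o θ c u = 0 := by
  rw [chartIntegrand_eq]
  by_cases hu : (chartAt (EuclideanSpace ℝ (Fin n)) c).symm u ∈ formSupport θ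
  · rw [chartFun, chartPartition_eq_zero hK h (hs hu), zero_mul]
  · rw [chartDensity_eq_zero o hu, mul_zero]

lemma formIntegral_eq_sum (o : OrientationField n M) {θ : Form n M n} {K : Set M}
    (hK : IsCompact K) (hs : formSupport θ ⊆ K) (A : Set M) :
    formIntegral o A θ =
      ∑ c ∈ chartFinset n hK, ∫ u in chartPart n A c, chartIntegrand o θ c u := by
  refine finsum_eq_sum_of_support_subset _ fun c hcs => ?_
  by_contra h
  refine hcs ?_
  simp [chartIntegrand_eq_zero o hK hs (fun hc' => h (Finset.mem_coe.2 hc'))]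

/-- A form that is smooth near a closed set and has compact support is absolutely integrable over
the closed set. -/
lemma formIntegrableOn_of_smooth {o : OrientationField n M} (ho : IsManifoldOrientation o)
    {U A : Set M} {θ : Form n M n} (hθ : SmoothFormOn U θ) (hc : IsCompact (formSupport θ))
    (hA : IsClosed A) (hAU : A ⊆ U) : FormIntegrableOn o A θ := by
  refine ⟨fun c => ?_, (chartFinset n hc).finite_toSet.subset ?_⟩
  · exact integrableOn_chartDensity ho hθ hc hA hAU (continuous_chartPartition c)
      (inter_subset_left.trans (isSubordinate_chartPartition c))
  · rintro c ⟨u, -, hu⟩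
    by_contra h
    exact hu (chartIntegrand_eq_zero o hc subset_rfl (fun hc' => h (Finset.mem_coe.2 hc')) u)

lemma formIntegral_add (o : OrientationField n M) {A : Set M} {θ η : Form n M n}
    (hθ : FormIntegrableOn o A θ) (hη : FormIntegrableOn o A η) :
    formIntegral o A (θ + η) = formIntegral o A θ + formIntegral o A η := by
  have hfin : ∀ {ζ : Form n M n}, FormIntegrableOn o A ζ →
      (Function.support fun c => ∫ u in chartPart n A c, chartIntegrand o ζ c u).Finite := by
    intro ζ hζ
    refine hζ.2.subset fun c hc => ?_
    by_contra h
    refine hc (setIntegral_eq_zero_of_forall_eq_zero fun u hu => ?_)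
    by_contra h0
    exact h ⟨u, hu, h0⟩
  unfold formIntegral
  rw [← finsum_add_distrib (hfin hθ) (hfin hη)]
  refine finsum_congr fun c => ?_
  rw [← integral_add (hθ.1 c) (hη.1 c)]
  refine integral_congr_ae (Eventually.of_forall fun u => ?_)
  simp only [chartIntegrand_eq, chartDensity_add, mul_add]

/-- If the support of a form lies in the domain of a chart, its integral may be computed in this
chart. -/
lemma formIntegral_eq_of_support_subset {o : OrientationField n M}
    (ho : IsManifoldOrientation o) {θ : Form n M n} (hθ : SmoothFormOn univ θ)
    (hc : IsCompact (formSupport θ)) {c' : M}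
    (hs : formSupport θ ⊆ (chartAt (EuclideanSpace ℝ (Fin n)) c').source) :
    formIntegral o univ θ =
      ∫ u in (chartAt (EuclideanSpace ℝ (Fin n)) c').target, chartDensity o θ c' u := by
  set ρ := chartPartition n M
  have h1 : ∀ c, ∫ u in chartPart n univ c, chartIntegrand o θ c u =
      ∫ u in (chartAt (EuclideanSpace ℝ (Fin n)) c').target,
        chartFun (ρ c) c' u * chartDensity o θ c' u := by
    intro c
    have h2 : ∫ u in chartPart n univ c, chartIntegrand o θ c u =
        ∫ u in chartPart n (chartAt (EuclideanSpace ℝ (Fin n)) c').source c,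
          chartFun (ρ c) c u * chartDensity o θ c u := by
      refine setIntegral_eq_of_subset_of_forall_sdiff_eq_zero
        (measurableSet_chartPart isClosed_univ c)
        (inter_subset_inter_right _ (preimage_mono (subset_univ _))) fun u hu => ?_
      rw [chartIntegrand_eq, chartDensity_eq_zero o fun h => hu.2 ⟨hu.1.1, hs h⟩, mul_zero]
    rw [h2, integral_chartDensity_transition]
    symm
    refine setIntegral_eq_of_subset_of_forall_sdiff_eq_zero
      (chartAt (EuclideanSpace ℝ (Fin n)) c').open_target.measurableSet inter_subset_left
      fun u hu => ?_
    have : ρ c ((chartAt (EuclideanSpace ℝ (Fin n)) c').symm u) = 0 :=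
      image_eq_zero_of_notMem_tsupport fun h =>
        hu.2 ⟨hu.1, isSubordinate_chartPartition c h⟩
    rw [chartFun, this, zero_mul]
  rw [formIntegral_eq_sum o hc subset_rfl]
  simp_rw [h1]
  rw [← integral_finsetSum]
  · refine setIntegral_congr_fun
      (chartAt (EuclideanSpace ℝ (Fin n)) c').open_target.measurableSet fun u _ => ?_
    by_cases hu : (chartAt (EuclideanSpace ℝ (Fin n)) c').symm u ∈ formSupport θ
    · rw [← Finset.sum_mul]
      simp only [chartFun]
      rw [sum_chartPartition (n := n) hc hu, one_mul]
    · simp [chartDensity_eq_zero o hu]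
  · intro c _
    have := integrableOn_chartDensity ho hθ hc isClosed_univ subset_rfl
      (continuous_chartPartition (n := n) c) (c := c') (inter_subset_right.trans hs)
    rwa [chartPart_univ] at this

lemma extDeriv_fun_zero {E : Type*} [NormedAddCommGroup E] [NormedSpace ℝ E] {p : ℕ} (u : E) :
    extDeriv (fun _ : E => (0 : E [⋀^Fin p]→L[ℝ] ℝ)) u = 0 := by
  ext v
  simp [extDeriv, ContinuousAlternatingMap.alternatizeUncurryFin_apply]

/-- Stokes' theorem in `ℝ^(m+1)` for forms with compact support. -/
lemma integral_extDeriv_eq_zero {m : ℕ}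
    {β : EuclideanSpace ℝ (Fin (m + 1)) → EuclideanSpace ℝ (Fin (m + 1)) [⋀^Fin m]→L[ℝ] ℝ}
    (hβ : ContDiff ℝ ∞ β) (hc : HasCompactSupport β)
    (v : Fin (m + 1) → EuclideanSpace ℝ (Fin (m + 1))) :
    ∫ u, extDeriv β u v = 0 := by
  have hd : Differentiable ℝ β := hβ.differentiable (by simp)
  have h1 : ∀ (w : Fin m → EuclideanSpace ℝ (Fin (m + 1))) (a : EuclideanSpace ℝ (Fin (m + 1))),
      Integrable (fun u => fderiv ℝ (fun u => β u w) u a) ∧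
        ∫ u, fderiv ℝ (fun u => β u w) u a = 0 := by
    intro w a
    have hg : ContDiff ℝ ∞ fun u => β u w :=
      (ContinuousAlternatingMap.apply ℝ (EuclideanSpace ℝ (Fin (m + 1))) ℝ w).contDiff.comp hβ
    have hgc : HasCompactSupport fun u => β u w :=
      hc.comp_left (g := fun L : EuclideanSpace ℝ (Fin (m + 1)) [⋀^Fin m]→L[ℝ] ℝ => L w) rfl
    have hi : Integrable fun u => fderiv ℝ (fun u => β u w) u a :=
      (((hg.continuous_fderiv (by simp)).clm_apply
        continuous_const)).integrable_of_hasCompactSupport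
        (hgc.fderiv_apply ℝ a)
    refine ⟨hi, ?_⟩
    have := integral_mul_fderiv_eq_neg_fderiv_mul_of_integrable (𝕜 := ℝ)
      (f := fun _ => (1 : ℝ)) (g := fun u => β u w) (v := a)
      (μ := (volume : Measure (EuclideanSpace ℝ (Fin (m + 1)))))
      (by simp) (by simpa using hi)
      (by simpa using hg.continuous.integrable_of_hasCompactSupport hgc)
      (fun _ _ => differentiableAt_const _) (fun u _ => hg.differentiable (by simp) u)
    simpa using this
  simp_rw [fun u => extDeriv_apply (hd u) v]
  rw [integral_finsetSum _ fun i _ => ((h1 _ _).1.fun_smul _)]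
  refine Finset.sum_eq_zero fun i _ => ?_
  simp_rw [zsmul_eq_mul]
  rw [integral_const_mul, (h1 _ _).2, mul_zero]

end Integration

section Stokes

variable {m : ℕ} {M : Type*} [TopologicalSpace M]
  [ChartedSpace (EuclideanSpace ℝ (Fin (m + 1))) M]

lemma extDerivForm_eq_zero_of_notMem {p : ℕ} {θ : Form (m + 1) M p} {x : M}
    (hx : x ∉ formSupport θ) : extDerivForm θ x = 0 := by
  set φ := chartAt (EuclideanSpace ℝ (Fin (m + 1))) x
  have h1 : localRep θ x =ᶠ[𝓝 (φ x)] fun _ => 0 := by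
    have hmem : φ x ∈ chartPart (m + 1) (formSupport θ)ᶜ x :=
      ⟨φ.map_source (mem_chart_source _ x), by
        rw [mem_preimage, φ.left_inv (mem_chart_source _ x)]; exact hx⟩
    filter_upwards [(isOpen_chartPart isClosed_closure.isOpen_compl x).mem_nhds hmem] with v hv
    exact localRep_eq_zero hv.2
  have h2 : extDeriv (localRep θ x) (φ x) = 0 := by
    rw [h1.extDeriv_eq, extDeriv_fun_zero]
  rw [extDerivForm, show chartAt (EuclideanSpace ℝ (Fin (m + 1))) x = φ from rfl, h2]
  rfl

lemma formSupport_extDerivForm_subset {p : ℕ} (θ : Form (m + 1) M p) :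
    formSupport (extDerivForm θ) ⊆ formSupport θ :=
  closure_minimal (fun _ hx => by_contra fun h => hx (extDerivForm_eq_zero_of_notMem h))
    isClosed_closure

variable [IsManifold (𝓡 (m + 1)) ∞ M]

lemma SmoothFormOn.extDerivForm {p : ℕ} {U : Set M} (hU : IsOpen U) {θ : Form (m + 1) M p}
    (hθ : SmoothFormOn U θ) : SmoothFormOn U (extDerivForm θ) := by
  intro c
  have h1 : ContDiffOn ℝ ∞ (extDeriv (localRep θ c)) (chartPart (m + 1) U c) :=
    (ContinuousAlternatingMap.alternatizeUncurryFinCLM ℝ (EuclideanSpace ℝ (Fin (m + 1)))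
      ℝ).contDiff.comp_contDiffOn ((hθ c).fderiv_of_isOpen (isOpen_chartPart hU c) (by simp))
  exact h1.congr fun u hu => localRep_extDerivForm hU hθ hu

lemma SmoothFormOn.fmul {p : ℕ} {U : Set M} {θ : Form (m + 1) M p} (hθ : SmoothFormOn U θ)
    {g : M → ℝ} (hg : ContMDiffOn (𝓡 (m + 1)) 𝓘(ℝ, ℝ) ∞ g U) : SmoothFormOn U (θ.fmul g) :=
  fun c => (contDiffOn_chartFun hg c).smul (hθ c)

variable [T2Space M] [SigmaCompactSpace M]

lemma formIntegral_extDerivForm_of_support_subset {o : OrientationField (m + 1) M}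
    (ho : IsManifoldOrientation o) {ζ : Form (m + 1) M m} (hζ : SmoothFormOn univ ζ)
    (hc : IsCompact (formSupport ζ)) {c : M}
    (hs : formSupport ζ ⊆ (chartAt (EuclideanSpace ℝ (Fin (m + 1))) c).source) :
    formIntegral o univ (extDerivForm ζ) = 0 := by
  set φ := chartAt (EuclideanSpace ℝ (Fin (m + 1))) c
  have hsub := formSupport_extDerivForm_subset ζ
  rw [formIntegral_eq_of_support_subset ho (hζ.extDerivForm isOpen_univ)
    (hc.of_isClosed_subset isClosed_closure hsub) (hsub.trans hs)]
  have hK : IsCompact (φ '' formSupport ζ) := hc.image_of_continuousOn (φ.continuousOn.mono hs)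
  have hKt : φ '' formSupport ζ ⊆ φ.target := by
    rintro _ ⟨x, hx, rfl⟩
    exact φ.map_source (hs hx)
  -- the expression of the form in the chart, with the sign of the chart, extended by zero
  set β : EuclideanSpace ℝ (Fin (m + 1)) → EuclideanSpace ℝ (Fin (m + 1)) [⋀^Fin m]→L[ℝ] ℝ :=
    indicator φ.target fun u => ((chartSign o c u : SignType) : ℝ) • localRep ζ c u
  have hβ0 : ∀ u ∉ φ '' formSupport ζ, β u = 0 := by
    intro u hu
    by_cases hut : u ∈ φ.target
    · have h1 : localRep ζ c u = 0 := localRep_eq_zero fun h => hu ⟨_, h, φ.right_inv hut⟩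
      simp only [β]
      rw [indicator_of_mem hut, h1, smul_zero]
    · exact indicator_of_notMem hut _
  have hζc : ContDiffOn ℝ ∞ (localRep ζ c) φ.target := by
    have := hζ c
    rwa [preimage_univ, inter_univ] at this
  have hβ : ContDiff ℝ ∞ β := by
    refine contDiff_of_contDiffOn_of_eq_zero φ.open_target hK.isClosed hKt ?_ hβ0
    exact ((contDiffOn_chartSign ho c).smul hζc).congr fun u hu => indicator_of_mem hu _
  have hβc : HasCompactSupport β := HasCompactSupport.intro hK hβ0
  have h1 : ∀ u ∈ φ.target, chartDensity o (extDerivForm ζ) c u =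
      extDeriv β u fun i => EuclideanSpace.single i 1 := by
    intro u hu
    have h2 : β =ᶠ[𝓝 u] ((chartSign o c u : SignType) : ℝ) • localRep ζ c := by
      filter_upwards [eventually_chartSign_eq ho hu, φ.open_target.mem_nhds hu] with v hv hvt
      simp only [β]
      rw [indicator_of_mem hvt, hv]
      rfl
    rw [h2.extDeriv_eq, extDeriv_smul, chartDensity,
      localRep_extDerivForm isOpen_univ hζ (by rwa [chartPart_univ])]
    rfl
  rw [setIntegral_congr_fun φ.open_target.measurableSet h1,
    setIntegral_eq_integral_of_forall_compl_eq_zero, integral_extDeriv_eq_zero hβ hβc]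
  intro u hu
  have h3 : β =ᶠ[𝓝 u] fun _ => 0 := by
    filter_upwards [hK.isClosed.isOpen_compl.mem_nhds fun h => hu (hKt h)] with v hv
    exact hβ0 v hv
  rw [h3.extDeriv_eq, extDeriv_fun_zero]
  rfl

/-- Stokes' theorem for smooth forms with compact support. -/
theorem formIntegral_extDerivForm_eq_zero {o : OrientationField (m + 1) M}
    (ho : IsManifoldOrientation o) {ζ : Form (m + 1) M m} (hζ : SmoothFormOn univ ζ)
    (hc : IsCompact (formSupport ζ)) : formIntegral o univ (extDerivForm ζ) = 0 := by
  classical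
  set ρ := chartPartition (m + 1) M
  have hsum : ζ = ∑ c ∈ chartFinset (m + 1) hc, ζ.fmul (ρ c) := by
    have h1 : ∀ (S : Finset M) (x : M), (∑ c ∈ S, ζ.fmul (ρ c)) x = (∑ c ∈ S, ρ c x) • ζ x := by
      intro S x
      induction S using Finset.induction_on with
      | empty => simp [Form.zero_apply]
      | insert c S hcS ih =>
        rw [Finset.sum_insert hcS, Finset.sum_insert hcS, Form.add_apply, ih, add_smul]
        rfl
    funext x
    rw [h1]
    by_cases hx : x ∈ formSupport ζ
    · rw [sum_chartPartition hc hx, one_smul]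
    · rw [Form.eq_zero_of_notMem hx, smul_zero]
  have hpiece : ∀ c, SmoothFormOn univ (ζ.fmul (ρ c)) ∧ IsCompact (formSupport (ζ.fmul (ρ c))) ∧
      formIntegral o univ (extDerivForm (ζ.fmul (ρ c))) = 0 := by
    intro c
    have h1 : SmoothFormOn univ (ζ.fmul (ρ c)) := hζ.fmul (ρ c).contMDiff.contMDiffOn
    have h2 := formSupport_fmul_subset (ρ c) ζ
    have h3 : IsCompact (formSupport (ζ.fmul (ρ c))) :=
      hc.of_isClosed_subset isClosed_closure (h2.trans inter_subset_right)
    exact ⟨h1, h3, formIntegral_extDerivForm_of_support_subset ho h1 h3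
      ((h2.trans inter_subset_left).trans (isSubordinate_chartPartition c))⟩
  have hall : ∀ S : Finset M, SmoothFormOn univ (∑ c ∈ S, ζ.fmul (ρ c)) ∧
      IsCompact (formSupport (∑ c ∈ S, ζ.fmul (ρ c))) ∧
      formIntegral o univ (extDerivForm (∑ c ∈ S, ζ.fmul (ρ c))) = 0 := by
    intro S
    induction S using Finset.induction_on with
    | empty =>
      refine ⟨fun c => ?_, by simp [formSupport, Form.zero_apply], ?_⟩
      · rw [Finset.sum_empty, localRep_zero]; exact contDiffOn_const
      · have h0 : extDerivForm (0 : Form (m + 1) M m) = 0 := funext fun x => extDerivForm_zero x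
        rw [Finset.sum_empty, h0]
        refine finsum_eq_zero_of_forall_eq_zero fun c => ?_
        refine integral_eq_zero_of_ae (Eventually.of_forall fun u => ?_)
        simp [chartIntegrand, Form.zero_apply]
    | insert c S hcS ih =>
      obtain ⟨h1, h2, h3⟩ := hpiece c
      obtain ⟨i1, i2, i3⟩ := ih
      rw [Finset.sum_insert hcS]
      refine ⟨h1.add i1, (h2.union i2).of_isClosed_subset isClosed_closure ?_, ?_⟩
      · unfold formSupport
        rw [← closure_union]
        refine closure_mono fun x hx => ?_
        by_contra h
        simp only [mem_union, mem_ofPred_eq, not_or, not_not] at h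
        exact hx (by rw [Form.add_apply, h.1, h.2, add_zero])
      · have hadd : extDerivForm (ζ.fmul (ρ c) + ∑ c ∈ S, ζ.fmul (ρ c)) =
            extDerivForm (ζ.fmul (ρ c)) + extDerivForm (∑ c ∈ S, ζ.fmul (ρ c)) :=
          funext fun x => extDerivForm_add isOpen_univ h1 i1 (mem_univ x)
        have hint : ∀ {ξ : Form (m + 1) M m}, SmoothFormOn univ ξ → IsCompact (formSupport ξ) →
            FormIntegrableOn o univ (extDerivForm ξ) := fun hξ hξc =>
          formIntegrableOn_of_smooth ho (hξ.extDerivForm isOpen_univ)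
            (hξc.of_isClosed_subset isClosed_closure (formSupport_extDerivForm_subset _))
            isClosed_univ subset_rfl
        rw [hadd, formIntegral_add o (hint h1 h2) (hint i1 i2), h3, i3, add_zero]
  rw [hsum]
  exact (hall _).2.2

end Stokes

/-! ### Integrals with a pole along a hypersurface of a vector space -/

section Pole

variable {E : Type*} [NormedAddCommGroup E] [NormedSpace ℝ E] {V : Set E} {y y' T χ : E → ℝ}

/-- On the open set `V` the function `y` is smooth, with nonzero derivative at its zeros, and `T` is
smooth off the zeros of `y`. -/
structure IsPolePair (V : Set E) (y T : E → ℝ) : Prop where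
  isOpen : IsOpen V
  contDiffOn : ContDiffOn ℝ ∞ y V
  fderiv_ne_zero : ∀ u ∈ V, y u = 0 → fderiv ℝ y u ≠ 0
  contDiffOn_pole : ContDiffOn ℝ ∞ T (V ∩ {u | y u ≠ 0})

/-- Near a point where `y` does not vanish, `|y|` is bounded away from `0`. -/
lemma IsPolePair.exists_nhds (h : IsPolePair V y T) {u₀ : E} (hu₀ : u₀ ∈ V) (h0 : y u₀ ≠ 0) :
    ∃ W ∈ 𝓝 u₀, ∃ δ > 0, ∀ u ∈ W, δ ≤ |y u| := by
  have hc : ContinuousAt y u₀ :=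
    h.contDiffOn.continuousOn.continuousAt (h.isOpen.mem_nhds hu₀)
  have hpos : |y u₀| / 2 < |y u₀| := half_lt_self (abs_pos.2 h0)
  exact ⟨{u | |y u₀| / 2 ≤ |y u|},
    (hc.abs.eventually (lt_mem_nhds hpos)).mono fun u hu => le_of_lt hu,
    |y u₀| / 2, half_pos (abs_pos.2 h0), fun u hu => hu⟩

variable [MeasurableSpace E] [BorelSpace E] (μ : Measure E)

lemma IsPolePair.integrable [IsFiniteMeasureOnCompacts μ] (h : IsPolePair V y T)
    (hχ : IsTestFunction V χ) {Ψ : ℝ → ℝ}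
    (hΨ : Measurable Ψ) {C : ℝ} (hC : ∀ t, |Ψ t| ≤ C) {δ : ℝ} (hδ : 0 < δ)
    (h0 : ∀ t, |t| < δ → Ψ t = 0) : Integrable (fun u => Ψ (y u) * (χ u * T u)) μ := by
  set K := tsupport χ ∩ y ⁻¹' {t | δ ≤ |t|}
  have hyc : ContinuousOn y (tsupport χ) := h.contDiffOn.continuousOn.mono hχ.tsupport_subset
  have hK : IsCompact K := by
    refine hχ.hasCompactSupport.isCompact.of_isClosed_subset ?_ inter_subset_left
    exact hyc.preimage_isClosed_of_isClosed (isClosed_tsupport χ)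
      (isClosed_le continuous_const continuous_abs)
  have hKV : K ⊆ V ∩ {u | y u ≠ 0} := by
    rintro u ⟨hu, hu'⟩
    refine ⟨hχ.tsupport_subset hu, fun h0 => ?_⟩
    have : δ ≤ |y u| := hu'
    rw [h0, abs_zero] at this
    linarith
  have h1 : IntegrableOn (fun u => χ u * T u) K μ :=
    (hχ.contDiff.continuous.continuousOn.mul
      (h.contDiffOn_pole.continuousOn.mono hKV)).integrableOn_compact hK
  have h2 : IntegrableOn (fun u => Ψ (y u) * (χ u * T u)) K μ := by
    refine h1.bdd_mul (c := C) ?_ (Eventually.of_forall fun u => hC _)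
    have : AEMeasurable y (μ.restrict K) :=
      (hyc.mono inter_subset_left).aemeasurable hK.measurableSet
    exact (hΨ.comp_aemeasurable this).aestronglyMeasurable
  rw [← integrableOn_univ]
  refine h2.of_forall_sdiff_eq_zero MeasurableSet.univ fun u hu => ?_
  by_cases hu1 : u ∈ tsupport χ
  · rw [h0 _ (not_le.1 fun h3 => hu.2 ⟨hu1, h3⟩), zero_mul]
  · rw [image_eq_zero_of_notMem_tsupport hu1, zero_mul, mul_zero]

variable [FiniteDimensional ℝ E] [μ.IsAddHaarMeasure]

/-- Integrals of functions with a pole of order `N + 1` along the hypersurface `y = 0`, cut off near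
the hypersurface, have an asymptotic expansion. -/
theorem IsPolePair.hasExpansion (h : IsPolePair V y T) {N : ℕ}
    (hT : ∀ u ∈ V, y u = 0 → ∃ W, IsOpen W ∧ u ∈ W ∧ ∃ H : E → ℝ, ContDiffOn ℝ ∞ H W ∧
      ∀ v ∈ W, y v ≠ 0 → H v = y v ^ (N + 1) * T v) (hχ : IsTestFunction V χ) :
    HasExpansion N (fun Φ ε => ∫ u, Φ (y u / ε) * (χ u * T u) ∂μ) := by
  refine hχ.induction_local
    (P := fun χ => HasExpansion N fun Φ ε => ∫ u, Φ (y u / ε) * (χ u * T u) ∂μ) ?_ ?_ ?_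
  · simpa using HasExpansion.zero
  · intro f g hf hg h1 h2
    refine (h1.add h2).congr' fun Φ hΦ => ?_
    filter_upwards [self_mem_nhdsWithin] with ε hε
    have hε : 0 < ε := hε
    have hint : ∀ f, IsTestFunction V f → Integrable (fun u => Φ (y u / ε) * (f u * T u)) μ := by
      intro f hf
      refine h.integrable μ hf (Ψ := fun t => Φ (t / ε)) (C := 1) (δ := ε)
        (hΦ.measurable.comp (measurable_id.div_const ε)) (fun t => hΦ.abs_le_one _) hε
        fun t ht => hΦ.eq_zero _ ?_
      rwa [abs_div, abs_of_pos hε, div_lt_one hε]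
    rw [← integral_add (hint f hf) (hint g hg)]
    refine integral_congr_ae (Eventually.of_forall fun u => ?_)
    simp only [Pi.add_apply]
    ring
  · intro u₀ hu₀
    by_cases h0 : y u₀ = 0
    · obtain ⟨W, hW, hu₀W, H, hH, hHT⟩ := hT u₀ hu₀ h0
      obtain ⟨W', hW', hdens⟩ := exists_density μ h.isOpen h.contDiffOn hu₀
        (h.fderiv_ne_zero u₀ hu₀ h0)
      refine ⟨W ∩ W', inter_mem (hW.mem_nhds hu₀W) hW', fun f hf => ?_⟩
      have hfH : IsTestFunction W' (fun u => H u * f u) := by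
        have h1 := (hf.mono (inter_subset_right.trans inter_subset_left)).mul_contDiffOn hW hH
        exact ⟨h1.contDiff, h1.hasCompactSupport, tsupport_mul_subset_right.trans
          (hf.tsupport_subset.trans (inter_subset_right.trans inter_subset_right))⟩
      obtain ⟨g, hg, hgc, hgd⟩ := hdens _ hfH
      refine (hasExpansion_div_pow hg hgc).congr' fun Φ hΦ => ?_
      filter_upwards [self_mem_nhdsWithin] with ε hε
      have hε : 0 < ε := hε
      have h1 := hgd (fun t => Φ (t / ε) / t ^ (N + 1))
        ((hΦ.measurable.comp (measurable_id.div_const ε)).div (measurable_id.pow_const _))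
        ⟨1 / ε ^ (N + 1), fun t => by
          rcases lt_or_ge |t| ε with ht | ht
          · rw [hΦ.eq_zero _ (by rwa [abs_div, abs_of_pos hε, div_lt_one hε])]
            simp only [zero_div, abs_zero]
            positivity
          · rw [abs_div, abs_pow]
            exact div_le_div₀ zero_le_one (hΦ.abs_le_one _) (by positivity)
              (pow_le_pow_left₀ hε.le ht _)⟩
      calc ∫ t, Φ (t / ε) * (g t / t ^ (N + 1))
          = ∫ t, Φ (t / ε) / t ^ (N + 1) * g t := by
            refine integral_congr_ae (Eventually.of_forall fun t => ?_)
            simp only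
            ring
        _ = _ := h1.symm
        _ = _ := by
            refine integral_congr_ae (Eventually.of_forall fun u => ?_)
            simp only
            by_cases hu : u ∈ W
            · by_cases hy0 : y u = 0
              · rw [hy0, zero_div, hΦ.eq_zero 0 (by simp)]
                simp
              · rw [hHT u hu hy0]
                field_simp
            · rw [hf.eq_zero fun h => hu h.2.1]
              simp
    · obtain ⟨W, hW, δ, hδ, hδW⟩ := h.exists_nhds hu₀ h0
      refine ⟨W, hW, fun f hf => ?_⟩
      refine HasExpansion.of_tendsto (C := ∫ u, f u * T u ∂μ) fun Φ hΦ => ?_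
      refine tendsto_const_nhds.congr' ?_
      filter_upwards [hΦ.eventually_div_eq_one hδ] with ε hε
      refine integral_congr_ae (Eventually.of_forall fun u => ?_)
      simp only
      by_cases hu : u ∈ W
      · rw [hε _ (hδW u hu), one_mul]
      · rw [hf.eq_zero fun h => hu h.2]
        simp

lemma deriv_smoothCutoff_eq_zero_of_lt {s : ℝ} (hs : |s| < 1) : deriv smoothCutoff s = 0 := by
  have : smoothCutoff =ᶠ[𝓝 s] fun _ => 0 := by
    filter_upwards [(isOpen_lt continuous_abs continuous_const).mem_nhds hs] with t ht
    exact isCutoff_smoothCutoff.eq_zero t ht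
  rw [this.deriv_eq, deriv_const]

lemma deriv_smoothCutoff_eq_zero_of_le {s : ℝ} (hs : 2 ≤ |s|) : deriv smoothCutoff s = 0 := by
  -- the cutoff attains its maximum at `s`
  refine IsLocalMax.deriv_eq_zero (Eventually.of_forall fun t => ?_)
  rw [isCutoff_smoothCutoff.eq_one s hs]
  exact isCutoff_smoothCutoff.le_one t

lemma continuous_deriv_smoothCutoff : Continuous (deriv smoothCutoff) :=
  contDiff_smoothCutoff.continuous_deriv (by simp)

lemma integral_deriv_smoothCutoff : ∫ s, deriv smoothCutoff s = 0 := by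
  refine integral_eq_zero_of_odd fun t => ?_
  have h : (fun s => smoothCutoff (-s)) = smoothCutoff := funext isCutoff_smoothCutoff.even
  have h1 := deriv_comp_neg smoothCutoff t
  rw [h] at h1
  linarith

lemma exists_abs_deriv_smoothCutoff_le : ∃ C, ∀ s, |deriv smoothCutoff s| ≤ C := by
  obtain ⟨C, hC⟩ := (isCompact_Icc (a := (-2 : ℝ)) (b := 2)).exists_bound_of_continuousOn
    continuous_deriv_smoothCutoff.continuousOn
  refine ⟨C, fun s => ?_⟩
  by_cases hs : |s| ≤ 2
  · exact hC s (abs_le.1 hs)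
  · rw [deriv_smoothCutoff_eq_zero_of_le (not_le.1 hs).le, abs_zero]
    exact (norm_nonneg _).trans (hC 0 (by simp))

/-- If `T` extends smoothly over the zeros of `y`, its integral against the derivative of the
cutoff, which is odd and concentrates along `y = 0`, tends to zero. -/
theorem IsPolePair.tendsto_integral_deriv (h : IsPolePair V y T)
    (hT : ∀ u ∈ V, y u = 0 → ∃ W, IsOpen W ∧ u ∈ W ∧ ∃ H : E → ℝ, ContDiffOn ℝ ∞ H W ∧
      ∀ v ∈ W, y v ≠ 0 → H v = T v) (hχ : IsTestFunction V χ) :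
    Tendsto (fun ε => ∫ u, ε⁻¹ * deriv smoothCutoff (y u / ε) * (χ u * T u) ∂μ)
      (𝓝[>] 0) (𝓝 0) := by
  obtain ⟨C, hC⟩ := exists_abs_deriv_smoothCutoff_le
  refine hχ.induction_local (P := fun χ => Tendsto (fun ε =>
    ∫ u, ε⁻¹ * deriv smoothCutoff (y u / ε) * (χ u * T u) ∂μ) (𝓝[>] 0) (𝓝 0)) ?_ ?_ ?_
  · simp
  · intro f g hf hg h1 h2
    have h3 := h1.add h2
    rw [add_zero] at h3
    refine h3.congr' ?_
    filter_upwards [self_mem_nhdsWithin] with ε hε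
    have hε : 0 < ε := hε
    have hint : ∀ f, IsTestFunction V f →
        Integrable (fun u => ε⁻¹ * deriv smoothCutoff (y u / ε) * (f u * T u)) μ := by
      intro f hf
      refine h.integrable μ hf (Ψ := fun t => ε⁻¹ * deriv smoothCutoff (t / ε)) (C := |ε⁻¹| * C)
        (δ := ε) ((continuous_deriv_smoothCutoff.measurable.comp
          (measurable_id.div_const ε)).const_mul _) (fun t => ?_) hε fun t ht => ?_
      · rw [abs_mul]
        exact mul_le_mul_of_nonneg_left (hC _) (abs_nonneg _)
      · rw [deriv_smoothCutoff_eq_zero_of_lt (by rwa [abs_div, abs_of_pos hε, div_lt_one hε]),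
          mul_zero]
    rw [← integral_add (hint f hf) (hint g hg)]
    refine integral_congr_ae (Eventually.of_forall fun u => ?_)
    simp only [Pi.add_apply]
    ring
  · intro u₀ hu₀
    by_cases h0 : y u₀ = 0
    · obtain ⟨W, hW, hu₀W, H, hH, hHT⟩ := hT u₀ hu₀ h0
      refine ⟨W, hW.mem_nhds hu₀W, fun f hf => ?_⟩
      have hfH : IsTestFunction V (fun u => H u * f u) := by
        have h1 := (hf.mono inter_subset_right).mul_contDiffOn hW hH
        exact ⟨h1.contDiff, h1.hasCompactSupport, tsupport_mul_subset_right.trans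
          (hf.tsupport_subset.trans inter_subset_left)⟩
      refine (tendsto_integral_concentrated μ h.isOpen h.contDiffOn h.fderiv_ne_zero hfH
        continuous_deriv_smoothCutoff.measurable hC
        (fun s hs => deriv_smoothCutoff_eq_zero_of_le hs) integral_deriv_smoothCutoff).congr
        fun ε => integral_congr_ae (Eventually.of_forall fun u => ?_)
      simp only
      by_cases hu : u ∈ W
      · by_cases hy0 : y u = 0
        · rw [hy0, zero_div, deriv_smoothCutoff_eq_zero_of_lt (by simp)]
          simp
        · rw [hHT u hu hy0]
          ring
      · rw [hf.eq_zero fun h => hu h.2]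
        simp
    · obtain ⟨W, hW, δ, hδ, hδW⟩ := h.exists_nhds hu₀ h0
      refine ⟨W, hW, fun f hf => ?_⟩
      refine tendsto_const_nhds.congr' ?_
      have h1 : ∀ᶠ ε in 𝓝[>] (0 : ℝ), ε < δ / 2 :=
        mem_nhdsWithin_of_mem_nhds (Iio_mem_nhds (by positivity))
      filter_upwards [h1, self_mem_nhdsWithin] with ε hε hε0
      have hε0 : 0 < ε := hε0
      symm
      refine integral_eq_zero_of_ae (Eventually.of_forall fun u => ?_)
      simp only [Pi.zero_apply]
      by_cases hu : u ∈ W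
      · rw [deriv_smoothCutoff_eq_zero_of_le, mul_zero, zero_mul]
        rw [abs_div, abs_of_pos hε0, le_div_iff₀ hε0]
        linarith [hδW u hu]
      · rw [hf.eq_zero fun h => hu h.2]
        simp

end Pole

/-! ### Change of the defining function -/

section Interpolation

/-- Interpolation between two functions, from the first for `p.2 ≤ 0` to the second for
`1 ≤ p.2`. -/
def interpolate {X : Type*} (y y' : X → ℝ) (p : X × ℝ) : ℝ :=
  y p.1 + Real.smoothTransition p.2 * (y' p.1 - y p.1)

lemma deriv_smoothTransition_eq_zero {σ : ℝ} (hσ : σ ∉ Icc (0 : ℝ) 1) :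
    deriv Real.smoothTransition σ = 0 := by
  rcases lt_or_ge σ 0 with h | h
  · have : Real.smoothTransition =ᶠ[𝓝 σ] fun _ => 0 := by
      filter_upwards [Iio_mem_nhds h] with t ht
      exact Real.smoothTransition.zero_of_nonpos (le_of_lt ht)
    rw [this.deriv_eq, deriv_const]
  · have h' : 1 < σ := by
      by_contra h1
      exact hσ ⟨h, not_lt.1 h1⟩
    have : Real.smoothTransition =ᶠ[𝓝 σ] fun _ => 1 := by
      filter_upwards [Ioi_mem_nhds h'] with t ht
      exact Real.smoothTransition.one_of_one_le (le_of_lt ht)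
    rw [this.deriv_eq, deriv_const]

/-- The fundamental theorem of calculus along the interpolation. -/
lemma integral_deriv_interpolate {X : Type*} {y y' : X → ℝ} {Φ : ℝ → ℝ}
    (hΦ : ContDiff ℝ ∞ Φ) (u : X) (ε : ℝ) :
    ∫ σ, ε⁻¹ * deriv Φ (interpolate y y' (u, σ) / ε) *
      ((y' u - y u) * deriv Real.smoothTransition σ) = Φ (y' u / ε) - Φ (y u / ε) := by
  have hst : ContDiff ℝ ∞ Real.smoothTransition := Real.smoothTransition.contDiff
  have hderiv : ∀ σ, HasDerivAt (fun σ => Φ (interpolate y y' (u, σ) / ε))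
      (ε⁻¹ * deriv Φ (interpolate y y' (u, σ) / ε) *
        ((y' u - y u) * deriv Real.smoothTransition σ)) σ := by
    intro σ
    have h1 : HasDerivAt Real.smoothTransition (deriv Real.smoothTransition σ) σ :=
      (hst.differentiable (by simp) σ).hasDerivAt
    have h2 : HasDerivAt (fun σ => interpolate y y' (u, σ) / ε)
        (deriv Real.smoothTransition σ * (y' u - y u) / ε) σ :=
      ((h1.mul_const (y' u - y u)).const_add (y u)).div_const ε
    have h3 := (hΦ.differentiable (by simp) (interpolate y y' (u, σ) / ε)).hasDerivAt.comp σ h2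
    refine h3.congr_deriv ?_
    rw [div_eq_inv_mul]
    ring
  refine integral_of_hasDerivAt_of_tendsto hderiv ?_ ?_ ?_
  · refine Continuous.integrable_of_hasCompactSupport ?_
      (HasCompactSupport.intro (isCompact_Icc (a := (0 : ℝ)) (b := 1)) fun σ hσ => ?_)
    · have h1 : Continuous fun σ => interpolate y y' (u, σ) / ε := by
        have h0 := hst.continuous
        change Continuous fun σ => (y u + Real.smoothTransition σ * (y' u - y u)) / ε
        fun_prop
      exact (continuous_const.mul ((hΦ.continuous_deriv (by simp)).comp h1)).mul
        (continuous_const.mul (hst.continuous_deriv (by simp)))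
    · rw [deriv_smoothTransition_eq_zero hσ, mul_zero, mul_zero]
  · refine tendsto_const_nhds.congr' ?_
    filter_upwards [Iic_mem_atBot (0 : ℝ)] with σ hσ
    simp [interpolate, Real.smoothTransition.zero_of_nonpos hσ]
  · refine tendsto_const_nhds.congr' ?_
    filter_upwards [Ici_mem_atTop (1 : ℝ)] with σ hσ
    simp [interpolate, Real.smoothTransition.one_of_one_le hσ]

variable {E : Type*} [NormedAddCommGroup E] [NormedSpace ℝ E] {V : Set E} {y y' T χ : E → ℝ}

lemma contDiffOn_interpolate (hy : ContDiffOn ℝ ∞ y V) (hy' : ContDiffOn ℝ ∞ y' V) :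
    ContDiffOn ℝ ∞ (interpolate y y') (V ×ˢ univ) := by
  have h1 : ContDiffOn ℝ ∞ (fun p : E × ℝ => y p.1) (V ×ˢ univ) :=
    hy.comp contDiff_fst.contDiffOn fun p hp => hp.1
  have h2 : ContDiffOn ℝ ∞ (fun p : E × ℝ => y' p.1) (V ×ˢ univ) :=
    hy'.comp contDiff_fst.contDiffOn fun p hp => hp.1
  exact h1.add ((Real.smoothTransition.contDiff.comp contDiff_snd).contDiffOn.mul (h2.sub h1))

lemma fderiv_interpolate_ne_zero {u : E} {σ : ℝ} (hV : IsOpen V) (hy : ContDiffOn ℝ ∞ y V)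
    (hy' : ContDiffOn ℝ ∞ y' V) (hu : u ∈ V)
    (h : ∀ s ∈ Icc (0 : ℝ) 1, (1 - s) • fderiv ℝ y u + s • fderiv ℝ y' u ≠ 0) :
    fderiv ℝ (interpolate y y') (u, σ) ≠ 0 := by
  intro h0
  set s := Real.smoothTransition σ
  refine h s ⟨Real.smoothTransition.nonneg σ, Real.smoothTransition.le_one σ⟩ ?_
  have hd : ∀ {z : E → ℝ}, ContDiffOn ℝ ∞ z V → DifferentiableAt ℝ z u := fun hz =>
    (hz.contDiffAt (hV.mem_nhds hu)).differentiableAt (by simp)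
  have h1 : HasFDerivAt (interpolate y y') (0 : E × ℝ →L[ℝ] ℝ) (u, σ) := by
    rw [← h0]
    refine DifferentiableAt.hasFDerivAt ?_
    exact ((contDiffOn_interpolate hy hy').contDiffAt ((hV.prod isOpen_univ).mem_nhds
      ⟨hu, mem_univ _⟩)).differentiableAt (by simp)
  have h2 : HasFDerivAt (fun v : E => (v, σ)) (ContinuousLinearMap.inl ℝ E ℝ) u :=
    hasFDerivAt_prodMk_left u σ
  have h3 := h1.comp u h2
  have h4 : HasFDerivAt (fun v => y v + s * (y' v - y v))
      (fderiv ℝ y u + s • (fderiv ℝ y' u - fderiv ℝ y u)) u :=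
    (hd hy).hasFDerivAt.add (((hd hy').hasFDerivAt.sub (hd hy).hasFDerivAt).const_mul s)
  have h5 := h4.unique h3
  rw [ContinuousLinearMap.zero_comp] at h5
  rw [← h5]
  module

variable [MeasurableSpace E] [BorelSpace E] (μ : Measure E)

lemma IsPolePair.integrable_smoothCutoff [IsFiniteMeasureOnCompacts μ] (h : IsPolePair V y T)
    (hχ : IsTestFunction V χ) {ε : ℝ}
    (hε : 0 < ε) : Integrable (fun u => smoothCutoff (y u / ε) * (χ u * T u)) μ := by
  refine h.integrable μ hχ (Ψ := fun t => smoothCutoff (t / ε)) (C := 1) (δ := ε)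
    (isCutoff_smoothCutoff.measurable.comp (measurable_id.div_const ε))
    (fun t => isCutoff_smoothCutoff.abs_le_one _) hε
    fun t ht => isCutoff_smoothCutoff.eq_zero _ ?_
  rwa [abs_div, abs_of_pos hε, div_lt_one hε]

variable [FiniteDimensional ℝ E] [μ.IsAddHaarMeasure]

/-- The local form of `IsPolePair.tendsto_sub`. The difference is an integral over `E × ℝ` that
concentrates along the zeros of the interpolation. -/
lemma IsPolePair.exists_nhds_tendsto_sub (h : IsPolePair V y T) (h' : IsPolePair V y' T)
    (hzero : ∀ u ∈ V, y u = 0 ↔ y' u = 0) {u₀ : E} (hu₀ : u₀ ∈ V)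
    (hne : ∀ s ∈ Icc (0 : ℝ) 1, (1 - s) • fderiv ℝ y u₀ + s • fderiv ℝ y' u₀ ≠ 0)
    (hT : ∃ W, IsOpen W ∧ u₀ ∈ W ∧ ∃ H : E → ℝ, ContDiffOn ℝ ∞ H W ∧
      ∀ v ∈ W, y v ≠ 0 → H v = (y' v - y v) * T v) :
    ∃ W ∈ 𝓝 u₀, ∀ f, IsTestFunction (V ∩ W) f →
      Tendsto (fun ε => ∫ u, smoothCutoff (y' u / ε) * (f u * T u) ∂μ -
        ∫ u, smoothCutoff (y u / ε) * (f u * T u) ∂μ) (𝓝[>] 0) (𝓝 0) := by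
  have hy' := h'.contDiffOn
  obtain ⟨W, hW, hu₀W, H, hH, hHT⟩ := hT
  -- by compactness of `[0, 1]`, the interpolation is nondegenerate near `u₀`
  obtain ⟨W', hW', hu₀W', hW'V⟩ : ∃ W', IsOpen W' ∧ u₀ ∈ W' ∧ ∀ u ∈ W', ∀ s ∈ Icc (0 : ℝ) 1,
      (1 - s) • fderiv ℝ y u + s • fderiv ℝ y' u ≠ 0 := by
    have h1 := (isCompact_Icc (a := (0 : ℝ)) (b := 1)).eventually_forall_of_forall_eventually
      (x₀ := u₀) (P := fun u s => (1 - s) • fderiv ℝ y u + s • fderiv ℝ y' u ≠ 0)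
      fun s hs => by
        have hc : ∀ {z : E → ℝ}, ContDiffOn ℝ ∞ z V → ContinuousAt (fderiv ℝ z) u₀ :=
          fun hz => (hz.continuousOn_fderiv_of_isOpen h.isOpen (by simp)).continuousAt
            (h.isOpen.mem_nhds hu₀)
        have hcont : ContinuousAt (fun p : E × ℝ =>
            (1 - p.2) • fderiv ℝ y p.1 + p.2 • fderiv ℝ y' p.1) (u₀, s) :=
          ((continuousAt_const.sub continuousAt_snd).smul
            (ContinuousAt.comp (x := (u₀, s)) (f := Prod.fst) (hc h.contDiffOn)
              continuousAt_fst)).add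
            (continuousAt_snd.smul (ContinuousAt.comp (x := (u₀, s)) (f := Prod.fst) (hc hy')
              continuousAt_fst))
        exact hcont.eventually_ne (hne s hs)
    exact ⟨_, isOpen_interior, mem_interior_iff_mem_nhds.2 h1, fun u hu => interior_subset hu⟩
  refine ⟨W ∩ W', inter_mem (hW.mem_nhds hu₀W) (hW'.mem_nhds hu₀W'), fun f hf => ?_⟩
  have hV' : IsOpen (V ∩ (W ∩ W')) := h.isOpen.inter (hW.inter hW')
  have hprod : IsOpen ((V ∩ (W ∩ W')) ×ˢ (univ : Set ℝ)) := hV'.prod isOpen_univ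
  have hY := contDiffOn_interpolate (h.contDiffOn.mono (inter_subset_left (t := W ∩ W')))
    (hy'.mono inter_subset_left)
  have hfH : IsTestFunction (V ∩ (W ∩ W')) fun u => H u * f u :=
    hf.mul_contDiffOn hV' (hH.mono (inter_subset_right.trans inter_subset_left))
  have hh : IsTestFunction ((V ∩ (W ∩ W')) ×ˢ (univ : Set ℝ))
      fun p => H p.1 * f p.1 * deriv Real.smoothTransition p.2 := by
    have h0 : ∀ p ∉ tsupport (fun u => H u * f u) ×ˢ Icc (0 : ℝ) 1,
        H p.1 * f p.1 * deriv Real.smoothTransition p.2 = 0 := by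
      intro p hp
      by_cases hp1 : p.1 ∈ tsupport fun u => H u * f u
      · rw [deriv_smoothTransition_eq_zero fun hp2 => hp ⟨hp1, hp2⟩, mul_zero]
      · rw [image_eq_zero_of_notMem_tsupport hp1, zero_mul]
    have hK : IsCompact (tsupport (fun u => H u * f u) ×ˢ Icc (0 : ℝ) 1) :=
      hfH.hasCompactSupport.isCompact.prod isCompact_Icc
    refine ⟨(hfH.contDiff.comp contDiff_fst).mul
      ((contDiff_infty_iff_deriv.1 Real.smoothTransition.contDiff).2.comp contDiff_snd),
      HasCompactSupport.intro hK h0, ?_⟩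
    refine (closure_minimal (fun p hp => ?_) hK.isClosed).trans
      (prod_mono hfH.tsupport_subset (subset_univ _))
    by_contra h1
    exact hp (h0 p h1)
  obtain ⟨C, hC⟩ := exists_abs_deriv_smoothCutoff_le
  refine (tendsto_integral_concentrated (μ.prod volume) hprod hY (fun p hp _ =>
    fderiv_interpolate_ne_zero h.isOpen h.contDiffOn hy' hp.1.1 (hW'V _ hp.1.2.2)) hh
    continuous_deriv_smoothCutoff.measurable hC
    (fun s hs => deriv_smoothCutoff_eq_zero_of_le hs) integral_deriv_smoothCutoff).congr' ?_
  filter_upwards [self_mem_nhdsWithin] with ε hε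
  have hε : 0 < ε := hε
  have hint2 : Integrable (fun p : E × ℝ => ε⁻¹ * deriv smoothCutoff (interpolate y y' p / ε) *
      (H p.1 * f p.1 * deriv Real.smoothTransition p.2)) (μ.prod volume) := by
    have h1 := hh.mul_contDiffOn hprod (contDiffOn_const (c := ε⁻¹) |>.mul
      ((contDiff_infty_iff_deriv.1 contDiff_smoothCutoff).2.comp_contDiffOn
        (hY.div_const ε)))
    exact h1.contDiff.continuous.integrable_of_hasCompactSupport h1.hasCompactSupport
  have hfV : IsTestFunction V f := hf.mono inter_subset_left
  rw [integral_prod _ hint2, ← integral_sub (h'.integrable_smoothCutoff μ hfV hε)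
    (h.integrable_smoothCutoff μ hfV hε)]
  refine integral_congr_ae (Eventually.of_forall fun u => ?_)
  simp only
  by_cases hu : u ∈ V ∩ (W ∩ W')
  · by_cases hy0 : y u = 0
    · have hy0' := (hzero u hu.1).1 hy0
      have h1 : ∀ σ, interpolate y y' (u, σ) = 0 := by simp [interpolate, hy0, hy0']
      simp only [h1, hy0, hy0', zero_div]
      rw [deriv_smoothCutoff_eq_zero_of_lt (by simp)]
      simp
    · rw [← sub_mul, ← integral_deriv_interpolate contDiff_smoothCutoff u ε,
        ← integral_mul_const]
      refine integral_congr_ae (Eventually.of_forall fun σ => ?_)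
      simp only
      rw [hHT u hu.2.1 hy0]
      ring
  · rw [hf.eq_zero hu]
    simp

/-- If at each common zero of `y` and `y'` the derivatives of `y` and of `y'` or `-y'` are joined by
a segment that avoids `0`, and `(y' - y) T` or `(-y' - y) T` is smooth there, then the integrals of
`T`, cut off by means of `y` and by means of `y'`, have the same asymptotics. -/
theorem IsPolePair.tendsto_sub (h : IsPolePair V y T) (h' : IsPolePair V y' T)
    (hzero : ∀ u ∈ V, y u = 0 ↔ y' u = 0)
    (hne : ∀ u ∈ V, y u = 0 → ∃ τ : ℝ, (τ = 1 ∨ τ = -1) ∧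
      (∀ s ∈ Icc (0 : ℝ) 1, (1 - s) • fderiv ℝ y u + s • τ • fderiv ℝ y' u ≠ 0) ∧
      ∃ W, IsOpen W ∧ u ∈ W ∧ ∃ H : E → ℝ, ContDiffOn ℝ ∞ H W ∧
        ∀ v ∈ W, y v ≠ 0 → H v = (τ * y' v - y v) * T v) (hχ : IsTestFunction V χ) :
    Tendsto (fun ε => ∫ u, smoothCutoff (y' u / ε) * (χ u * T u) ∂μ -
      ∫ u, smoothCutoff (y u / ε) * (χ u * T u) ∂μ) (𝓝[>] 0) (𝓝 0) := by
  refine hχ.induction_local (P := fun χ => Tendsto (fun ε =>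
    ∫ u, smoothCutoff (y' u / ε) * (χ u * T u) ∂μ -
      ∫ u, smoothCutoff (y u / ε) * (χ u * T u) ∂μ) (𝓝[>] 0) (𝓝 0)) ?_ ?_ ?_
  · simp
  · intro f g hf hg h1 h2
    have h3 := h1.add h2
    rw [add_zero] at h3
    refine h3.congr' ?_
    filter_upwards [self_mem_nhdsWithin] with ε hε
    have hadd : ∀ {z : E → ℝ}, IsPolePair V z T →
        ∫ u, smoothCutoff (z u / ε) * ((f + g) u * T u) ∂μ =
          ∫ u, smoothCutoff (z u / ε) * (f u * T u) ∂μ +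
            ∫ u, smoothCutoff (z u / ε) * (g u * T u) ∂μ := by
      intro z hz
      rw [← integral_add (hz.integrable_smoothCutoff μ hf hε) (hz.integrable_smoothCutoff μ hg hε)]
      refine integral_congr_ae (Eventually.of_forall fun u => ?_)
      simp only [Pi.add_apply]
      ring
    rw [hadd h, hadd h']
    ring
  · intro u₀ hu₀
    by_cases h0 : y u₀ = 0
    · obtain ⟨τ, hτ, hseg, hT⟩ := hne u₀ hu₀ h0
      have hτ0 : τ ≠ 0 := by rcases hτ with rfl | rfl <;> norm_num
      have hd : ∀ u ∈ V, fderiv ℝ (fun v => τ * y' v) u = τ • fderiv ℝ y' u := fun u hu =>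
        fderiv_const_mul ((h'.contDiffOn.contDiffAt (h.isOpen.mem_nhds hu)).differentiableAt
          (by simp)) τ
      have h'' : IsPolePair V (fun v => τ * y' v) T := by
        refine ⟨h.isOpen, contDiffOn_const.mul h'.contDiffOn, fun u hu hu0 => ?_, ?_⟩
        · rw [hd u hu]
          exact smul_ne_zero hτ0
            (h'.fderiv_ne_zero u hu ((mul_eq_zero.1 hu0).resolve_left hτ0))
        · exact h'.contDiffOn_pole.mono fun u hu => ⟨hu.1, right_ne_zero_of_mul hu.2⟩
      obtain ⟨W, hW, hW'⟩ := h.exists_nhds_tendsto_sub μ h''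
        (fun u hu => (hzero u hu).trans (by simp [hτ0])) hu₀ (by rwa [hd u₀ hu₀]) hT
      refine ⟨W, hW, fun f hf => (hW' f hf).congr fun ε => ?_⟩
      -- the cutoff is even, so the sign does not matter
      have heven : ∀ u, smoothCutoff (τ * y' u / ε) = smoothCutoff (y' u / ε) := by
        intro u
        rcases hτ with rfl | rfl
        · rw [one_mul]
        · rw [neg_one_mul, neg_div, isCutoff_smoothCutoff.even]
      simp only [heven]
    · obtain ⟨W, hW, δ, hδ, hδW⟩ := h.exists_nhds hu₀ h0
      obtain ⟨W', hW', δ', hδ', hδW'⟩ := h'.exists_nhds hu₀ fun h => h0 ((hzero u₀ hu₀).2 h)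
      refine ⟨W ∩ W', inter_mem hW hW', fun f hf => ?_⟩
      refine tendsto_const_nhds.congr' ?_
      filter_upwards [isCutoff_smoothCutoff.eventually_div_eq_one hδ,
        isCutoff_smoothCutoff.eventually_div_eq_one hδ'] with ε hε hε'
      symm
      refine sub_eq_zero.2 (integral_congr_ae (Eventually.of_forall fun u => ?_))
      simp only
      by_cases hu : u ∈ W ∩ W'
      · rw [hε _ (hδW u hu.1), hε' _ (hδW' u hu.2)]
      · rw [hf.eq_zero fun h => hu h.2]
        simp

end Interpolation

/-! ### Integrals of `b^k`-forms near the hypersurface, in a chart -/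

section Local

variable {k m : ℕ} {M : Type*} [TopologicalSpace M]
  [ChartedSpace (EuclideanSpace ℝ (Fin (m + 1))) M] [IsManifold (𝓡 (m + 1)) ∞ M]

/-- The coefficient of `du_1 ∧ ⋯ ∧ du_n` in the expression of a form of top degree. -/
def topCoeff {n : ℕ} {M : Type*} [TopologicalSpace M] [ChartedSpace (EuclideanSpace ℝ (Fin n)) M]
    (θ : Form n M n) (c : M) (u : EuclideanSpace ℝ (Fin n)) : ℝ :=
  localRep θ c u fun i => EuclideanSpace.single i 1

lemma IsDefiningOn.isPolePair {Z U : Set M} {f : C^∞⟮𝓡 (m + 1), M; ℝ⟯} (hf : IsDefiningOn Z f U)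
    {c : M} {T : EuclideanSpace ℝ (Fin (m + 1)) → ℝ}
    (hT : ContDiffOn ℝ ∞ T (chartPart (m + 1) Zᶜ c)) :
    IsPolePair (chartPart (m + 1) U c) (chartFun f c) T where
  isOpen := isOpen_chartPart hf.isOpen c
  contDiffOn := (contDiffOn_chartFun_target f c).mono inter_subset_left
  fderiv_ne_zero _ hu h0 := hf.fderiv_chartFun_ne_zero ⟨hu.1, (hf.zero_iff _ hu.2).1 h0⟩
  contDiffOn_pole := hT.mono fun _ hu =>
    ⟨hu.1.1, fun hZ => hu.2 ((hf.zero_iff _ hu.1.2).2 hZ)⟩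

/-- The square of the ideal of `Z` consists of functions with vanishing derivative along `Z`. -/
lemma fderiv_chartFun_eq_zero {Z : Set M} {g : C^∞⟮𝓡 (m + 1), M; ℝ⟯}
    (hg : g ∈ vanishingIdeal (m + 1) Z ^ 2) {c : M} {u : EuclideanSpace ℝ (Fin (m + 1))}
    (hu : u ∈ chartPart (m + 1) Z c) : fderiv ℝ (chartFun g c) u = 0 := by
  have hd : ∀ f : C^∞⟮𝓡 (m + 1), M; ℝ⟯, DifferentiableAt ℝ (chartFun f c) u := fun f =>
    ((contDiffOn_chartFun_target f c).contDiffAt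
      ((chartAt (EuclideanSpace ℝ (Fin (m + 1))) c).open_target.mem_nhds hu.1)).differentiableAt
      (by simp)
  rw [pow_two] at hg
  induction hg using Submodule.mul_induction_on' with
  | mem_mul_mem f hf g hg =>
    have h1 : chartFun (n := m + 1) (f * g : C^∞⟮𝓡 (m + 1), M; ℝ⟯) c =
        chartFun f c * chartFun g c := rfl
    have hf0 : chartFun f c u = 0 := hf _ hu.2
    have hg0 : chartFun g c u = 0 := hg _ hu.2
    rw [h1, fderiv_mul (hd f) (hd g), hf0, hg0]
    simp
  | add f _ g _ hf hg =>
    have h1 : chartFun (n := m + 1) (f + g : C^∞⟮𝓡 (m + 1), M; ℝ⟯) c =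
        chartFun f c + chartFun g c := rfl
    rw [h1, fderiv_add (hd f) (hd g), hf, hg, add_zero]

/-- For nonzero functionals `ℓ` and `ℓ'`, one of the segments from `ℓ` to `ℓ'` and from `ℓ` to `-ℓ'`
avoids `0`. -/
lemma exists_sign_segment_ne_zero {F : Type*} [AddCommGroup F] [Module ℝ F] {ℓ ℓ' : F}
    (h : ℓ ≠ 0) (h' : ℓ' ≠ 0) : ∃ τ : ℝ, (τ = 1 ∨ τ = -1) ∧
      ∀ s ∈ Icc (0 : ℝ) 1, (1 - s) • ℓ + s • τ • ℓ' ≠ 0 := by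
  by_contra! hcon
  have key : ∀ τ : ℝ, (τ = 1 ∨ τ = -1) → ∃ a : ℝ, 0 ≤ a ∧ τ • ℓ' = -(a • ℓ) := by
    intro τ hτ
    obtain ⟨s, hs, h0⟩ := hcon τ hτ
    have hs0 : s ≠ 0 := by
      rintro rfl
      simp [h] at h0
    refine ⟨s⁻¹ * (1 - s), mul_nonneg (inv_nonneg.2 hs.1) (by linarith [hs.2]), ?_⟩
    rw [mul_smul, ← smul_neg, ← eq_neg_of_add_eq_zero_right h0, smul_smul, inv_mul_cancel₀ hs0,
      one_smul]
  obtain ⟨a, ha, h1⟩ := key 1 (Or.inl rfl)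
  obtain ⟨b, hb, h2⟩ := key (-1) (Or.inr rfl)
  have h3 : (a + b) • ℓ = 0 := by
    rw [one_smul] at h1
    rw [neg_one_smul, h1, neg_neg] at h2
    rw [add_smul, h2]
    simp
  rcases smul_eq_zero.1 h3 with h4 | h4
  · have ha0 : a = 0 := by linarith
    rw [ha0, zero_smul, neg_zero, one_smul] at h1
    exact h' h1
  · exact h h4

/-- The coefficient of `df ∧ η` in the expression in a chart, for `η` of degree one less than the
dimension. -/
def wedgeCoeff (f : M → ℝ) (η : Form (m + 1) M m) (c : M)
    (u : EuclideanSpace ℝ (Fin (m + 1))) : ℝ :=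
  wedgeRep f η c u fun i => EuclideanSpace.single i 1

lemma contDiffOn_wedgeCoeff {U : Set M} (hU : IsOpen U) {η : Form (m + 1) M m}
    (hη : SmoothFormOn U η) (f : C^∞⟮𝓡 (m + 1), M; ℝ⟯) (c : M) :
    ContDiffOn ℝ ∞ (wedgeCoeff f η c) (chartPart (m + 1) U c) := by
  have h1 : ContDiffOn ℝ ∞ (fderiv ℝ (chartFun f c)) (chartPart (m + 1) U c) :=
    ((contDiffOn_chartFun_target f c).mono inter_subset_left).fderiv_of_isOpen
      (isOpen_chartPart hU c) (by simp)
  have h2 := (ContinuousAlternatingMap.alternatizeUncurryFinCLM ℝ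
    (EuclideanSpace ℝ (Fin (m + 1))) ℝ).contDiff.comp_contDiffOn (h1.smulRight (hη c))
  exact (ContinuousAlternatingMap.apply ℝ (EuclideanSpace ℝ (Fin (m + 1))) ℝ
    _).contDiff.comp_contDiffOn h2

variable [T2Space M] {B : BkStructure k m M}

lemma IsBkForm.hasExpansion (hk : 1 ≤ k) {f : C^∞⟮𝓡 (m + 1), M; ℝ⟯} {U : Set M}
    (hf : IsDefiningOn B.Z f U)
    (hj : Ideal.Quotient.mk (vanishingIdeal (m + 1) B.Z ^ k) f = B.jet)
    {θ : Form (m + 1) M (m + 1)} (hθ : IsBkForm B θ) (c : M)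
    {χ : EuclideanSpace ℝ (Fin (m + 1)) → ℝ} (hχ : IsTestFunction (chartPart (m + 1) U c) χ) :
    HasExpansion (k - 1) (fun Φ ε => ∫ u, Φ (chartFun f c u / ε) * (χ u * topCoeff θ c u)) := by
  refine (hf.isPolePair (hθ.smooth.contDiffOn_localRep_apply c _)).hasExpansion volume
    (fun u hu h0 => ?_) hχ
  obtain ⟨W, hW, huW, hWt, H, hH, hHT⟩ := hθ.exists_smooth_mul hk hf hj
    (Ideal.pow_mem_pow hf.mem_vanishingIdeal k) (c := c) ⟨hu.1, (hf.zero_iff _ hu.2).1 h0⟩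
  refine ⟨W, hW, huW, H, hH, fun v hv hv0 => ?_⟩
  rw [hHT v hv fun hZ => hv0 ((hf.zero_iff _ (hf.subset hZ)).2 hZ), Nat.sub_add_cancel hk]
  rfl

/-- Defining functions with the same jet lead to the same asymptotics. -/
lemma IsBkForm.tendsto_sub (hk : 1 ≤ k) {f f' : C^∞⟮𝓡 (m + 1), M; ℝ⟯} {U : Set M}
    (hf : IsDefiningOn B.Z f U) (hf' : IsDefiningOn B.Z f' U)
    (hj : Ideal.Quotient.mk (vanishingIdeal (m + 1) B.Z ^ k) f = B.jet)
    (hj' : Ideal.Quotient.mk (vanishingIdeal (m + 1) B.Z ^ k) f' = B.jet)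
    {θ : Form (m + 1) M (m + 1)} (hθ : IsBkForm B θ) (c : M)
    {χ : EuclideanSpace ℝ (Fin (m + 1)) → ℝ} (hχ : IsTestFunction (chartPart (m + 1) U c) χ) :
    Tendsto (fun ε => (∫ u, smoothCutoff (chartFun f' c u / ε) * (χ u * topCoeff θ c u)) -
      ∫ u, smoothCutoff (chartFun f c u / ε) * (χ u * topCoeff θ c u)) (𝓝[>] 0) (𝓝 0) := by
  have hT : ContDiffOn ℝ ∞ (topCoeff θ c) (chartPart (m + 1) B.Zᶜ c) :=
    hθ.smooth.contDiffOn_localRep_apply c _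
  refine (hf.isPolePair hT).tendsto_sub volume (hf'.isPolePair hT)
    (fun u hu => (hf.zero_iff _ hu.2).trans (hf'.zero_iff _ hu.2).symm) (fun u hu h0 => ?_) hχ
  have huZ : u ∈ chartPart (m + 1) B.Z c := ⟨hu.1, (hf.zero_iff _ hu.2).1 h0⟩
  have hmem : f' - f ∈ vanishingIdeal (m + 1) B.Z ^ k := Ideal.Quotient.eq.1 (hj'.trans hj.symm)
  have hd : ∀ g : C^∞⟮𝓡 (m + 1), M; ℝ⟯, DifferentiableAt ℝ (chartFun g c) u := fun g =>
    ((contDiffOn_chartFun_target g c).contDiffAt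
      ((chartAt (EuclideanSpace ℝ (Fin (m + 1))) c).open_target.mem_nhds hu.1)).differentiableAt
      (by simp)
  obtain ⟨τ, hτ, hseg, hτmem⟩ : ∃ τ : ℝ, (τ = 1 ∨ τ = -1) ∧
      (∀ s ∈ Icc (0 : ℝ) 1,
        (1 - s) • fderiv ℝ (chartFun f c) u + s • τ • fderiv ℝ (chartFun f' c) u ≠ 0) ∧
      τ • f' - f ∈ vanishingIdeal (m + 1) B.Z ^ k := by
    rcases hk.eq_or_lt with rfl | hk2
    · -- for `k = 1` the jet does not determine the sign of a defining function
      obtain ⟨τ, hτ, hseg⟩ := exists_sign_segment_ne_zero (hf.fderiv_chartFun_ne_zero huZ)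
        (hf'.fderiv_chartFun_ne_zero huZ)
      refine ⟨τ, hτ, hseg, ?_⟩
      rw [pow_one]
      refine sub_mem ?_ hf.mem_vanishingIdeal
      intro x hx
      have : f' x = 0 := hf'.mem_vanishingIdeal x hx
      simp [this]
    · refine ⟨1, Or.inl rfl, fun s _ => ?_, by rwa [one_smul]⟩
      have h1 := fderiv_chartFun_eq_zero (Ideal.pow_le_pow_right hk2 hmem) huZ
      have h2 : chartFun (n := m + 1) (f' - f : C^∞⟮𝓡 (m + 1), M; ℝ⟯) c =
          chartFun f' c - chartFun f c := rfl
      rw [h2, fderiv_sub (hd f') (hd f), sub_eq_zero] at h1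
      rw [h1, one_smul, ← add_smul, sub_add_cancel, one_smul]
      exact hf.fderiv_chartFun_ne_zero huZ
  obtain ⟨W, hW, huW, hWt, H, hH, hHT⟩ := hθ.exists_smooth_mul hk hf hj hτmem huZ
  refine ⟨τ, hτ, hseg, W, hW, huW, H, hH, fun v hv hv0 => ?_⟩
  rw [hHT v hv fun hZ => hv0 ((hf.zero_iff _ (hf.subset hZ)).2 hZ)]
  rfl

/-- The term with the derivative of the cutoff in Stokes' theorem disappears in the limit. -/
lemma IsBkForm.tendsto_integral_wedgeCoeff (hk : 1 ≤ k) {f : C^∞⟮𝓡 (m + 1), M; ℝ⟯} {U : Set M}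
    (hf : IsDefiningOn B.Z f U)
    (hj : Ideal.Quotient.mk (vanishingIdeal (m + 1) B.Z ^ k) f = B.jet)
    {η : Form (m + 1) M m} (hη : IsBkForm B η) (c : M)
    {χ : EuclideanSpace ℝ (Fin (m + 1)) → ℝ} (hχ : IsTestFunction (chartPart (m + 1) U c) χ) :
    Tendsto (fun ε => ∫ u, ε⁻¹ * deriv smoothCutoff (chartFun f c u / ε) *
      (χ u * wedgeCoeff f η c u)) (𝓝[>] 0) (𝓝 0) := by
  refine (hf.isPolePair (contDiffOn_wedgeCoeff B.isClosed_Z.isOpen_compl hη.smooth f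
    c)).tendsto_integral_deriv volume (fun u hu h0 => ?_) hχ
  obtain ⟨W, hW, huW, hWt, H, hH, hHT⟩ := hη.exists_smooth_wedge hk hf hj (c := c)
    (u₀ := u) ⟨hu.1, (hf.zero_iff _ hu.2).1 h0⟩
  exact ⟨W, hW, huW, H, hH, fun v hv hv0 =>
    hHT v hv fun hZ => hv0 ((hf.zero_iff _ (hf.subset hZ)).2 hZ)⟩

end Local

/-! ### Smoothed volumes -/

section Global

variable {k m : ℕ} {M : Type*} [TopologicalSpace M]
  [ChartedSpace (EuclideanSpace ℝ (Fin (m + 1))) M]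

/-- `q` has compact support in `U` and equals `1` near `Z`. -/
structure IsBump (Z U : Set M) (q : C^∞⟮𝓡 (m + 1), M; ℝ⟯) : Prop where
  hasCompactSupport : HasCompactSupport q
  tsupport_subset : tsupport q ⊆ U
  eventually_eq_one : ∀ᶠ x in 𝓝ˢ Z, q x = 1

lemma IsBump.eventually_one_sub_eq_zero {Z U : Set M} {q : C^∞⟮𝓡 (m + 1), M; ℝ⟯}
    (hq : IsBump Z U q) : ∀ᶠ x in 𝓝ˢ Z, (1 - ⇑q) x = 0 :=
  hq.eventually_eq_one.mono fun x hx => by simp [hx]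

lemma isOpen_tube {Z : Set M} (y : LocalDefiningFunction (m + 1) Z) (ε : ℝ) : IsOpen (y.tube ε) :=
  y.smooth.continuousOn.isOpen_inter_preimage y.isOpen_dom
    (isOpen_lt continuous_abs continuous_const)

lemma subset_tube {Z : Set M} (y : LocalDefiningFunction (m + 1) Z) {ε : ℝ} (hε : 0 < ε) :
    Z ⊆ y.tube ε := fun x hx =>
  ⟨y.subset_dom hx, by rwa [(y.zero_iff x (y.subset_dom hx)).2 hx, abs_zero]⟩

lemma eventually_notMem_tube {Z : Set M} (y : LocalDefiningFunction (m + 1) Z)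
    {x : M} (hx : x ∉ Z) :
    ∀ᶠ ε in 𝓝[>] (0 : ℝ), x ∉ y.tube ε := by
  by_cases hxd : x ∈ y.dom
  · have h0 : 0 < |y.toFun x| := abs_pos.2 fun h => hx ((y.zero_iff x hxd).1 h)
    filter_upwards [mem_nhdsWithin_of_mem_nhds (Iio_mem_nhds h0)] with ε hε h
    exact lt_asymm h.2 hε
  · exact Eventually.of_forall fun ε h => hxd h.1

lemma wedgeCoeff_eq_mul {f g : M → ℝ} {c : M} {u : EuclideanSpace ℝ (Fin (m + 1))} {a : ℝ}
    (h : fderiv ℝ (chartFun g c) u = a • fderiv ℝ (chartFun f c) u) (η : Form (m + 1) M m) :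
    wedgeCoeff g η c u = a * wedgeCoeff f η c u := by
  have h1 : wedgeRep g η c u = a • wedgeRep f η c u := by
    rw [wedgeRep, wedgeRep, h, ← ContinuousAlternatingMap.alternatizeUncurryFin_smul]
    congr 1
    ext v w
    simp [mul_assoc]
  rw [wedgeCoeff, h1]
  rfl

variable [IsManifold (𝓡 (m + 1)) ∞ M]

/-- A form with singularities on `Z` becomes smooth when multiplied by a function that vanishes
near `Z`. -/
lemma SmoothFormOn.fmul_of_eventually_eq_zero {Z : Set M} (hZ : IsClosed Z) {p : ℕ}
    {θ : Form (m + 1) M p} (hθ : SmoothFormOn Zᶜ θ) {g : M → ℝ}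
    (hg : ContMDiff (𝓡 (m + 1)) 𝓘(ℝ, ℝ) ∞ g) (h0 : ∀ᶠ x in 𝓝ˢ Z, g x = 0) :
    SmoothFormOn univ (θ.fmul g) := by
  intro c u hu
  refine ContDiffAt.contDiffWithinAt ?_
  by_cases huZ : (chartAt (EuclideanSpace ℝ (Fin (m + 1))) c).symm u ∈ Z
  · have h1 : ∀ᶠ v in 𝓝 u, g ((chartAt (EuclideanSpace ℝ (Fin (m + 1))) c).symm v) = 0 :=
      ((chartAt (EuclideanSpace ℝ (Fin (m + 1))) c).symm.continuousAt hu.1).eventually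
        (eventually_nhdsSet_iff_forall.1 h0 _ huZ)
    refine (contDiffAt_const (c := 0)).congr_of_eventuallyEq ?_
    filter_upwards [h1] with v hv
    rw [localRep_fmul, chartFun, hv, zero_smul]
  · exact (hθ.fmul (g := g) hg.contMDiffOn c).contDiffAt
      ((isOpen_chartPart hZ.isOpen_compl c).mem_nhds ⟨hu.1, huZ⟩)

/-- The Leibniz rule `d(gη) = dg ∧ η + g dη` in a chart. -/
lemma topCoeff_extDerivForm_fmul {U : Set M} (hU : IsOpen U) {η : Form (m + 1) M m}
    (hη : SmoothFormOn U η) {g : M → ℝ} (hg : ContMDiff (𝓡 (m + 1)) 𝓘(ℝ, ℝ) ∞ g) {c : M}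
    {u : EuclideanSpace ℝ (Fin (m + 1))} (hu : u ∈ chartPart (m + 1) U c) :
    topCoeff (extDerivForm (η.fmul g)) c u =
      wedgeCoeff g η c u + chartFun g c u * topCoeff (extDerivForm η) c u := by
  have hopen := (isOpen_chartPart hU c).mem_nhds hu
  have h1 : DifferentiableAt ℝ (chartFun g c) u :=
    ((contDiffOn_chartFun (hg.contMDiffOn (s := U)) c).contDiffAt hopen).differentiableAt (by simp)
  have h2 : DifferentiableAt ℝ (localRep η c) u :=
    ((hη c).contDiffAt hopen).differentiableAt (by simp)
  have h3 : localRep (η.fmul g) c = fun v => chartFun g c v • localRep η c v := rfl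
  rw [topCoeff, topCoeff, localRep_extDerivForm hU (hη.fmul hg.contMDiffOn) hu,
    localRep_extDerivForm hU hη hu, h3, extDeriv, fderiv_fun_smul h1 h2,
    ContinuousAlternatingMap.alternatizeUncurryFin_add,
    ContinuousAlternatingMap.alternatizeUncurryFin_smul]
  exact add_comm _ _

variable [T2Space M] [SigmaCompactSpace M]

lemma exists_isBump {Z U : Set M} (hZ : IsCompact Z) (hU : IsOpen U) (hZU : Z ⊆ U) :
    ∃ q : C^∞⟮𝓡 (m + 1), M; ℝ⟯, IsBump Z U q := by
  have := ChartedSpace.locallyCompactSpace (EuclideanSpace ℝ (Fin (m + 1))) M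
  obtain ⟨L, hL, hZL, hLU⟩ := exists_compact_between hZ hU hZU
  obtain ⟨q, hq1, hq0, -⟩ := exists_contMDiffMap_one_nhds_of_subset_interior (𝓡 (m + 1)) (n := ⊤)
    hZ.isClosed hZL
  have hs : tsupport q ⊆ L :=
    closure_minimal (fun x hx => by_contra fun h => hx (hq0 x h)) hL.isClosed
  exact ⟨q, hL.of_isClosed_subset (isClosed_tsupport _) hs, hs.trans hLU, hq1⟩

/-- The member of the partition of unity that belongs to the chart at `c`, multiplied by `q` and by
the sign of the chart, in coordinates. -/
def chartWeight (o : OrientationField (m + 1) M) (q : M → ℝ) (c : M) :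
    EuclideanSpace ℝ (Fin (m + 1)) → ℝ :=
  indicator (chartAt (EuclideanSpace ℝ (Fin (m + 1))) c).target fun u =>
    chartFun (chartPartition (m + 1) M c) c u *
      (((chartSign o c u : SignType) : ℝ) * chartFun q c u)

lemma chartWeight_eq_zero (o : OrientationField (m + 1) M) {q : M → ℝ} {c : M}
    {u : EuclideanSpace ℝ (Fin (m + 1))} (h : chartFun q c u = 0) : chartWeight o q c u = 0 := by
  by_cases hu : u ∈ (chartAt (EuclideanSpace ℝ (Fin (m + 1))) c).target
  · rw [chartWeight, indicator_of_mem hu, h, mul_zero, mul_zero]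
  · exact indicator_of_notMem hu _

lemma isTestFunction_chartWeight {o : OrientationField (m + 1) M} (ho : IsManifoldOrientation o)
    {Z U : Set M} {q : C^∞⟮𝓡 (m + 1), M; ℝ⟯} (hq : IsBump Z U q) (c : M) :
    IsTestFunction (chartPart (m + 1) U c) (chartWeight o q c) := by
  set φ := chartAt (EuclideanSpace ℝ (Fin (m + 1))) c
  set ρ := chartPartition (m + 1) M c
  set L := tsupport ρ ∩ tsupport q
  have hL : IsCompact L := hq.hasCompactSupport.isCompact.inter_left (isClosed_tsupport _)
  have hLs : L ⊆ φ.source := inter_subset_left.trans (isSubordinate_chartPartition c)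
  have hK : IsCompact (φ '' L) := hL.image_of_continuousOn (φ.continuousOn.mono hLs)
  have hKU : φ '' L ⊆ chartPart (m + 1) U c := by
    rintro _ ⟨x, hx, rfl⟩
    refine ⟨φ.map_source (hLs hx), ?_⟩
    rw [mem_preimage, φ.left_inv (hLs hx)]
    exact hq.tsupport_subset hx.2
  have h0 : ∀ u ∉ φ '' L, chartWeight o q c u = 0 := by
    intro u hu
    by_cases hut : u ∈ φ.target
    · by_cases h1 : φ.symm u ∈ tsupport q
      · have h2 : chartFun ρ c u = 0 := image_eq_zero_of_notMem_tsupport (f := ρ) fun h =>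
          hu ⟨φ.symm u, ⟨h, h1⟩, φ.right_inv hut⟩
        rw [chartWeight, indicator_of_mem hut, h2, zero_mul]
      · exact chartWeight_eq_zero o (image_eq_zero_of_notMem_tsupport (f := q) h1)
    · exact indicator_of_notMem hut _
  refine ⟨?_, HasCompactSupport.intro hK h0, ?_⟩
  · refine contDiff_of_contDiffOn_of_eq_zero φ.open_target hK.isClosed
      (hKU.trans inter_subset_left) ?_ h0
    exact ((contDiffOn_chartFun_target ρ c).mul ((contDiffOn_chartSign ho c).mul
      (contDiffOn_chartFun_target q c))).congr fun u hu => indicator_of_mem hu _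
  · refine (closure_minimal (fun u hu => ?_) hK.isClosed).trans hKU
    by_contra h
    exact hu (h0 u h)

/-- The integral of `Φ(f / ε) q θ`, computed in the charts that meet the compact set `K`. -/
def cutoffIntegral (o : OrientationField (m + 1) M) {K : Set M} (hK : IsCompact K) (f q : M → ℝ)
    (θ : Form (m + 1) M (m + 1)) (Φ : ℝ → ℝ) (ε : ℝ) : ℝ :=
  ∑ c ∈ chartFinset (m + 1) hK,
    ∫ u, Φ (chartFun f c u / ε) * (chartWeight o q c u * topCoeff θ c u)

lemma formIntegral_eq_cutoffIntegral (o : OrientationField (m + 1) M) {K : Set M}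
    (hK : IsCompact K) {θ : Form (m + 1) M (m + 1)} (hs : formSupport θ ⊆ K) {A : Set M}
    (hA : IsClosed A) {f q g : M → ℝ} {Φ : ℝ → ℝ} {ε : ℝ} (h1 : ∀ x ∈ A, g x = q x * Φ (f x / ε))
    (h2 : ∀ x ∉ A, q x * Φ (f x / ε) = 0) :
    formIntegral o A (θ.fmul g) = cutoffIntegral o hK f q θ Φ ε := by
  rw [formIntegral_eq_sum o hK (((formSupport_fmul_subset g θ).trans inter_subset_right).trans hs)]
  refine Finset.sum_congr rfl fun c _ => ?_
  rw [← setIntegral_eq_integral_of_forall_compl_eq_zero (s := chartPart (m + 1) A c)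
    (f := fun u => Φ (chartFun f c u / ε) * (chartWeight o q c u * topCoeff θ c u))]
  · refine setIntegral_congr_fun (measurableSet_chartPart hA c) fun u hu => ?_
    have h3 : chartFun g c u = chartFun q c u * Φ (chartFun f c u / ε) := h1 _ hu.2
    rw [chartIntegrand_eq, chartDensity_fmul, h3, chartWeight, indicator_of_mem hu.1, chartDensity,
      topCoeff]
    ring
  · intro u hu
    by_cases hut : u ∈ (chartAt (EuclideanSpace ℝ (Fin (m + 1))) c).target
    · rcases mul_eq_zero.1 (h2 _ fun h => hu ⟨hut, h⟩) with h | h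
      · rw [chartWeight_eq_zero o h, zero_mul, mul_zero]
      · rw [chartFun, h, zero_mul]
    · rw [chartWeight, indicator_of_notMem hut, zero_mul, mul_zero]

variable {B : BkStructure k m M}

lemma hasExpansion_cutoffIntegral (hk : 1 ≤ k) {f q : C^∞⟮𝓡 (m + 1), M; ℝ⟯} {U : Set M}
    (hf : IsDefiningOn B.Z f U)
    (hj : Ideal.Quotient.mk (vanishingIdeal (m + 1) B.Z ^ k) f = B.jet) (hq : IsBump B.Z U q)
    {θ : Form (m + 1) M (m + 1)} (hθ : IsBkForm B θ) {K : Set M} (hK : IsCompact K) :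
    HasExpansion (k - 1) (cutoffIntegral B.orientation hK f q θ) :=
  HasExpansion.sum _ fun c _ =>
    hθ.hasExpansion hk hf hj c (isTestFunction_chartWeight B.isOrientation hq c)

lemma tendsto_cutoffIntegral_sub (hk : 1 ≤ k) {f f' q : C^∞⟮𝓡 (m + 1), M; ℝ⟯} {U : Set M}
    (hf : IsDefiningOn B.Z f U) (hf' : IsDefiningOn B.Z f' U)
    (hj : Ideal.Quotient.mk (vanishingIdeal (m + 1) B.Z ^ k) f = B.jet)
    (hj' : Ideal.Quotient.mk (vanishingIdeal (m + 1) B.Z ^ k) f' = B.jet) (hq : IsBump B.Z U q)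
    {θ : Form (m + 1) M (m + 1)} (hθ : IsBkForm B θ) {K : Set M} (hK : IsCompact K) :
    Tendsto (fun ε => cutoffIntegral B.orientation hK f' q θ smoothCutoff ε -
      cutoffIntegral B.orientation hK f q θ smoothCutoff ε) (𝓝[>] 0) (𝓝 0) := by
  have h1 := tendsto_finsetSum (chartFinset (m + 1) hK) fun c _ =>
    hθ.tendsto_sub hk hf hf' hj hj' c (isTestFunction_chartWeight B.isOrientation hq c)
  simp only [Finset.sum_const_zero, Finset.sum_sub_distrib] at h1
  exact h1

/-- The complements of the tubes exhaust the complement of `Z`. -/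
lemma tendsto_formIntegral_tube (y : LocalDefiningFunction (m + 1) B.Z)
    {ξ : Form (m + 1) M (m + 1)} (hξ : SmoothFormOn univ ξ) (hc : IsCompact (formSupport ξ))
    (h0 : ∀ x ∈ B.Z, ξ x = 0) :
    Tendsto (fun ε => formIntegral B.orientation (y.tube ε)ᶜ ξ) (𝓝[>] 0)
      (𝓝 (formIntegral B.orientation univ ξ)) := by
  simp_rw [formIntegral_eq_sum B.orientation hc subset_rfl]
  refine tendsto_finsetSum _ fun c _ => ?_
  have hmeas : ∀ ε, MeasurableSet (chartPart (m + 1) (y.tube ε)ᶜ c) := fun ε =>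
    measurableSet_chartPart (isOpen_tube y ε).isClosed_compl c
  have hmeas' := measurableSet_chartPart (n := m + 1) (M := M) isClosed_univ c
  have hint : Integrable (indicator (chartPart (m + 1) univ c)
      (chartIntegrand B.orientation ξ c)) :=
    (integrable_indicator_iff hmeas').2
      ((formIntegrableOn_of_smooth B.isOrientation hξ hc isClosed_univ subset_rfl).1 c)
  simp_rw [← integral_indicator (hmeas _)]
  rw [← integral_indicator hmeas']
  have hsub : ∀ ε, chartPart (m + 1) (y.tube ε)ᶜ c ⊆ chartPart (m + 1) univ c := fun ε =>
    inter_subset_inter_right _ (preimage_mono (subset_univ _))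
  have heq : ∀ ε, indicator (chartPart (m + 1) (y.tube ε)ᶜ c) (chartIntegrand B.orientation ξ c) =
      indicator (chartPart (m + 1) (y.tube ε)ᶜ c) (indicator (chartPart (m + 1) univ c)
        (chartIntegrand B.orientation ξ c)) := fun ε => by
    rw [indicator_indicator, inter_eq_self_of_subset_left (hsub ε)]
  simp_rw [heq]
  refine tendsto_integral_filter_of_dominated_convergence _
    (Eventually.of_forall fun ε => hint.aestronglyMeasurable.indicator (hmeas ε))
    (Eventually.of_forall fun ε => Eventually.of_forall fun u => norm_indicator_le_norm_self _ _)
    hint.norm (Eventually.of_forall fun u => ?_)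
  refine tendsto_const_nhds.congr' ?_
  by_cases hu : u ∈ (chartAt (EuclideanSpace ℝ (Fin (m + 1))) c).target
  · by_cases huZ : (chartAt (EuclideanSpace ℝ (Fin (m + 1))) c).symm u ∈ B.Z
    · refine Eventually.of_forall fun ε => ?_
      have h1 : indicator (chartPart (m + 1) univ c) (chartIntegrand B.orientation ξ c) u = 0 := by
        refine indicator_apply_eq_zero.2 fun _ => ?_
        rw [chartIntegrand, h0 _ huZ]
        simp
      simp only
      rw [h1, indicator_apply_eq_zero.2 fun _ => h1]
    · filter_upwards [eventually_notMem_tube y huZ] with ε hε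
      have hmem : u ∈ chartPart (m + 1) (y.tube ε)ᶜ c := ⟨hu, hε⟩
      rw [indicator_of_mem hmem]
  · refine Eventually.of_forall fun ε => ?_
    have h1 : u ∉ chartPart (m + 1) univ c := fun h => hu h.1
    simp only
    rw [indicator_of_notMem h1, indicator_of_notMem fun h => h1 (hsub ε h)]

/-- The volume, up to terms that tend to `0`, in terms of the sharp cutoff. -/
lemma tendsto_vol_sub_cutoffIntegral {y : LocalDefiningFunction (m + 1) B.Z}
    {f q : C^∞⟮𝓡 (m + 1), M; ℝ⟯} {U : Set M}
    (hUy : U ⊆ y.dom) (hfy : ∀ x ∈ U, f x = y.toFun x) (hq : IsBump B.Z U q)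
    {θ : Form (m + 1) M (m + 1)} (hθ : IsBkForm B θ) (hK : IsCompact (formSupport θ)) :
    Tendsto (fun ε => vol B y ε θ - (formIntegral B.orientation univ (θ.fmul (1 - ⇑q)) +
      cutoffIntegral B.orientation hK f q θ sharpCutoff ε)) (𝓝[>] 0) (𝓝 0) := by
  have hsupp : ∀ g : M → ℝ, IsCompact (formSupport (θ.fmul g)) := fun g =>
    hK.of_isClosed_subset isClosed_closure ((formSupport_fmul_subset g θ).trans inter_subset_right)
  have h1 := tendsto_formIntegral_tube y (hθ.smooth.fmul_of_eventually_eq_zero B.isClosed_Z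
    (g := 1 - ⇑q) (1 - q).contMDiff hq.eventually_one_sub_eq_zero) (hsupp _)
    fun x hx => by rw [Form.fmul, hθ.eq_zero x hx, smul_zero]
  have h2 := h1.sub_const (formIntegral B.orientation univ (θ.fmul (1 - ⇑q)))
  rw [sub_self] at h2
  refine h2.congr' ?_
  filter_upwards [self_mem_nhdsWithin] with ε hε
  have hε : 0 < ε := hε
  have hclosed := (isOpen_tube y ε).isClosed_compl
  have hint : ∀ g : C^∞⟮𝓡 (m + 1), M; ℝ⟯,
      FormIntegrableOn B.orientation (y.tube ε)ᶜ (θ.fmul g) := fun g =>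
    formIntegrableOn_of_smooth B.isOrientation (hθ.smooth.fmul g.contMDiff.contMDiffOn) (hsupp _)
      hclosed (compl_subset_compl.2 (subset_tube y hε))
  have hsplit : θ = θ.fmul (1 - ⇑q) + θ.fmul q := by
    funext x
    rw [Form.add_apply, Form.fmul, Form.fmul, ← add_smul]
    simp
  have h3 : formIntegral B.orientation (y.tube ε)ᶜ (θ.fmul q) =
      cutoffIntegral B.orientation hK f q θ sharpCutoff ε := by
    refine formIntegral_eq_cutoffIntegral _ hK subset_rfl hclosed (fun x hx => ?_) fun x hx => ?_
    · by_cases hxq : x ∈ tsupport q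
      · have hxU := hq.tsupport_subset hxq
        have h4 : 1 ≤ |f x / ε| := by
          rw [hfy x hxU, abs_div, abs_of_pos hε, le_div_iff₀ hε, one_mul]
          exact not_lt.1 fun h => hx ⟨hUy hxU, h⟩
        have h5 : sharpCutoff (f x / ε) = 1 := by simp [sharpCutoff, h4]
        rw [h5, mul_one]
      · rw [image_eq_zero_of_notMem_tsupport hxq, zero_mul]
    · by_cases hxq : x ∈ tsupport q
      · have hxt := not_not.1 hx
        rw [isCutoff_sharpCutoff.eq_zero, mul_zero]
        rw [hfy x (hq.tsupport_subset hxq), abs_div, abs_of_pos hε, div_lt_one hε]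
        exact hxt.2
      · rw [image_eq_zero_of_notMem_tsupport hxq, zero_mul]
  have h6 : vol B y ε θ = formIntegral B.orientation (y.tube ε)ᶜ (θ.fmul (1 - ⇑q)) +
      cutoffIntegral B.orientation hK f q θ sharpCutoff ε := by
    rw [vol, ← h3]
    nth_rewrite 1 [hsplit]
    exact formIntegral_add _ (hint (1 - q)) (hint q)
  rw [h6]
  ring

end Global

/-! ### Exact forms -/

section Exact

variable {k m : ℕ} {M : Type*} [TopologicalSpace M]
  [ChartedSpace (EuclideanSpace ℝ (Fin (m + 1))) M]

/-- The smooth cutoff of `q` along `f = 0`. -/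
def cutoffFun (f q : M → ℝ) (ε : ℝ) (x : M) : ℝ := q x * smoothCutoff (f x / ε)

lemma contMDiff_cutoffFun (f q : C^∞⟮𝓡 (m + 1), M; ℝ⟯) (ε : ℝ) :
    ContMDiff (𝓡 (m + 1)) 𝓘(ℝ, ℝ) ∞ (cutoffFun f q ε) :=
  q.contMDiff.mul (contDiff_smoothCutoff.contMDiff.comp (f.contMDiff.div_const ε))

lemma eventually_cutoffFun_eq_zero {Z U : Set M} {f : C^∞⟮𝓡 (m + 1), M; ℝ⟯}
    (hf : IsDefiningOn Z f U) (q : M → ℝ) {ε : ℝ} (hε : 0 < ε) :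
    ∀ᶠ x in 𝓝ˢ Z, cutoffFun f q ε x = 0 := by
  have hopen : IsOpen {x | |f x| < ε} := isOpen_lt f.contMDiff.continuous.abs continuous_const
  have hsub : Z ⊆ {x | |f x| < ε} := fun x hx => by
    have h0 : f x = 0 := hf.mem_vanishingIdeal x hx
    simpa [h0] using hε
  filter_upwards [hopen.mem_nhdsSet.2 hsub] with x hx
  have hx : |f x| < ε := hx
  rw [cutoffFun, isCutoff_smoothCutoff.eq_zero, mul_zero]
  rwa [abs_div, abs_of_pos hε, div_lt_one hε]

variable [IsManifold (𝓡 (m + 1)) ∞ M]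

/-- For small `ε`, the derivative of the weight `1 - q + q Φ(f / ε)` only sees the derivative of
the cutoff `Φ`, since `f` is bounded away from zero where `q` is not locally constant. -/
lemma eventually_fderiv_cutoffFun {Z U : Set M} {f q : C^∞⟮𝓡 (m + 1), M; ℝ⟯}
    (hf : IsDefiningOn Z f U) (hq : IsBump Z U q) :
    ∀ᶠ ε in 𝓝[>] (0 : ℝ), ∀ c : M, ∀ u ∈ (chartAt (EuclideanSpace ℝ (Fin (m + 1))) c).target,
      fderiv ℝ (chartFun (1 - ⇑q + cutoffFun f q ε) c) u =
        (chartFun q c u * (ε⁻¹ * deriv smoothCutoff (chartFun f c u / ε))) •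
          fderiv ℝ (chartFun f c) u := by
  set L := tsupport q \ interior {x | q x = 1}
  have hL : IsCompact L := hq.hasCompactSupport.isCompact.diff isOpen_interior
  obtain ⟨δ, hδ, hLδ⟩ : ∃ δ, 0 < δ ∧ ∀ x ∈ L, δ ≤ |f x| := by
    refine hL.exists_forall_le' f.contMDiff.continuous.abs.continuousOn fun x hx => ?_
    refine abs_pos.2 fun h => hx.2 ?_
    have hxZ := (hf.zero_iff x (hq.tsupport_subset hx.1)).1 h
    exact subset_interior_iff_mem_nhdsSet.2 hq.eventually_eq_one hxZ
  filter_upwards [isCutoff_smoothCutoff.eventually_div_eq_one hδ] with ε hε c u hu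
  set φ := chartAt (EuclideanSpace ℝ (Fin (m + 1))) c
  have hd : ∀ g : C^∞⟮𝓡 (m + 1), M; ℝ⟯,
      HasFDerivAt (chartFun g c) (fderiv ℝ (chartFun g c) u) u := fun g =>
    (((contDiffOn_chartFun_target g c).contDiffAt (φ.open_target.mem_nhds hu)).differentiableAt
      (by simp)).hasFDerivAt
  have h1 : HasFDerivAt (fun v => smoothCutoff (chartFun f c v / ε))
      (deriv smoothCutoff (chartFun f c u / ε) • ε⁻¹ • fderiv ℝ (chartFun f c) u) u := by
    have h2 := (contDiff_smoothCutoff.differentiable (by simp)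
      (chartFun f c u / ε)).hasDerivAt
    have h3 : HasFDerivAt (fun v => chartFun f c v / ε) (ε⁻¹ • fderiv ℝ (chartFun f c) u) u := by
      simp_rw [div_eq_inv_mul]
      exact (hd f).const_mul ε⁻¹
    exact HasDerivAt.comp_hasFDerivAt (h₂ := smoothCutoff) u h2 h3
  have h4 : HasFDerivAt (chartFun (1 - ⇑q + cutoffFun f q ε) c) _ u :=
    ((hd q).const_sub 1).add ((hd q).mul h1)
  rw [h4.fderiv]
  -- where `q` is not locally constant, the cutoff equals `1`
  have h5 : (smoothCutoff (f (φ.symm u) / ε) - 1) • fderiv ℝ (chartFun q c) u = 0 := by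
    by_cases h6 : φ.symm u ∈ L
    · rw [hε _ (hLδ _ h6), sub_self, zero_smul]
    · have h7 : ∃ a : ℝ, ∀ᶠ x in 𝓝 (φ.symm u), q x = a := by
        by_cases h8 : φ.symm u ∈ tsupport q
        · have h9 : φ.symm u ∈ interior {x | q x = 1} := by
            by_contra h
            exact h6 ⟨h8, h⟩
          exact ⟨1, mem_interior_iff_mem_nhds.1 h9⟩
        · exact ⟨0, (isClosed_tsupport q).isOpen_compl.eventually_mem h8 |>.mono fun x hx =>
            image_eq_zero_of_notMem_tsupport hx⟩
      obtain ⟨a, ha⟩ := h7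
      have h10 : chartFun q c =ᶠ[𝓝 u] fun _ => a := (φ.symm.continuousAt hu).eventually ha
      rw [h10.fderiv_eq]
      simp
  rw [sub_smul, one_smul, sub_eq_zero] at h5
  rw [h5]
  module

variable [T2Space M] [SigmaCompactSpace M] {B : BkStructure k m M}

/-- The smoothed volumes of an exact form tend to zero. By Stokes' theorem they are integrals of
`dg ∧ η` with `g` a cutoff, which concentrate along `Z`. -/
lemma tendsto_cutoffIntegral_of_exact (hk : 1 ≤ k) {f q : C^∞⟮𝓡 (m + 1), M; ℝ⟯} {U : Set M}
    (hf : IsDefiningOn B.Z f U)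
    (hj : Ideal.Quotient.mk (vanishingIdeal (m + 1) B.Z ^ k) f = B.jet) (hq : IsBump B.Z U q)
    {θ : Form (m + 1) M (m + 1)} (hθ : IsBkForm B θ) {η : Form (m + 1) M m} (hη : IsBkForm B η)
    (hηc : IsCompact (formSupport η)) (hd : ∀ x ∉ B.Z, θ x = extDerivForm η x)
    (hK : IsCompact (formSupport θ)) :
    Tendsto (fun ε => formIntegral B.orientation univ (θ.fmul (1 - ⇑q)) +
      cutoffIntegral B.orientation hK f q θ smoothCutoff ε) (𝓝[>] 0) (𝓝 0) := by
  set o := B.orientation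
  have ho := B.isOrientation
  have hZo := B.isClosed_Z.isOpen_compl
  have hsupp : ∀ {p : ℕ} {ξ : Form (m + 1) M p} (g : M → ℝ), IsCompact (formSupport ξ) →
      IsCompact (formSupport (ξ.fmul g)) := fun g h =>
    h.of_isClosed_subset isClosed_closure ((formSupport_fmul_subset g _).trans inter_subset_right)
  have hθη : formSupport θ ⊆ formSupport η := by
    refine (closure_mono fun x hx => ?_).trans (formSupport_extDerivForm_subset η)
    by_cases hxZ : x ∈ B.Z
    · exact absurd (hθ.eq_zero x hxZ) hx
    · rwa [mem_ofPred_eq, ← hd x hxZ]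
  have hlim := tendsto_finsetSum (chartFinset (m + 1) hηc) fun c _ =>
    hη.tendsto_integral_wedgeCoeff hk hf hj c (isTestFunction_chartWeight ho hq c)
  rw [Finset.sum_const_zero] at hlim
  have hlim := hlim.neg
  rw [neg_zero] at hlim
  refine hlim.congr' ?_
  filter_upwards [self_mem_nhdsWithin, eventually_fderiv_cutoffFun hf hq] with ε hε hder
  have hε : 0 < ε := hε
  set g : M → ℝ := 1 - ⇑q + cutoffFun f q ε
  have hcut := contMDiff_cutoffFun f q ε
  have hcut0 := eventually_cutoffFun_eq_zero hf q hε
  have hg : ContMDiff (𝓡 (m + 1)) 𝓘(ℝ, ℝ) ∞ g := (1 - q).contMDiff.add hcut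
  have hg0 : ∀ᶠ x in 𝓝ˢ B.Z, g x = 0 := by
    filter_upwards [hq.eventually_one_sub_eq_zero, hcut0] with x h1 h2
    change (1 - ⇑q) x + cutoffFun f q ε x = 0
    rw [h1, h2, add_zero]
  have hζ := hη.smooth.fmul_of_eventually_eq_zero B.isClosed_Z hg hg0
  have hζc := hsupp g hηc
  have hdζ := hζ.extDerivForm isOpen_univ
  have hdζc := hζc.of_isClosed_subset isClosed_closure (formSupport_extDerivForm_subset _)
  have hθg := hθ.smooth.fmul_of_eventually_eq_zero B.isClosed_Z hg hg0
  -- the smoothed volume is the integral of `g θ`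
  have hvol : formIntegral o univ (θ.fmul (1 - ⇑q)) + cutoffIntegral o hK f q θ smoothCutoff ε =
      formIntegral o univ (θ.fmul g) := by
    rw [← formIntegral_eq_cutoffIntegral o hK subset_rfl isClosed_univ (g := cutoffFun f q ε)
      (fun x _ => rfl) (fun x hx => absurd (mem_univ x) hx), ← formIntegral_add]
    · congr 1
      funext x
      exact (add_smul _ _ _).symm
    · exact formIntegrableOn_of_smooth ho (hθ.smooth.fmul_of_eventually_eq_zero B.isClosed_Z
        (g := 1 - ⇑q) (1 - q).contMDiff hq.eventually_one_sub_eq_zero) (hsupp _ hK)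
        isClosed_univ subset_rfl
    · exact formIntegrableOn_of_smooth ho (hθ.smooth.fmul_of_eventually_eq_zero B.isClosed_Z
        hcut hcut0) (hsupp _ hK) isClosed_univ subset_rfl
  -- the difference of `d(g η)` and `g θ` in a chart
  have hkey : ∀ c, ∀ u ∈ (chartAt (EuclideanSpace ℝ (Fin (m + 1))) c).target,
      chartIntegrand o (extDerivForm (η.fmul g)) c u - chartIntegrand o (θ.fmul g) c u =
        ε⁻¹ * deriv smoothCutoff (chartFun f c u / ε) *
          (chartWeight o q c u * wedgeCoeff f η c u) := by
    intro c u hu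
    have h1 : topCoeff (extDerivForm (η.fmul g)) c u - chartFun g c u * topCoeff θ c u =
        chartFun q c u * (ε⁻¹ * deriv smoothCutoff (chartFun f c u / ε)) *
          wedgeCoeff f η c u := by
      by_cases huZ : (chartAt (EuclideanSpace ℝ (Fin (m + 1))) c).symm u ∈ B.Z
      · have h2 : (chartAt (EuclideanSpace ℝ (Fin (m + 1))) c).symm u ∉
            formSupport (η.fmul g) := by
          intro h
          refine mem_closure_iff_frequently.1 h ?_
          filter_upwards [eventually_nhdsSet_iff_forall.1 hg0 _ huZ] with x hx hx'
          exact hx' (by rw [Form.fmul, hx, zero_smul])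
        have h3 : localRep (extDerivForm (η.fmul g)) c u = 0 :=
          localRep_eq_zero fun h => h2 (formSupport_extDerivForm_subset _ h)
        have h4 : localRep θ c u = 0 := by
          rw [localRep, hθ.eq_zero _ huZ]
          rfl
        have h5 : localRep η c u = 0 := by
          rw [localRep, hη.eq_zero _ huZ]
          rfl
        rw [topCoeff, h3, topCoeff, h4, wedgeCoeff, wedgeRep, h5]
        simp [ContinuousAlternatingMap.alternatizeUncurryFin_apply]
      · have h2 : topCoeff θ c u = topCoeff (extDerivForm η) c u := by
          rw [topCoeff, topCoeff, localRep, localRep, hd _ huZ]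
        rw [topCoeff_extDerivForm_fmul hZo hη.smooth hg ⟨hu, huZ⟩, h2, add_sub_cancel_right,
          wedgeCoeff_eq_mul (hder c u hu)]
    rw [chartIntegrand_eq, chartIntegrand_eq, chartDensity_fmul, chartWeight, indicator_of_mem hu]
    have h3 : chartDensity o (extDerivForm (η.fmul g)) c u =
      ((chartSign o c u : SignType) : ℝ) * topCoeff (extDerivForm (η.fmul g)) c u := rfl
    have h4 : chartDensity o θ c u = ((chartSign o c u : SignType) : ℝ) * topCoeff θ c u := rfl
    rw [h3, h4, eq_add_of_sub_eq h1]
    ring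
  have hint1 := formIntegrableOn_of_smooth ho hdζ hdζc isClosed_univ subset_rfl
  have hint2 := formIntegrableOn_of_smooth ho hθg (hsupp g hK) isClosed_univ subset_rfl
  have hsub : ∑ c ∈ chartFinset (m + 1) hηc, ∫ u, ε⁻¹ * deriv smoothCutoff (chartFun f c u / ε) *
        (chartWeight o q c u * wedgeCoeff f η c u) =
      formIntegral o univ (extDerivForm (η.fmul g)) - formIntegral o univ (θ.fmul g) := by
    rw [formIntegral_eq_sum o hηc ((formSupport_extDerivForm_subset _).trans
        ((formSupport_fmul_subset g η).trans inter_subset_right)),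
      formIntegral_eq_sum o hηc
        (((formSupport_fmul_subset g θ).trans inter_subset_right).trans hθη),
      ← Finset.sum_sub_distrib]
    refine Finset.sum_congr rfl fun c _ => ?_
    rw [← integral_sub (hint1.1 c) (hint2.1 c), chartPart_univ,
      ← setIntegral_eq_integral_of_forall_compl_eq_zero
        (s := (chartAt (EuclideanSpace ℝ (Fin (m + 1))) c).target)
        (f := fun u => ε⁻¹ * deriv smoothCutoff (chartFun f c u / ε) *
          (chartWeight o q c u * wedgeCoeff f η c u))]
    · exact setIntegral_congr_fun
        (chartAt (EuclideanSpace ℝ (Fin (m + 1))) c).open_target.measurableSet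
        fun u hu => (hkey c u hu).symm
    · intro u hu
      rw [chartWeight, indicator_of_notMem hu, zero_mul, mul_zero]
  rw [hsub, formIntegral_extDerivForm_eq_zero ho hζ hζc, hvol]
  ring

end Exact

/-! ### The volume polynomial -/

section VolumePolynomial

lemma polynomial_eq_of_tendsto_sub {P Q : Polynomial ℝ} {v : ℝ → ℝ}
    (hP : Tendsto (fun ε : ℝ => P.eval ε⁻¹ - v ε) (𝓝[>] 0) (𝓝 0))
    (hQ : Tendsto (fun ε : ℝ => Q.eval ε⁻¹ - v ε) (𝓝[>] 0) (𝓝 0)) : P = Q := by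
  have h := hP.sub hQ
  rw [sub_zero] at h
  refine sub_eq_zero.1 (polynomial_eq_zero_of_tendsto_inv (h.congr fun ε => ?_))
  rw [Polynomial.eval_sub]
  ring

variable {k m : ℕ} {M : Type*} [TopologicalSpace M]
  [ChartedSpace (EuclideanSpace ℝ (Fin (m + 1))) M]

lemma LocalDefiningFunction.Represents.exists_isDefiningOn {Z : Set M} {j : Jet (m + 1) Z k}
    {y : LocalDefiningFunction (m + 1) Z} (hy : y.Represents j) :
    ∃ (f : C^∞⟮𝓡 (m + 1), M; ℝ⟯) (U : Set M),
      Ideal.Quotient.mk (vanishingIdeal (m + 1) Z ^ k) f = j ∧ IsDefiningOn Z f U ∧ U ⊆ y.dom ∧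
        ∀ x ∈ U, f x = y.toFun x := by
  obtain ⟨f, hf, hfy⟩ := hy
  have hsub : Z ⊆ interior {x | f x = y.toFun x} := subset_interior_iff_mem_nhdsSet.2 hfy
  refine ⟨f, interior {x | f x = y.toFun x} ∩ y.dom, hf,
    ⟨isOpen_interior.inter y.isOpen_dom, subset_inter hsub y.subset_dom, fun x hx => ?_,
      fun x hx => ?_⟩, inter_subset_right,
    fun x hx => interior_subset (s := {x | f x = y.toFun x}) hx.1⟩
  · have h1 : f x = y.toFun x := interior_subset (s := {x | f x = y.toFun x}) hx.1
    rw [h1]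
    exact y.zero_iff x hx.2
  · have h1 : (f : M → ℝ) =ᶠ[𝓝 x] y.toFun := mem_interior_iff_mem_nhds.1 (hsub hx)
    rw [h1.mfderiv_eq]
    exact y.deriv_ne_zero x hx

variable [IsManifold (𝓡 (m + 1)) ∞ M] [T2Space M] [SigmaCompactSpace M] {B : BkStructure k m M}

/-- The volume has an expansion with the coefficients of the smoothed volume. -/
lemma tendsto_expansionPoly_sub_vol {y : LocalDefiningFunction (m + 1) B.Z}
    {f q : C^∞⟮𝓡 (m + 1), M; ℝ⟯} {U : Set M}
    (hUy : U ⊆ y.dom) (hfy : ∀ x ∈ U, f x = y.toFun x) (hq : IsBump B.Z U q)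
    {θ : Form (m + 1) M (m + 1)} (hθ : IsBkForm B θ) (hK : IsCompact (formSupport θ)) {N : ℕ}
    {C : ℝ} {a : ℕ → ℝ}
    (h : ∀ Φ, IsCutoff Φ → Tendsto (fun ε => formIntegral B.orientation univ (θ.fmul (1 - ⇑q)) +
      cutoffIntegral B.orientation hK f q θ Φ ε -
        (C + ∑ j ∈ Finset.range N, a j * moment Φ (j + 2) * ε⁻¹ ^ (j + 1))) (𝓝[>] 0) (𝓝 0)) :
    Tendsto (fun ε : ℝ => (expansionPoly N sharpCutoff C a).eval ε⁻¹ - vol B y ε θ)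
      (𝓝[>] 0) (𝓝 0) := by
  have h1 := ((tendsto_vol_sub_cutoffIntegral hUy hfy hq hθ hK).add
    (h _ isCutoff_sharpCutoff)).neg
  rw [add_zero, neg_zero] at h1
  refine h1.congr fun ε => ?_
  rw [eval_expansionPoly]
  ring

/-- Two local defining functions in the jet lead to the same polynomial. -/
lemma exists_polynomial_tendsto (hk : 1 ≤ k) (hZ : IsCompact B.Z)
    {y y' : LocalDefiningFunction (m + 1) B.Z} (hy : y.Represents B.jet)
    (hy' : y'.Represents B.jet) {θ : Form (m + 1) M (m + 1)} (hθ : θ ∈ bkFormsC B (m + 1)) :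
    ∃ P : Polynomial ℝ,
      Tendsto (fun ε : ℝ => P.eval ε⁻¹ - vol B y ε θ) (𝓝[>] 0) (𝓝 0) ∧
      Tendsto (fun ε : ℝ => P.eval ε⁻¹ - vol B y' ε θ) (𝓝[>] 0) (𝓝 0) := by
  obtain ⟨f, U, hj, hf, hUy, hfy⟩ := hy.exists_isDefiningOn
  obtain ⟨f', U', hj', hf', hUy', hfy'⟩ := hy'.exists_isDefiningOn
  have hopen := hf.isOpen.inter hf'.isOpen
  have hsub := subset_inter hf.subset hf'.subset
  replace hf := hf.mono hopen hsub inter_subset_left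
  replace hf' := hf'.mono hopen hsub inter_subset_right
  obtain ⟨q, hq⟩ := exists_isBump (m := m) hZ hopen hsub
  have hexp : ∀ {g : C^∞⟮𝓡 (m + 1), M; ℝ⟯}, IsDefiningOn B.Z g (U ∩ U') →
      Ideal.Quotient.mk (vanishingIdeal (m + 1) B.Z ^ k) g = B.jet →
      HasExpansion (k - 1) (fun Φ ε => formIntegral B.orientation univ (θ.fmul (1 - ⇑q)) +
        cutoffIntegral B.orientation hθ.2 g q θ Φ ε) := fun hg hgj =>
    (HasExpansion.of_tendsto fun _ _ => tendsto_const_nhds).add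
      (hasExpansion_cutoffIntegral hk hg hgj hq hθ.1 hθ.2)
  obtain ⟨C, a, h⟩ := hexp hf hj
  obtain ⟨C', a', h'⟩ := hexp hf' hj'
  have hv := tendsto_expansionPoly_sub_vol (inter_subset_left.trans hUy)
    (fun x hx => hfy x hx.1) hq hθ.1 hθ.2 h
  have hv' := tendsto_expansionPoly_sub_vol (inter_subset_right.trans hUy')
    (fun x hx => hfy' x hx.2) hq hθ.1 hθ.2 h'
  -- the expansions are compared for the smooth cutoff, and then agree for the sharp one
  have hsmooth : expansionPoly (k - 1) smoothCutoff C a =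
      expansionPoly (k - 1) smoothCutoff C' a' := by
    have h1 := ((h _ isCutoff_smoothCutoff).add
      (tendsto_cutoffIntegral_sub hk hf hf' hj hj' hq hθ.1 hθ.2)).neg
    have h2 := (h' _ isCutoff_smoothCutoff).neg
    rw [add_zero, neg_zero] at h1
    rw [neg_zero] at h2
    refine polynomial_eq_of_tendsto_sub
      (v := fun ε => formIntegral B.orientation univ (θ.fmul (1 - ⇑q)) +
        cutoffIntegral B.orientation hθ.2 f' q θ smoothCutoff ε)
      (h1.congr fun ε => ?_) (h2.congr fun ε => ?_)
    · rw [eval_expansionPoly]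
      ring
    · rw [eval_expansionPoly]
      ring
  rw [← expansionPoly_eq_of_eq (Ψ := sharpCutoff) isCutoff_smoothCutoff hsmooth] at hv'
  exact ⟨_, hv, hv'⟩

/-- The volumes of exact forms tend to zero. -/
lemma tendsto_vol_of_mem_exactFormsC (hk : 1 ≤ k) (hZ : IsCompact B.Z)
    {y : LocalDefiningFunction (m + 1) B.Z} (hy : y.Represents B.jet)
    {θ : Form (m + 1) M (m + 1)} (hθ : θ ∈ exactFormsC B (m + 1)) :
    Tendsto (fun ε => vol B y ε θ) (𝓝[>] 0) (𝓝 0) := by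
  obtain ⟨hθ, η, hη, hd⟩ := hθ
  obtain ⟨f, U, hj, hf, hUy, hfy⟩ := hy.exists_isDefiningOn
  obtain ⟨q, hq⟩ := exists_isBump (m := m) hZ hf.isOpen hf.subset
  obtain ⟨C, a, h⟩ : HasExpansion (k - 1)
      (fun Φ ε => formIntegral B.orientation univ (θ.fmul (1 - ⇑q)) +
        cutoffIntegral B.orientation hθ.2 f q θ Φ ε) :=
    (HasExpansion.of_tendsto fun _ _ => tendsto_const_nhds).add
      (hasExpansion_cutoffIntegral hk hf hj hq hθ.1 hθ.2)
  have hv := tendsto_expansionPoly_sub_vol hUy hfy hq hθ.1 hθ.2 h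
  have h0 : expansionPoly (k - 1) smoothCutoff C a = expansionPoly (k - 1) smoothCutoff 0 0 := by
    have h1 := ((tendsto_cutoffIntegral_of_exact hk hf hj hq hθ.1 hη.1 hη.2 hd hθ.2).sub
      (h _ isCutoff_smoothCutoff))
    rw [sub_zero] at h1
    refine polynomial_eq_of_tendsto_sub (v := 0) (h1.congr fun ε => ?_) ?_
    · rw [eval_expansionPoly, Pi.zero_apply]
      ring
    · simp [eval_expansionPoly]
  rw [expansionPoly_eq_of_eq (Ψ := sharpCutoff) isCutoff_smoothCutoff h0] at hv
  have h1 := hv.neg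
  rw [neg_zero] at h1
  refine h1.congr fun ε => ?_
  simp [eval_expansionPoly]

lemma formIntegrableOn_compl_tube {θ : Form (m + 1) M (m + 1)} (hθ : θ ∈ bkFormsC B (m + 1))
    (y : LocalDefiningFunction (m + 1) B.Z) {ε : ℝ} (hε : 0 < ε) :
    FormIntegrableOn B.orientation (y.tube ε)ᶜ θ :=
  formIntegrableOn_of_smooth B.isOrientation hθ.1.smooth hθ.2 (isOpen_tube y ε).isClosed_compl
    (compl_subset_compl.2 (subset_tube y hε))

theorem exists_isVolumePolynomial (hk : 1 ≤ k) (hZ : IsCompact B.Z)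
    (a : BkCohomologyC B (m + 1)) : ∃ P, IsVolumePolynomial B a P := by
  obtain ⟨y₀, -, hy₀⟩ := B.exists_positive
  obtain ⟨θ₀, hθ₀⟩ := Submodule.Quotient.mk_surjective _ a
  obtain ⟨P, hP, -⟩ := exists_polynomial_tendsto hk hZ hy₀ hy₀ θ₀.2.1
  refine ⟨P, fun y hy θ hθ => ?_⟩
  obtain ⟨Q, hQ₀, hQ⟩ := exists_polynomial_tendsto hk hZ hy₀ hy θ₀.2.1
  obtain rfl := polynomial_eq_of_tendsto_sub hP hQ₀
  have hex : (θ : Form (m + 1) M (m + 1)) - θ₀ ∈ exactFormsC B (m + 1) :=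
    (Submodule.Quotient.eq ((exactFormsC B (m + 1)).submoduleOf (closedFormsC B (m + 1)))).1
      (hθ.trans hθ₀.symm)
  have h1 := hQ.sub (tendsto_vol_of_mem_exactFormsC hk hZ hy hex)
  rw [sub_zero] at h1
  refine h1.congr' ?_
  filter_upwards [self_mem_nhdsWithin] with ε hε
  have h2 := formIntegral_add B.orientation (formIntegrableOn_compl_tube θ₀.2.1 y hε)
    (formIntegrableOn_compl_tube (sub_mem θ.2.1 θ₀.2.1) y hε)
  rw [add_sub_cancel] at h2
  simp only [vol]
  rw [h2]
  ring

lemma IsVolumePolynomial.unique {a : BkCohomologyC B (m + 1)} {P Q : Polynomial ℝ}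
    (hP : IsVolumePolynomial B a P) (hQ : IsVolumePolynomial B a Q) : P = Q := by
  obtain ⟨y, -, hy⟩ := B.exists_positive
  obtain ⟨θ, hθ⟩ := Submodule.Quotient.mk_surjective _ a
  exact polynomial_eq_of_tendsto_sub (hP y hy θ hθ) (hQ y hy θ hθ)

lemma IsVolumePolynomial.eq_volumePolynomial {a : BkCohomologyC B (m + 1)} {P : Polynomial ℝ}
    (hP : IsVolumePolynomial B a P) : volumePolynomial B a = P := by
  have h : ∃ P, IsVolumePolynomial B a P := ⟨P, hP⟩
  rw [volumePolynomial, dif_pos h]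
  exact h.choose_spec.unique hP

end VolumePolynomial

end BK

end

theorem mainTheorem4 (k m : ℕ) (hk : 1 ≤ k) (M : Type*) [TopologicalSpace M]
    [ChartedSpace (EuclideanSpace ℝ (Fin (m + 1))) M] [IsManifold (𝓡 (m + 1)) ∞ M]
    [T2Space M] [SigmaCompactSpace M]
    (B : BK.BkStructure k m M) (hZ : IsCompact B.Z) (a : BK.BkCohomologyC B (m + 1)) :
    -- the integrals that define `vol_{y, ε}(θ)` converge absolutely
    (∀ y : BK.LocalDefiningFunction (m + 1) B.Z, y.Represents B.jet →
      ∀ θ : BK.closedFormsC B (m + 1), BK.bkClass θ = a → ∀ ε : ℝ, 0 < ε →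
        BK.FormIntegrableOn B.orientation (y.tube ε)ᶜ (θ : BK.Form (m + 1) M (m + 1))) ∧
    -- there is exactly one volume polynomial; its constant term is the Liouville volume
    ∃ P : Polynomial ℝ, BK.IsVolumePolynomial B a P ∧
      (∀ Q : Polynomial ℝ, BK.IsVolumePolynomial B a Q → Q = P) ∧
      P.coeff 0 = BK.liouvilleVolume B a := by
  obtain ⟨P, hP⟩ := BK.exists_isVolumePolynomial hk hZ a
  refine ⟨fun y _ θ _ ε hε => BK.formIntegrableOn_compl_tube θ.2.1 y hε, P, hP,
    fun Q hQ => hQ.unique hP, ?_⟩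
  rw [BK.liouvilleVolume, hP.eq_volumePolynomial, Polynomial.coeff_zero_eq_eval_zero]
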